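/- Let $n\ge 0$, $I=[0,1]$ and let $J=\begin{pmatrix}0&-I_n\\ I_n&0\end{pmatrix}$ be the standard symplectic matrix on $\mathbb{R}^{2n}$. Let $S=\{S_\lambda\}_{\lambda\in I}$ be a continuous family of symmetric $2n\times 2n$-matrices and let $R:I\times\mathbb{R}^{2n}\to\mathbb{R}$ be a $C^2$-map such that $\nabla_uR(\lambda,u)=o(\|u\|)$ as $u\to0$ for each $\lambda$ and $\|D_u^2R(\lambda,u)\|\le a+b\|u\|^r$ for some $a,b,r>0$ and all $(\lambda,u)$. Let $G_0$ be a compact group (for example, a compact Lie group) with a continuous homomorphism into $O(2n)$ such that $g^TJg=J$ and $gS_\lambda=S_\lambda g$ for all $g\in G_0$, $\lambda\in I$. Let $S^1=\mathbb{R}/2\pi\mathbb{Z}$ and let $G=G_0\times S^1$ act on $$H=H^{1/2}(S^1,\mathbb{R}^{2n})=\Big\{u=b_0+\sum_{k\ge1}(\sin(kt)a_k+\cos(kt)b_k):\ \sum_{k\ge 1} k(|a_k|^2+|b_k|^2)<\infty\Big\},$$ $$\langle u,u'\rangle_{H}=2\pi\langle b_0,b_0'\rangle+\pi\sum_{k\ge1}k\,(\langle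 a_k,a_k'\rangle+\langle b_k,b_k'\rangle),$$ by $((g,\Theta)u)(t)=g\,u(t+\Theta)$. Let $RO(G)$ be the Grothendieck group of isomorphism classes of finite dimensional continuous real representations of $G$ under direct sums. There is a bounded bilinear form $\Gamma$ on $H$ with $\Gamma(u,v)=\int_0^{2\pi}\langle Ju'(t),v(t)\rangle\,dt$ for all $u\in H^1(S^1,\mathbb{R}^{2n})$, $v\in H$, and there are bounded operators $L_\lambda$ on $H$, $\lambda\in I$, determined by $$\langle L_\lambda u,v\rangle_H=\Gamma(u,v)+\int_0^{2\pi}\langle S_\lambda u(t),v(t)\rangle\,dt .$$ The operator $L_\lambda$ is the Hessian at $0$ of the quadratic functional $u\mapsto\frac12\Gamma(u,u)+\frac12\int_0^{2\pi}\langle S_\lambda u,u\rangle\,dt$. It is also the only operator that can be the Hessian at $0$ of the Hamiltonian action functional $f_\lambda(u)=\frac12\Gamma(u,u)+\int_0^{2\pi}\big(\tfrac12\langle S_\lambda u,u\rangle+R(\lambda,u)\big)dt$: whenever $f_\lambda$ is differentiable near $0$ and twice differentiable at $0$, its Hessian there is $L_\lambda$. Moreover, $L=\{L_\lambda\}_{\lambda\in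 I}$ is a norm-continuous path of $G$-equivariant selfadjoint Fredholm operators. There are a partition $0=\lambda_0<\dots<\lambda_N=1$ and numbers $a_i>0$ such that, for $\lambda\in[\lambda_{i-1},\lambda_i]$, $\pm a_i\notin\sigma(L_\lambda)$ and $[-a_i,a_i]\cap\sigma_{ess}(L_\lambda)=\emptyset$. For all such choices, $$\mathrm{sfl}_G(L)=\sum_{i=1}^N\big([E(L_{\lambda_i},[0,a_i])]-[E(L_{\lambda_{i-1}},[0,a_i])]\big)\in RO(G)$$ is the same element, where $E(T,[0,a])$ is the sum of the eigenspaces of $T$ for eigenvalues in $[0,a]$. For $k\ge1$ let $$A_k(\lambda)=\begin{pmatrix}\frac1kS_\lambda&-J\\ J&\frac1kS_\lambda\end{pmatrix},$$ and let $G$ act on $\mathbb{R}^{4n}$ by $$(g,\Theta)\mapsto\begin{pmatrix}\cos(k\Theta)I_{2n}&-\sin(k\Theta)I_{2n}\\ \sin(k\Theta)I_{2n}&\cos(k\Theta)I_{2n}\end{pmatrix}\begin{pmatrix}g&0\\0&g\end{pmatrix}.$$ Write $E^-(A)$ for the sum of the eigenspaces of a symmetric matrix $A$ for its negative eigenvalues;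 on $E^-(S_0),E^-(S_1)\subset\mathbb{R}^{2n}$ the group $G_0$ acts by its action on $\mathbb{R}^{2n}$ and $S^1$ acts trivially. Then $$[E^-(A_k(0))]-[E^-(A_k(1))]=0\in RO(G)\quad\text{for all but finitely many }k\ge 1,$$ and $$\mathrm{sfl}_G(L)=[E^-(S_0)]-[E^-(S_1)]+\sum_{k=1}^\infty\big([E^-(A_k(0))]-[E^-(A_k(1))]\big)\in RO(G).$$ -/

import Mathlib

open MeasureTheory Topology Filter Set
open scoped ContDiff RealInnerProductSpace

noncomputable section

namespace EquivariantSpectralFlow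

/-! ### The real representation ring as an abelian group -/

/-- A finite dimensional continuous linear real representation of `G`.  (On a finite dimensional
space, continuity means that all the matrix coefficients are continuous.) -/
structure FinRep (G : Type*) [Group G] [TopologicalSpace G] where
  carrier : Type
  [addCommGroup : AddCommGroup carrier]
  [module : Module ℝ carrier]
  [finite : FiniteDimensional ℝ carrier]
  rep : Representation ℝ G carrier
  continuous_coeff : ∀ (v : carrier) (f : Module.Dual ℝ carrier), Continuous fun g => f (rep g v)

attribute [instance] FinRep.addCommGroup FinRep.module FinRep.finite

namespace FinRep

variable {G : Type*} [Group G] [TopologicalSpace G]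

/-- Isomorphism of representations: an intertwining linear isomorphism. -/
def Iso (U V : FinRep G) : Prop :=
  ∃ e : U.carrier ≃ₗ[ℝ] V.carrier, ∀ g u, e (U.rep g u) = V.rep g (e u)

/-- The direct sum `U ⊕ V`. -/
def dsum (U V : FinRep G) : FinRep G where
  carrier := U.carrier × V.carrier
  rep := U.rep.prod V.rep
  continuous_coeff v f := by
    have h : (fun g => f ((U.rep.prod V.rep) g v)) = fun g =>
        (f ∘ₗ LinearMap.inl ℝ U.carrier V.carrier) (U.rep g v.1)
          + (f ∘ₗ LinearMap.inr ℝ U.carrier V.carrier) (V.rep g v.2) := by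
      funext g
      simp [← map_add]
    rw [h]
    exact (U.continuous_coeff v.1 _).add (V.continuous_coeff v.2 _)

/-- The zero representation. -/
def zero : FinRep G where
  carrier := PUnit
  rep := 1
  continuous_coeff v f := by
    have h : (fun g => f ((1 : Representation ℝ G PUnit) g v)) = fun _ => 0 := by
      funext g
      rw [Subsingleton.elim ((1 : Representation ℝ G PUnit) g v) 0, map_zero]
    rw [h]
    exact continuous_const

instance isoSetoid (G : Type*) [Group G] [TopologicalSpace G] : Setoid (FinRep G) where
  r := Iso
  iseqv :=
    { refl := fun U => ⟨LinearEquiv.refl ℝ _, fun _ _ => rfl⟩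
      symm := by
        rintro U V ⟨e, he⟩
        refine ⟨e.symm, fun g v => ?_⟩
        rw [LinearEquiv.symm_apply_eq, he, LinearEquiv.apply_symm_apply]
      trans := by
        rintro U V W ⟨e, he⟩ ⟨f, hf⟩
        exact ⟨e.trans f, fun g u => by simp [he, hf]⟩ }

end FinRep

/-- Isomorphism classes of finite dimensional continuous real representations of `G`. -/
def RepClass (G : Type*) [Group G] [TopologicalSpace G] : Type _ :=
  Quotient (FinRep.isoSetoid G)

instance (G : Type*) [Group G] [TopologicalSpace G] : Add (RepClass G) where
  add := Quotient.map₂ FinRep.dsum (by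
    rintro U U' ⟨e, he⟩ V V' ⟨f, hf⟩
    exact ⟨e.prodCongr f, fun g u => Prod.ext (he g u.1) (hf g u.2)⟩)

instance (G : Type*) [Group G] [TopologicalSpace G] : Zero (RepClass G) where
  zero := Quotient.mk _ FinRep.zero

instance (G : Type*) [Group G] [TopologicalSpace G] : AddCommMonoid (RepClass G) where
  add_assoc := by
    rintro ⟨U⟩ ⟨V⟩ ⟨W⟩
    exact Quotient.sound ⟨LinearEquiv.prodAssoc ℝ _ _ _, fun _ _ => rfl⟩
  zero_add := by
    rintro ⟨U⟩
    exact Quotient.sound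
      ⟨(LinearEquiv.uniqueProd : (PUnit × U.carrier) ≃ₗ[ℝ] U.carrier), fun _ _ => rfl⟩
  add_zero := by
    rintro ⟨U⟩
    exact Quotient.sound
      ⟨(LinearEquiv.prodUnique : (U.carrier × PUnit) ≃ₗ[ℝ] U.carrier), fun _ _ => rfl⟩
  add_comm := by
    rintro ⟨U⟩ ⟨V⟩
    exact Quotient.sound ⟨LinearEquiv.prodComm ℝ _ _, fun _ _ => rfl⟩
  nsmul := nsmulRec

/-- `RO(G)`: the Grothendieck group of the monoid of isomorphism classes under direct sum. -/
abbrev RO (G : Type*) [Group G] [TopologicalSpace G] : Type _ :=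
  Algebra.GrothendieckAddGroup (RepClass G)

/-- The class in `RO(G)` of a representation. -/
def FinRep.toRO {G : Type*} [Group G] [TopologicalSpace G] (U : FinRep G) : RO G :=
  Algebra.GrothendieckAddGroup.of (Quotient.mk (FinRep.isoSetoid G) U : RepClass G)

section Classes

variable {G : Type*} [Group G] [TopologicalSpace G]
variable {V : Type} [AddCommGroup V] [Module ℝ V] [TopologicalSpace V]

/-- `E` is a finite dimensional `π`-invariant subspace on which `G` acts continuously. -/
def IsFinSubrep (π : Representation ℝ G V) (E : Submodule ℝ V) : Prop :=
  FiniteDimensional ℝ E ∧ (∀ g, E ≤ E.comap (π g)) ∧ ∀ v ∈ E, Continuous fun g => π g v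

/-- A finite dimensional invariant subspace, as a representation of its own. -/
def subRep [IsTopologicalAddGroup V] [ContinuousSMul ℝ V] [T2Space V]
    (π : Representation ℝ G V) (E : Submodule ℝ V) (h : IsFinSubrep π E) : FinRep G :=
  haveI := h.1
  { carrier := E
    rep := π.subrepresentation E h.2.1
    continuous_coeff := fun v f =>
      (LinearMap.continuous_of_finiteDimensional f).comp
        (Continuous.subtype_mk (h.2.2 v v.2) fun g => h.2.1 g v.2) }

open Classical in
/-- The class `[E] ∈ RO(G)` of a finite dimensional invariant subspace `E` of the representation
`π` (and `0` if `E` is not such a subspace). -/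
def roClass [IsTopologicalAddGroup V] [ContinuousSMul ℝ V] [T2Space V]
    (π : Representation ℝ G V) (E : Submodule ℝ V) : RO G :=
  if h : IsFinSubrep π E then (subRep π E h).toRO else 0

end Classes

/-! ### Eigenspaces and the equivariant spectral flow -/

/-- The sum of the eigenspaces of `T` for the eigenvalues in `s`. -/
def eigSum {V : Type*} [AddCommGroup V] [Module ℝ V] (T : Module.End ℝ V) (s : Set ℝ) :
    Submodule ℝ V :=
  ⨆ μ ∈ s, T.eigenspace μ

section SpectralFlow

variable {G : Type*} [Group G] [TopologicalSpace G]
variable {V : Type} [NormedAddCommGroup V] [InnerProductSpace ℝ V]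

/-- The essential spectrum: the `μ` for which `T - μ` is not Fredholm. -/
def essSpectrum (T : V →L[ℝ] V) : Set ℝ :=
  {μ | ¬ (T - μ • ContinuousLinearMap.id ℝ V).IsFredholm}

/-- A path `A : [0,1] → FS_G(V)` of `G`-equivariant bounded selfadjoint Fredholm operators,
continuous for the operator norm. (An everywhere defined bounded operator is selfadjoint
if and only if it is symmetric.) -/
structure IsFSPath (π : Representation ℝ G V) (A : ℝ → V →L[ℝ] V) : Prop where
  continuousOn : ContinuousOn A (Icc 0 1)
  symmetric : ∀ l ∈ Icc (0 : ℝ) 1, (A l : V →ₗ[ℝ] V).IsSymmetric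
  fredholm : ∀ l ∈ Icc (0 : ℝ) 1, (A l).IsFredholm
  equivariant : ∀ l ∈ Icc (0 : ℝ) 1, ∀ g u, A l (π g u) = π g (A l u)

/-- A partition `0 = λ₀ < … < λ_N = 1` with numbers `aᵢ > 0` such that, for
`λ ∈ [λᵢ₋₁, λᵢ]`, `± aᵢ ∉ σ(A_λ)` and `[-aᵢ, aᵢ]` does not meet the essential spectrum. -/
structure SpectralPartition (A : ℝ → V →L[ℝ] V) where
  N : ℕ
  pt : Fin (N + 1) → ℝ
  a : Fin N → ℝ
  pt_strictMono : StrictMono pt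
  pt_zero : pt 0 = 0
  pt_last : pt (Fin.last N) = 1
  a_pos : ∀ i, 0 < a i
  notMem_spectrum : ∀ i, ∀ l ∈ Icc (pt i.castSucc) (pt i.succ),
    a i ∉ spectrum ℝ (A l) ∧ -a i ∉ spectrum ℝ (A l)
  disjoint_essSpectrum : ∀ i, ∀ l ∈ Icc (pt i.castSucc) (pt i.succ),
    Disjoint (Icc (-a i) (a i)) (essSpectrum (A l))

/-- The sum `∑ᵢ ([E(A_{λᵢ}, [0, aᵢ])] - [E(A_{λᵢ₋₁}, [0, aᵢ])])` in `RO(G)`. -/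
def SpectralPartition.flow {A : ℝ → V →L[ℝ] V} (P : SpectralPartition A)
    (π : Representation ℝ G V) : RO G :=
  ∑ i : Fin P.N,
    (roClass π (eigSum (A (P.pt i.succ) : V →ₗ[ℝ] V) (Icc 0 (P.a i)))
      - roClass π (eigSum (A (P.pt i.castSucc) : V →ₗ[ℝ] V) (Icc 0 (P.a i))))

open Classical in
/-- The `G`-equivariant spectral flow of the path `A`, computed from any admissible partition
(`0` if there is none). -/
def sflG (π : Representation ℝ G V) (A : ℝ → V →L[ℝ] V) : RO G :=
  if h : Nonempty (SpectralPartition A) then h.some.flow π else 0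

end SpectralFlow

/-! ### The Sobolev space `H^{1/2}(S¹, ℝ²ⁿ)` -/

/-- Indices of the coordinates of `ℝ²ⁿ`. -/
abbrev Idx (n : ℕ) : Type := Fin n ⊕ Fin n

/-- The Euclidean space `ℝ²ⁿ`. -/
abbrev Phase (n : ℕ) : Type := EuclideanSpace ℝ (Idx n)

instance twoPiPos : Fact (0 < 2 * Real.pi) := ⟨Real.two_pi_pos⟩

/-- The circle `ℝ / 2πℤ`; its measure `volume` has total mass `2π`. -/
abbrev Circ : Type := AddCircle (2 * Real.pi)

/-- The circle group `S¹ = ℝ / 2πℤ`, written multiplicatively. -/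
abbrev S1 : Type := Multiplicative Circ

/-- `L²(S¹, ℝ²ⁿ)`. -/
abbrev L2 (n : ℕ) : Type := Lp (Phase n) 2 (volume : Measure Circ)

/-- `sin : ℝ / 2πℤ → ℝ`. -/
def csin : Circ → ℝ := Real.sin_periodic.lift

/-- `cos : ℝ / 2πℤ → ℝ`. -/
def ccos : Circ → ℝ := Real.cos_periodic.lift

lemma csin_coe (t : ℝ) : csin (t : Circ) = Real.sin t := Function.Periodic.lift_coe _ _

lemma ccos_coe (t : ℝ) : ccos (t : Circ) = Real.cos t := Function.Periodic.lift_coe _ _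

lemma continuous_csin : Continuous csin := continuous_quot_lift _ Real.continuous_sin

lemma continuous_ccos : Continuous ccos := continuous_quot_lift _ Real.continuous_cos

lemma csin_add (s t : Circ) : csin (s + t) = csin s * ccos t + ccos s * csin t := by
  induction s using QuotientAddGroup.induction_on with | _ s
  induction t using QuotientAddGroup.induction_on with | _ t
  have h : ((s : Circ) + (t : Circ)) = ((s + t : ℝ) : Circ) := rfl
  change csin ((s : Circ) + (t : Circ)) = csin (s : Circ) * ccos (t : Circ)
    + ccos (s : Circ) * csin (t : Circ)
  rw [h]
  simp only [csin_coe, ccos_coe, Real.sin_add]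

lemma ccos_add (s t : Circ) : ccos (s + t) = ccos s * ccos t - csin s * csin t := by
  induction s using QuotientAddGroup.induction_on with | _ s
  induction t using QuotientAddGroup.induction_on with | _ t
  have h : ((s : Circ) + (t : Circ)) = ((s + t : ℝ) : Circ) := rfl
  change ccos ((s : Circ) + (t : Circ)) = ccos (s : Circ) * ccos (t : Circ)
    - csin (s : Circ) * csin (t : Circ)
  rw [h]
  simp only [csin_coe, ccos_coe, Real.cos_add]

lemma csin_zero : csin 0 = 0 := by simpa using csin_coe 0

lemma ccos_zero : ccos 0 = 1 := by simpa using ccos_coe 0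

lemma csin_neg (t : Circ) : csin (-t) = -csin t := by
  induction t using QuotientAddGroup.induction_on with | _ t
  change csin ((-t : ℝ) : Circ) = -csin (t : Circ)
  simp only [csin_coe, Real.sin_neg]

lemma ccos_neg (t : Circ) : ccos (-t) = ccos t := by
  induction t using QuotientAddGroup.induction_on with | _ t
  change ccos ((-t : ℝ) : Circ) = ccos (t : Circ)
  simp only [ccos_coe, Real.cos_neg]

variable {n : ℕ}

lemma integrable_L2 (u : L2 n) : Integrable (fun t => u t) (volume : Measure Circ) :=
  (Lp.memLp u).integrable (by norm_num)

lemma integrable_smul_L2 {f : Circ → ℝ} (hf : Continuous f) (u : L2 n) :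
    Integrable (fun t => f t • u t) (volume : Measure Circ) := by
  obtain ⟨C, hC⟩ := isCompact_univ.exists_bound_of_continuousOn hf.continuousOn
  refine ((integrable_L2 u).norm.const_mul C).mono'
    (hf.aestronglyMeasurable.smul (Lp.aestronglyMeasurable u))
    (Eventually.of_forall fun t => ?_)
  rw [norm_smul]
  exact mul_le_mul_of_nonneg_right (hC t (mem_univ t)) (norm_nonneg _)

/-- `u ↦ ∫ f(t) u(t) dt` for continuous `f`. -/
def pairing (f : Circ → ℝ) (hf : Continuous f) : L2 n →ₗ[ℝ] Phase n where
  toFun u := ∫ t, f t • u t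
  map_add' u v := by
    rw [← integral_add (integrable_smul_L2 hf u) (integrable_smul_L2 hf v)]
    refine integral_congr_ae ?_
    filter_upwards [Lp.coeFn_add u v] with t ht
    rw [ht, Pi.add_apply, smul_add]
  map_smul' c u := by
    rw [RingHom.id_apply, ← integral_smul]
    refine integral_congr_ae ?_
    filter_upwards [Lp.coeFn_smul c u] with t ht
    rw [ht, Pi.smul_apply, smul_comm]

/-- The constant Fourier coefficient `b₀ = (1 / 2π) ∫ u`. -/
def meanCoeff : L2 n →ₗ[ℝ] Phase n :=
  (1 / (2 * Real.pi)) • pairing (fun _ => 1) continuous_const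

/-- The Fourier coefficient `aₖ = (1 / π) ∫ sin(kt) u(t) dt`, `k ≥ 1`. -/
def sinCoeff (k : ℕ) : L2 n →ₗ[ℝ] Phase n :=
  (1 / Real.pi) • pairing (fun t => csin (k • t)) (continuous_csin.comp (continuous_const_smul k))

/-- The Fourier coefficient `bₖ = (1 / π) ∫ cos(kt) u(t) dt`, `k ≥ 1`. -/
def cosCoeff (k : ℕ) : L2 n →ₗ[ℝ] Phase n :=
  (1 / Real.pi) • pairing (fun t => ccos (k • t)) (continuous_ccos.comp (continuous_const_smul k))


lemma fourier_eq_ccos_csin (k : ℕ) (t : Circ) :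
    fourier (k : ℤ) t = (ccos (k • t) : ℂ) + (csin (k • t) : ℂ) * Complex.I := by
  induction t using QuotientAddGroup.induction_on with | _ t
  change fourier (k : ℤ) (t : Circ) = (ccos ((k • t : ℝ) : Circ) : ℂ)
    + (csin ((k • t : ℝ) : Circ) : ℂ) * Complex.I
  rw [fourier_coe_apply, ccos_coe, csin_coe, Complex.ofReal_cos, Complex.ofReal_sin,
    ← Complex.exp_mul_I]
  congr 1
  have : (Real.pi : ℂ) ≠ 0 := by exact_mod_cast Real.pi_ne_zero
  push_cast
  simp only [nsmul_eq_mul]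
  field_simp

/-- A function in `L²` all of whose Fourier coefficients vanish is zero. -/
lemma eq_zero_of_coeff (u : L2 n) (h0 : meanCoeff u = 0)
    (hs : ∀ k : ℕ, k ≠ 0 → sinCoeff k u = 0) (hc : ∀ k : ℕ, k ≠ 0 → cosCoeff k u = 0) :
    u = 0 := by
  have hpi : (1 / Real.pi) ≠ 0 := by positivity
  have hpi2 : (1 / (2 * Real.pi)) ≠ 0 := by positivity
  have hS : ∀ k : ℕ, ∫ t, csin (k • t) • u t = 0 := by
    intro k
    rcases eq_or_ne k 0 with rfl | hk
    · simp [csin_zero]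
    · exact (smul_eq_zero.1 (hs k hk)).resolve_left hpi
  have hC : ∀ k : ℕ, ∫ t, ccos (k • t) • u t = 0 := by
    intro k
    rcases eq_or_ne k 0 with rfl | hk
    · have := (smul_eq_zero.1 h0).resolve_left hpi2
      simpa [ccos_zero, pairing] using this
    · exact (smul_eq_zero.1 (hc k hk)).resolve_left hpi
  have key : ∀ i : Idx n, (fun t => u t i) =ᵐ[(volume : Measure Circ)] 0 := by
    intro i
    have hmem : MemLp (fun t => ((u t i : ℝ) : ℂ)) 2 (volume : Measure Circ) :=
      (((EuclideanSpace.proj i : Phase n →L[ℝ] ℝ).comp_memLp' (Lp.memLp u))).ofReal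
    have hmem' : MemLp (fun t => ((u t i : ℝ) : ℂ)) 2
        (AddCircle.haarAddCircle : Measure Circ) := memLp_haarAddCircle_iff.2 hmem
    have hreal : ∀ {f : Circ → ℝ} (_ : Continuous f), ∫ t, f t • u t = 0 →
        ∫ t, (f t : ℂ) * ((u t i : ℝ) : ℂ) = 0 := by
      intro f hf h
      have h1 := (EuclideanSpace.proj i : Phase n →L[ℝ] ℝ).integral_comp_comm
        (integrable_smul_L2 hf u)
      rw [h, map_zero] at h1
      have h2 : ∫ t, f t * u t i = 0 := by simpa using h1
      have h3 : ∫ t, ((f t * u t i : ℝ) : ℂ) = 0 := by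
        rw [integral_complex_ofReal, h2, Complex.ofReal_zero]
      simpa using h3
    have hint : ∀ {f : Circ → ℝ} (_ : Continuous f),
        Integrable (fun t => (f t : ℂ) * ((u t i : ℝ) : ℂ)) (volume : Measure Circ) := by
      intro f hf
      have h1 := ((EuclideanSpace.proj i : Phase n →L[ℝ] ℝ).integrable_comp
        (integrable_smul_L2 hf u)).ofReal (𝕜 := ℂ)
      refine h1.congr (Eventually.of_forall fun t => ?_)
      simp
    have hcs : ∀ k : ℕ, Continuous fun t : Circ => csin (k • t) := fun k =>
      continuous_csin.comp (continuous_const_smul k)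
    have hcc : ∀ k : ℕ, Continuous fun t : Circ => ccos (k • t) := fun k =>
      continuous_ccos.comp (continuous_const_smul k)
    have hplus : ∀ k : ℕ, ∫ t : Circ, fourier (k : ℤ) t • ((u t i : ℝ) : ℂ) = 0 := by
      intro k
      have : (fun t : Circ => fourier (k : ℤ) t • ((u t i : ℝ) : ℂ)) = fun t =>
          (ccos (k • t) : ℂ) * ((u t i : ℝ) : ℂ)
            + Complex.I * ((csin (k • t) : ℂ) * ((u t i : ℝ) : ℂ)) := by
        funext t
        rw [fourier_eq_ccos_csin, smul_eq_mul]
        ring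
      rw [this, integral_add (hint (hcc k)) ((hint (hcs k)).const_mul _),
        integral_const_mul, hreal (hcc k) (hC k), hreal (hcs k) (hS k)]
      simp
    have hminus : ∀ k : ℕ, ∫ t : Circ, fourier (-(k : ℤ)) t • ((u t i : ℝ) : ℂ) = 0 := by
      intro k
      have : (fun t : Circ => fourier (-(k : ℤ)) t • ((u t i : ℝ) : ℂ)) = fun t =>
          (ccos (k • t) : ℂ) * ((u t i : ℝ) : ℂ)
            - Complex.I * ((csin (k • t) : ℂ) * ((u t i : ℝ) : ℂ)) := by
        funext t
        rw [fourier_neg, fourier_eq_ccos_csin, smul_eq_mul]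
        simp only [map_add, map_mul, Complex.conj_ofReal, Complex.conj_I]
        ring
      rw [this, integral_sub (hint (hcc k)) ((hint (hcs k)).const_mul _),
        integral_const_mul, hreal (hcc k) (hC k), hreal (hcs k) (hS k)]
      simp
    have hall : ∀ m : ℤ, fourierCoeff (fun t : Circ => ((u t i : ℝ) : ℂ)) m = 0 := by
      intro m
      rw [fourierCoeff, AddCircle.integral_haarAddCircle]
      obtain ⟨k, rfl | rfl⟩ := m.eq_nat_or_neg
      · rw [hminus, smul_zero]
      · rw [neg_neg, hplus, smul_zero]
    have hz : hmem'.toLp = 0 := by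
      have h1 := hasSum_fourier_series_L2 (hmem'.toLp)
      have h2 : ∀ m : ℤ, fourierCoeff (hmem'.toLp : Circ → ℂ) m = 0 := fun m => by
        rw [fourierCoeff_congr_ae hmem'.coeFn_toLp, hall m]
      simp only [h2, zero_smul] at h1
      exact h1.unique hasSum_zero
    have h3 : (fun t => ((u t i : ℝ) : ℂ)) =ᵐ[(AddCircle.haarAddCircle : Measure Circ)] 0 := by
      have := hmem'.coeFn_toLp
      rw [hz] at this
      exact this.symm.trans (Lp.coeFn_zero _ _ _)
    have h4 : (fun t => ((u t i : ℝ) : ℂ)) =ᵐ[(volume : Measure Circ)] 0 :=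
      Measure.ae_smul_measure h3 _
    filter_upwards [h4] with t ht
    simpa using ht
  apply Lp.ext
  have hall := ae_all_iff.2 key
  filter_upwards [hall, Lp.coeFn_zero (Phase n) 2 (volume : Measure Circ)] with t ht hz
  rw [hz]
  ext i
  simpa using ht i

/-- The subspace of those `u ∈ L²(S¹, ℝ²ⁿ)` with `∑ k (|aₖ|² + |bₖ|²) < ∞`. -/
def halfSubmodule (n : ℕ) : Submodule ℝ (L2 n) where
  carrier := {u | Summable fun k : ℕ => (k : ℝ) * (‖sinCoeff k u‖ ^ 2 + ‖cosCoeff k u‖ ^ 2)}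
  add_mem' {u v} hu hv := by
    refine Summable.of_nonneg_of_le (fun k => by positivity) (fun k => ?_)
      ((hu.add hv).mul_left 2)
    rw [map_add, map_add]
    have h1 : ∀ x y : Phase n, ‖x + y‖ ^ 2 ≤ 2 * (‖x‖ ^ 2 + ‖y‖ ^ 2) := fun x y => by
      nlinarith [norm_add_le x y, norm_nonneg (x + y), sq_nonneg (‖x‖ - ‖y‖),
        norm_nonneg x, norm_nonneg y]
    have h2 := h1 (sinCoeff k u) (sinCoeff k v)
    have h3 := h1 (cosCoeff k u) (cosCoeff k v)
    have hk : (0 : ℝ) ≤ k := k.cast_nonneg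
    nlinarith [mul_le_mul_of_nonneg_left (add_le_add h2 h3) hk]
  zero_mem' := by simp [summable_zero]
  smul_mem' c u hu := by
    refine (hu.mul_left (c ^ 2)).congr fun k => ?_
    rw [map_smul, map_smul, norm_smul, norm_smul, mul_pow, mul_pow, Real.norm_eq_abs, sq_abs]
    ring

/-- The Sobolev space `H^{1/2}(S¹, ℝ²ⁿ)`. -/
def HHalf (n : ℕ) : Type := halfSubmodule n

instance (n : ℕ) : AddCommGroup (HHalf n) := inferInstanceAs (AddCommGroup (halfSubmodule n))

instance (n : ℕ) : Module ℝ (HHalf n) := inferInstanceAs (Module ℝ (halfSubmodule n))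

/-- The inclusion `H^{1/2} → L²`. -/
def HHalf.toL2 : HHalf n →ₗ[ℝ] L2 n := (halfSubmodule n).subtype

lemma HHalf.toL2_injective : Function.Injective (HHalf.toL2 (n := n)) :=
  Subtype.val_injective

lemma HHalf.summable (u : HHalf n) : Summable fun k : ℕ =>
    (k : ℝ) * (‖sinCoeff k u.toL2‖ ^ 2 + ‖cosCoeff k u.toL2‖ ^ 2) := u.2

lemma HHalf.summable_inner (u v : HHalf n) : Summable fun k : ℕ =>
    (k : ℝ) * (⟪sinCoeff k u.toL2, sinCoeff k v.toL2⟫ + ⟪cosCoeff k u.toL2, cosCoeff k v.toL2⟫) := by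
  refine Summable.of_norm_bounded (u.summable.add v.summable) fun k => ?_
  have h1 : ∀ x y : Phase n, |⟪x, y⟫| ≤ ‖x‖ ^ 2 + ‖y‖ ^ 2 := fun x y => by
    nlinarith [abs_real_inner_le_norm x y, sq_nonneg (‖x‖ - ‖y‖), sq_nonneg (‖x‖ + ‖y‖)]
  have h2 := h1 (sinCoeff k u.toL2) (sinCoeff k v.toL2)
  have h3 := h1 (cosCoeff k u.toL2) (cosCoeff k v.toL2)
  have hk : (0 : ℝ) ≤ k := k.cast_nonneg
  rw [Real.norm_eq_abs, abs_mul, abs_of_nonneg hk]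
  have h4 := (abs_add_le ⟪sinCoeff k u.toL2, sinCoeff k v.toL2⟫
    ⟪cosCoeff k u.toL2, cosCoeff k v.toL2⟫).trans (add_le_add h2 h3)
  nlinarith [mul_le_mul_of_nonneg_left h4 hk]

/-- The usual scalar product of `H^{1/2}`:
`⟨u, v⟩ = 2π ⟨b₀, b₀'⟩ + π ∑ₖ k (⟨aₖ, aₖ'⟩ + ⟨bₖ, bₖ'⟩)`. -/
@[reducible]
def halfCore (n : ℕ) : InnerProductSpace.Core ℝ (HHalf n) where
  inner u v := 2 * Real.pi * ⟪meanCoeff u.toL2, meanCoeff v.toL2⟫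
    + Real.pi * ∑' k : ℕ, (k : ℝ) *
      (⟪sinCoeff k u.toL2, sinCoeff k v.toL2⟫ + ⟪cosCoeff k u.toL2, cosCoeff k v.toL2⟫)
  conj_inner_symm u v := by
    simp only [conj_trivial]
    rw [real_inner_comm]
    congr 2
    refine tsum_congr fun k => ?_
    rw [real_inner_comm, real_inner_comm (cosCoeff k u.toL2)]
  re_inner_nonneg u := by
    simp only [RCLike.re_to_real, real_inner_self_eq_norm_sq]
    have : 0 ≤ ∑' k : ℕ, (k : ℝ) * (‖sinCoeff k u.toL2‖ ^ 2 + ‖cosCoeff k u.toL2‖ ^ 2) :=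
      tsum_nonneg fun k => by positivity
    positivity
  add_left u v w := by
    have h : (∑' k : ℕ, (k : ℝ) * (⟪sinCoeff k (u + v).toL2, sinCoeff k w.toL2⟫
          + ⟪cosCoeff k (u + v).toL2, cosCoeff k w.toL2⟫))
        = (∑' k : ℕ, (k : ℝ) * (⟪sinCoeff k u.toL2, sinCoeff k w.toL2⟫
            + ⟪cosCoeff k u.toL2, cosCoeff k w.toL2⟫))
          + ∑' k : ℕ, (k : ℝ) * (⟪sinCoeff k v.toL2, sinCoeff k w.toL2⟫
            + ⟪cosCoeff k v.toL2, cosCoeff k w.toL2⟫) := by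
      rw [← (u.summable_inner w).tsum_add (v.summable_inner w)]
      refine tsum_congr fun k => ?_
      simp only [map_add, inner_add_left]
      ring
    rw [h, map_add, map_add, inner_add_left]
    ring
  smul_left u v c := by
    have h : (∑' k : ℕ, (k : ℝ) * (⟪sinCoeff k (c • u).toL2, sinCoeff k v.toL2⟫
          + ⟪cosCoeff k (c • u).toL2, cosCoeff k v.toL2⟫))
        = c * ∑' k : ℕ, (k : ℝ) * (⟪sinCoeff k u.toL2, sinCoeff k v.toL2⟫
            + ⟪cosCoeff k u.toL2, cosCoeff k v.toL2⟫) := by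
      rw [← tsum_mul_left]
      refine tsum_congr fun k => ?_
      simp only [map_smul, real_inner_smul_left]
      ring
    rw [h, map_smul, map_smul, real_inner_smul_left, conj_trivial]
    ring
  definite u h := by
    simp only [real_inner_self_eq_norm_sq] at h
    have hsum := u.summable
    have hnn : ∀ k : ℕ, 0 ≤ (k : ℝ) * (‖sinCoeff k u.toL2‖ ^ 2 + ‖cosCoeff k u.toL2‖ ^ 2) :=
      fun k => by positivity
    have hpi := Real.pi_pos
    have ht : 0 ≤ ∑' k : ℕ, (k : ℝ) * (‖sinCoeff k u.toL2‖ ^ 2 + ‖cosCoeff k u.toL2‖ ^ 2) :=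
      tsum_nonneg hnn
    have h1 : ‖meanCoeff u.toL2‖ ^ 2 = 0 := by
      nlinarith [sq_nonneg ‖meanCoeff u.toL2‖, mul_nonneg hpi.le ht,
        mul_nonneg hpi.le (sq_nonneg ‖meanCoeff u.toL2‖),
        mul_pos hpi hpi]
    rw [h1, mul_zero, zero_add] at h
    have h2 := (mul_eq_zero.1 h).resolve_left hpi.ne'
    have h3 := (hasSum_zero_iff_of_nonneg hnn).1 (h2 ▸ hsum.hasSum)
    have h4 : ∀ k : ℕ, k ≠ 0 → ‖sinCoeff k u.toL2‖ ^ 2 + ‖cosCoeff k u.toL2‖ ^ 2 = 0 :=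
      fun k hk => (mul_eq_zero.1 (congrFun h3 k)).resolve_left (Nat.cast_ne_zero.2 hk)
    apply HHalf.toL2_injective
    rw [map_zero]
    refine eq_zero_of_coeff _ (by simpa using h1) (fun k hk => ?_) (fun k hk => ?_)
    · have := h4 k hk
      have h5 : ‖sinCoeff k u.toL2‖ ^ 2 = 0 := by
        nlinarith [sq_nonneg ‖sinCoeff k u.toL2‖, sq_nonneg ‖cosCoeff k u.toL2‖]
      simpa using h5
    · have := h4 k hk
      have h5 : ‖cosCoeff k u.toL2‖ ^ 2 = 0 := by
        nlinarith [sq_nonneg ‖sinCoeff k u.toL2‖, sq_nonneg ‖cosCoeff k u.toL2‖]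
      simpa using h5

instance (n : ℕ) : NormedAddCommGroup (HHalf n) := (halfCore n).toNormedAddCommGroup

instance (n : ℕ) : InnerProductSpace ℝ (HHalf n) := InnerProductSpace.ofCore (halfCore n).toCore

/-! ### The Hamiltonian action functional -/

/-- The linear map of `ℝ²ⁿ` given by a matrix. -/
abbrev opOf (M : Matrix (Idx n) (Idx n) ℝ) : Phase n →L[ℝ] Phase n :=
  Matrix.toEuclideanCLM (𝕜 := ℝ) M

/-- `w ∈ L²` is the weak derivative of `u ∈ L²` on the circle (so that `u ∈ H¹`): test functions
are the smooth `2π`-periodic functions. -/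
def IsWeakDeriv (u w : L2 n) : Prop :=
  ∀ φ : ℝ → ℝ, ContDiff ℝ ∞ φ → Function.Periodic φ (2 * Real.pi) →
    ∫ t in (0 : ℝ)..(2 * Real.pi), deriv φ t • u (t : Circ)
      = -∫ t in (0 : ℝ)..(2 * Real.pi), φ t • w (t : Circ)

/-- `Γ` is the bounded bilinear form on `H^{1/2}` with `Γ(u, v) = ∫ ⟨J u'(t), v(t)⟩ dt` for all
`u ∈ H¹` and `v ∈ H^{1/2}`, where `J = [[0, -1], [1, 0]]`. -/
def IsActionForm (Γ : HHalf n →L[ℝ] HHalf n →L[ℝ] ℝ) : Prop :=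
  ∀ (u v : HHalf n) (w : L2 n), IsWeakDeriv u.toL2 w →
    Γ u v = ∫ t : Circ, ⟪opOf (Matrix.J (Fin n) ℝ) (w t), v.toL2 t⟫

/-- `f(u) = ½ Γ(u, u) + ∫ (½ ⟨S u(t), u(t)⟩ + R(u(t))) dt`. -/
def actionFunctional (Γ : HHalf n →L[ℝ] HHalf n →L[ℝ] ℝ) (S : Matrix (Idx n) (Idx n) ℝ)
    (R : Phase n → ℝ) (u : HHalf n) : ℝ :=
  1 / 2 * Γ u u + ∫ t : Circ, (1 / 2 * ⟪opOf S (u.toL2 t), u.toL2 t⟫ + R (u.toL2 t))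

/-- The conditions on the higher order part `R(λ, u)` of the Hamiltonian: it is `C²` on
`[0,1] × ℝ²ⁿ`, `∇_u R(λ, u) = o(‖u‖)` as `u → 0`, and `‖D²_u R(λ, u)‖ ≤ a + b ‖u‖ ^ r`. -/
structure IsHigherOrder (R : ℝ → Phase n → ℝ) : Prop where
  contDiffOn : ContDiffOn ℝ 2 (fun p : ℝ × Phase n => R p.1 p.2) (Icc 0 1 ×ˢ univ)
  gradient_isLittleO : ∀ l ∈ Icc (0 : ℝ) 1, (fun u => gradient (R l) u) =o[𝓝 0] fun u => u
  growth : ∃ r a b : ℝ, 0 < r ∧ 0 < a ∧ 0 < b ∧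
    ∀ l ∈ Icc (0 : ℝ) 1, ∀ u, ‖fderiv ℝ (fderiv ℝ (R l)) u‖ ≤ a + b * ‖u‖ ^ r

/-- `f` is differentiable near `0`, twice differentiable at `0`, and the operator `T` is its
Hessian at `0`. -/
def IsHessianAtZero {V : Type*} [NormedAddCommGroup V] [InnerProductSpace ℝ V] (f : V → ℝ)
    (T : V →L[ℝ] V) : Prop :=
  (∀ᶠ u in 𝓝 (0 : V), DifferentiableAt ℝ f u) ∧
    ∃ B : V →L[ℝ] V →L[ℝ] ℝ, HasFDerivAt (fderiv ℝ f) B 0 ∧ ∀ u v, B u v = ⟪T u, v⟫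

/-! ### The group actions -/

/-- `u ↦ M u(· + Θ)` on `L²`. -/
def actL2 (M : Matrix (Idx n) (Idx n) ℝ) (Θ : Circ) : L2 n →ₗ[ℝ] L2 n :=
  ((opOf M).compLpL 2 (volume : Measure Circ) : L2 n →ₗ[ℝ] L2 n) ∘ₗ
    Lp.compMeasurePreservingₗ ℝ (· + Θ) (measurePreserving_add_right volume Θ)

lemma actL2_coe (M : Matrix (Idx n) (Idx n) ℝ) (Θ : Circ) (u : L2 n) :
    ∀ᵐ t ∂(volume : Measure Circ), actL2 M Θ u t = opOf M (u (t + Θ)) := by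
  have h1 := (opOf M).coeFn_compLp
    (Lp.compMeasurePreserving (· + Θ) (measurePreserving_add_right volume Θ) u)
  have h2 := Lp.coeFn_compMeasurePreserving u (measurePreserving_add_right volume Θ)
  filter_upwards [h1, h2] with t ht1 ht2
  exact ht1.trans (congrArg _ ht2)

lemma integral_smul_actL2 (M : Matrix (Idx n) (Idx n) ℝ) (Θ : Circ) (u : L2 n) {f : Circ → ℝ}
    (hf : Continuous f) : ∫ t, f t • actL2 M Θ u t = opOf M (∫ t, f (t - Θ) • u t) := by
  have hf' : Continuous fun t => f (t - Θ) := hf.comp (continuous_id.sub continuous_const)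
  rw [← (opOf M).integral_comp_comm (integrable_smul_L2 hf' u),
    ← integral_add_right_eq_self (fun t => opOf M (f (t - Θ) • u t)) Θ]
  refine integral_congr_ae ?_
  filter_upwards [actL2_coe M Θ u] with t ht
  rw [ht, add_sub_cancel_right, map_smul]

lemma sinCoeff_actL2 (M : Matrix (Idx n) (Idx n) ℝ) (Θ : Circ) (u : L2 n) (k : ℕ) :
    sinCoeff k (actL2 M Θ u)
      = opOf M (ccos (k • Θ) • sinCoeff k u - csin (k • Θ) • cosCoeff k u) := by
  have hs : Continuous fun t : Circ => csin (k • t) :=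
    continuous_csin.comp (continuous_const_smul k)
  have hc : Continuous fun t : Circ => ccos (k • t) :=
    continuous_ccos.comp (continuous_const_smul k)
  have h1 := fun c : ℝ => (integrable_smul_L2 hs u).fun_smul c
  have h2 := fun c : ℝ => (integrable_smul_L2 hc u).fun_smul c
  have h : ∫ t : Circ, csin (k • (t - Θ)) • u t
      = ccos (k • Θ) • (∫ t : Circ, csin (k • t) • u t)
        - csin (k • Θ) • ∫ t : Circ, ccos (k • t) • u t := by
    rw [← integral_smul, ← integral_smul, ← integral_sub (h1 _) (h2 _)]
    refine integral_congr_ae (Eventually.of_forall fun t => ?_)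
    have e : k • (t - Θ) = k • t + -(k • Θ) := by rw [nsmul_sub, sub_eq_add_neg]
    simp only [e, csin_add, csin_neg, ccos_neg, smul_smul, ← sub_smul]
    congr 1
    ring
  change (1 / Real.pi) • (∫ t : Circ, csin (k • t) • actL2 M Θ u t)
    = opOf M (ccos (k • Θ) • (1 / Real.pi) • (∫ t : Circ, csin (k • t) • u t)
        - csin (k • Θ) • (1 / Real.pi) • ∫ t : Circ, ccos (k • t) • u t)
  rw [integral_smul_actL2 M Θ u hs, h, ← map_smul, smul_sub, smul_comm (1 / Real.pi),
    smul_comm (1 / Real.pi)]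

lemma cosCoeff_actL2 (M : Matrix (Idx n) (Idx n) ℝ) (Θ : Circ) (u : L2 n) (k : ℕ) :
    cosCoeff k (actL2 M Θ u)
      = opOf M (csin (k • Θ) • sinCoeff k u + ccos (k • Θ) • cosCoeff k u) := by
  have hs : Continuous fun t : Circ => csin (k • t) :=
    continuous_csin.comp (continuous_const_smul k)
  have hc : Continuous fun t : Circ => ccos (k • t) :=
    continuous_ccos.comp (continuous_const_smul k)
  have h1 := fun c : ℝ => (integrable_smul_L2 hs u).fun_smul c
  have h2 := fun c : ℝ => (integrable_smul_L2 hc u).fun_smul c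
  have h : ∫ t : Circ, ccos (k • (t - Θ)) • u t
      = csin (k • Θ) • (∫ t : Circ, csin (k • t) • u t)
        + ccos (k • Θ) • ∫ t : Circ, ccos (k • t) • u t := by
    rw [← integral_smul, ← integral_smul, ← integral_add (h1 _) (h2 _)]
    refine integral_congr_ae (Eventually.of_forall fun t => ?_)
    have e : k • (t - Θ) = k • t + -(k • Θ) := by rw [nsmul_sub, sub_eq_add_neg]
    simp only [e, ccos_add, csin_neg, ccos_neg, smul_smul, ← add_smul]
    congr 1
    ring
  change (1 / Real.pi) • (∫ t : Circ, ccos (k • t) • actL2 M Θ u t)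
    = opOf M (csin (k • Θ) • (1 / Real.pi) • (∫ t : Circ, csin (k • t) • u t)
        + ccos (k • Θ) • (1 / Real.pi) • ∫ t : Circ, ccos (k • t) • u t)
  rw [integral_smul_actL2 M Θ u hc, h, ← map_smul, smul_add, smul_comm (1 / Real.pi),
    smul_comm (1 / Real.pi)]

lemma ccos_sq_add_csin_sq (t : Circ) : ccos t ^ 2 + csin t ^ 2 = 1 := by
  induction t using QuotientAddGroup.induction_on with | _ t
  rw [csin_coe, ccos_coe, Real.cos_sq_add_sin_sq]

lemma actL2_mem (M : Matrix (Idx n) (Idx n) ℝ) (Θ : Circ) (u : L2 n) (hu : u ∈ halfSubmodule n) :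
    actL2 M Θ u ∈ halfSubmodule n := by
  have hu' : Summable fun k : ℕ => (k : ℝ) * (‖sinCoeff k u‖ ^ 2 + ‖cosCoeff k u‖ ^ 2) := hu
  change Summable fun k : ℕ =>
    (k : ℝ) * (‖sinCoeff k (actL2 M Θ u)‖ ^ 2 + ‖cosCoeff k (actL2 M Θ u)‖ ^ 2)
  refine Summable.of_nonneg_of_le (fun k => by positivity) (fun k => ?_)
    (hu'.mul_left (‖opOf M‖ ^ 2))
  rw [sinCoeff_actL2, cosCoeff_actL2]
  have h1 : ∀ x : Phase n, ‖opOf M x‖ ^ 2 ≤ ‖opOf M‖ ^ 2 * ‖x‖ ^ 2 := fun x => by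
    rw [← mul_pow]
    exact pow_le_pow_left₀ (norm_nonneg _) ((opOf M).le_opNorm x) 2
  have h2 : ∀ (c s : ℝ) (x y : Phase n), c ^ 2 + s ^ 2 = 1 →
      ‖c • x - s • y‖ ^ 2 + ‖s • x + c • y‖ ^ 2 = ‖x‖ ^ 2 + ‖y‖ ^ 2 := fun c s x y h => by
    rw [norm_sub_sq_real, norm_add_sq_real]
    simp only [norm_smul, real_inner_smul_left, real_inner_smul_right, mul_pow, Real.norm_eq_abs,
      sq_abs]
    linear_combination (‖x‖ ^ 2 + ‖y‖ ^ 2) * h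
  have h3 := h2 _ _ (sinCoeff k u) (cosCoeff k u) (ccos_sq_add_csin_sq (k • Θ))
  have h4 := add_le_add (h1 (ccos (k • Θ) • sinCoeff k u - csin (k • Θ) • cosCoeff k u))
    (h1 (csin (k • Θ) • sinCoeff k u + ccos (k • Θ) • cosCoeff k u))
  rw [← mul_add, h3] at h4
  calc _ ≤ (k : ℝ) * (‖opOf M‖ ^ 2 * (‖sinCoeff k u‖ ^ 2 + ‖cosCoeff k u‖ ^ 2)) :=
        mul_le_mul_of_nonneg_left h4 k.cast_nonneg
    _ = _ := by ring

lemma actL2_one (u : L2 n) : actL2 1 0 u = u := by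
  apply Lp.ext
  filter_upwards [actL2_coe 1 0 u] with t ht
  rw [ht, opOf, map_one, add_zero, one_apply_eq_self]

lemma actL2_mul (M N : Matrix (Idx n) (Idx n) ℝ) (Θ Ξ : Circ) (u : L2 n) :
    actL2 (M * N) (Θ + Ξ) u = actL2 M Θ (actL2 N Ξ u) := by
  apply Lp.ext
  have h := (measurePreserving_add_right (volume : Measure Circ) Θ).quasiMeasurePreserving.ae
    (actL2_coe N Ξ u)
  filter_upwards [actL2_coe (M * N) (Θ + Ξ) u, actL2_coe M Θ (actL2 N Ξ u), h] with t h1 h2 h3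
  rw [h1, h2, h3, opOf, map_mul, mul_apply_eq_comp, add_assoc]

section Actions

variable {G₀ : Type*} [Group G₀]

/-- The action of `G₀ × S¹` on `H^{1/2}(S¹, ℝ²ⁿ)`: `((g, Θ) u)(t) = g u(t + Θ)`. -/
def loopRep (ρ : G₀ →* Matrix.orthogonalGroup (Idx n) ℝ) :
    Representation ℝ (G₀ × S1) (HHalf n) where
  toFun x := (actL2 (ρ x.1 : Matrix (Idx n) (Idx n) ℝ) x.2.toAdd).restrict
    fun u hu => actL2_mem _ _ u hu
  map_one' := by
    ext1 u
    exact Subtype.ext ((congrArg (fun M => actL2 M 0 u.1) (by simp)).trans (actL2_one u.1))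
  map_mul' x y := by
    ext1 u
    exact Subtype.ext ((congrArg (fun M => actL2 M _ u.1) (by simp)).trans
      (actL2_mul _ _ _ _ u.1))

/-- The action of `G₀ × S¹` on `ℝ²ⁿ`: `S¹` acts trivially. -/
def constRep (ρ : G₀ →* Matrix.orthogonalGroup (Idx n) ℝ) :
    Representation ℝ (G₀ × S1) (Idx n → ℝ) where
  toFun x := Matrix.toLin' (ρ x.1 : Matrix (Idx n) (Idx n) ℝ)
  map_one' := by simp [Module.End.one_eq_id]
  map_mul' x y := by simp [Matrix.toLin'_mul, Module.End.mul_eq_comp]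

/-- The block matrix `[[cos(kΘ), -sin(kΘ)], [sin(kΘ), cos(kΘ)]]` acting on `ℝ²ⁿ × ℝ²ⁿ`. -/
def rotBlock (n k : ℕ) (Θ : Circ) : Matrix (Idx n ⊕ Idx n) (Idx n ⊕ Idx n) ℝ :=
  Matrix.fromBlocks (ccos (k • Θ) • 1) (-(csin (k • Θ) • 1)) (csin (k • Θ) • 1) (ccos (k • Θ) • 1)

/-- The action of `G₀ × S¹` on `ℝ⁴ⁿ = ℝ²ⁿ × ℝ²ⁿ`: `S¹` acts by the rotations with frequency `k`,
and `g ∈ G₀` acts by the block matrix `[[g, 0], [0, g]]`. -/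
def modeRep (ρ : G₀ →* Matrix.orthogonalGroup (Idx n) ℝ) (k : ℕ) :
    Representation ℝ (G₀ × S1) (Idx n ⊕ Idx n → ℝ) where
  toFun x := Matrix.toLin' (rotBlock n k x.2.toAdd *
    Matrix.fromBlocks (ρ x.1 : Matrix (Idx n) (Idx n) ℝ) 0 0 (ρ x.1))
  map_one' := by
    simp [rotBlock, ccos_zero, csin_zero, Module.End.one_eq_id]
  map_mul' x y := by
    rw [Module.End.mul_eq_comp, ← Matrix.toLin'_mul]
    congr 1
    simp only [rotBlock, Prod.fst_mul, Prod.snd_mul, map_mul, toAdd_mul, smul_add, csin_add,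
      ccos_add, Submonoid.coe_mul, Matrix.fromBlocks_multiply]
    congr 1 <;>
    · simp only [Matrix.smul_mul, Matrix.one_mul, Matrix.mul_zero, Matrix.neg_mul, add_zero,
        zero_add, Matrix.mul_smul, Matrix.mul_neg]
      module

end Actions

/-- The symmetric matrix `Aₖ = [[S / k, -J], [J, S / k]]` of size `4n`. -/
def modeMatrix (S : Matrix (Idx n) (Idx n) ℝ) (k : ℕ) :
    Matrix (Idx n ⊕ Idx n) (Idx n ⊕ Idx n) ℝ :=
  Matrix.fromBlocks ((1 / (k : ℝ)) • S) (-Matrix.J (Fin n) ℝ) (Matrix.J (Fin n) ℝ)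
    ((1 / (k : ℝ)) • S)

/-- `E⁻(A)`: the sum of the eigenspaces of a matrix for its negative eigenvalues. -/
def negSpace {ι : Type} [Fintype ι] [DecidableEq ι] (A : Matrix ι ι ℝ) : Submodule ℝ (ι → ℝ) :=
  eigSum (Matrix.toLin' A) (Iio 0)

section Terms

variable {G₀ : Type*} [Group G₀] [TopologicalSpace G₀]

/-- `[E⁻(S₀)] - [E⁻(S₁)] ∈ RO(G₀ × S¹)`. -/
def constTerm (ρ : G₀ →* Matrix.orthogonalGroup (Idx n) ℝ) (S : ℝ → Matrix (Idx n) (Idx n) ℝ) :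
    RO (G₀ × S1) :=
  roClass (constRep ρ) (negSpace (S 0)) - roClass (constRep ρ) (negSpace (S 1))

/-- `[E⁻(Aₖ(0))] - [E⁻(Aₖ(1))] ∈ RO(G₀ × S¹)`. -/
def modeTerm (ρ : G₀ →* Matrix.orthogonalGroup (Idx n) ℝ) (S : ℝ → Matrix (Idx n) (Idx n) ℝ)
    (k : ℕ) : RO (G₀ × S1) :=
  roClass (modeRep ρ k) (negSpace (modeMatrix (S 0) k))
    - roClass (modeRep ρ k) (negSpace (modeMatrix (S 1) k))

end Terms

end EquivariantSpectralFlow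

end

open EquivariantSpectralFlow

/-!
The operators `L_λ` commute with the decomposition of `H^{1/2}` into Fourier modes, so that the
equivariant spectral flow reduces to a computation in each of these finite dimensional spaces.

In terms of the coefficients `hcoef m u` of `u` in an `L²`-orthonormal trigonometric system indexed
by `m : ℤ` (multiples of `sin(kt)` for `m = k > 0` and of `cos(kt)` for `m = -k < 0`), the inner
product of `H^{1/2}` is `∑ max(1, |m|) ⟪uₘ, vₘ⟫` (`hasSum_inner_half`). Operators that permute and
transform the coefficients are therefore bounded as soon as they are so uniformly in each coefficient
(`exists_coefficient_operator`). The form `Γ` and the operators `L_λ` are defined in this way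
(`actionForm`, `hessOp`), and `L_λ` is Fredholm because the operator of `Γ` is invertible up to the
constants and the multiplication by `S_λ` is a norm limit of operators of finite rank. That `L_λ` is
the only candidate for the Hessian of the action functional follows by expanding the functional
along bounded functions `u`, on which the higher order term is `o(s²)` at `s u`
(`eq_hessOp_of_isHessianAtZero`).

The span `M k` of the modes `sin(kt)`, `cos(kt)` is invariant under the group and under all `L_λ`.
On each `M k` the class of the sum of the eigenspaces below a number `a` that is never an eigenvalue
is constant along the path, because the sums of eigenspaces below and above `a` of nearby operators
are transversal (`roClass_eigSum_Iic_eq`). Since `[0, a]` and `(-∞, 0)` partition `(-∞, a]`, the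
contribution of a step of a partition to the flow in `M k` is the decrease of `[E((-∞, 0))]`, and
the sum over the steps telescopes to `[E⁻(L₀|M k)] - [E⁻(L₁|M k)]`
(`IsModeDecomposition.sum_roClass_eigSumOn`). Only finitely many `k` contribute: a sequence of
vectors `x_k ∈ M k` of norm one with `L_{λ_k} x_k = 0` would be orthonormal, and along a
subsequence with `λ_k → λ` one gets `L_λ x_k → 0`, which a Fredholm operator excludes
(`finite_setOf_ker_inf_ne_bot`). Hence every partition gives the same sum over the modes
(`IsModeDecomposition.flow_eq`). Partitions exist since a selfadjoint Fredholm operator becomes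
invertible after adding an operator of finite rank, which is stable under small perturbations, and
since the operators have only countably many eigenvalues
(`IsModeDecomposition.nonempty_spectralPartition`).

Finally, in the coordinates given by the coefficients of `sin(kt)` and `cos(kt)`, the operator `L_λ`
on `M k` is the matrix `A_k(λ)` for `k ≥ 1` and `S_λ` for `k = 0` (`hessOp_modeEmb`,
`hessOp_constEmb`), with the stated actions of the group.
-/

noncomputable section

namespace EquivariantSpectralFlow

/-! ### Classes of invariant subspaces in the representation ring -/

section RepClasses

variable {G : Type*} [Group G] [TopologicalSpace G]
variable {V : Type} [AddCommGroup V] [Module ℝ V] [TopologicalSpace V]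
variable {W : Type} [AddCommGroup W] [Module ℝ W] [TopologicalSpace W]

lemma FinRep.toRO_eq_of_iso {U U' : FinRep G} (h : U.Iso U') : U.toRO = U'.toRO :=
  congrArg Algebra.GrothendieckAddGroup.of (Quotient.sound h)

lemma FinRep.toRO_dsum (U U' : FinRep G) : (U.dsum U').toRO = U.toRO + U'.toRO := by
  let x : RepClass G := Quotient.mk (FinRep.isoSetoid G) U
  let y : RepClass G := Quotient.mk (FinRep.isoSetoid G) U'
  exact map_add Algebra.GrothendieckAddGroup.of x y

lemma IsFinSubrep.of_le {π : Representation ℝ G V} {E M : Submodule ℝ V} (hM : IsFinSubrep π M)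
    (hE : E ≤ M) (hinv : ∀ g, E ≤ E.comap (π g)) : IsFinSubrep π E :=
  ⟨haveI := hM.1; Submodule.finiteDimensional_of_le hE, hinv, fun v hv => hM.2.2 v (hE hv)⟩

lemma IsFinSubrep.sup [IsTopologicalAddGroup V] {π : Representation ℝ G V} {E F : Submodule ℝ V}
    (hE : IsFinSubrep π E) (hF : IsFinSubrep π F) : IsFinSubrep π (E ⊔ F) := by
  have := hE.1
  have := hF.1
  refine ⟨inferInstance, fun g => sup_le ((hE.2.1 g).trans (Submodule.comap_mono le_sup_left))
    ((hF.2.1 g).trans (Submodule.comap_mono le_sup_right)), fun v hv => ?_⟩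
  obtain ⟨x, hx, y, hy, rfl⟩ := Submodule.mem_sup.1 hv
  simp only [map_add]
  exact (hE.2.2 x hx).add (hF.2.2 y hy)

lemma isFinSubrep_bot (π : Representation ℝ G V) : IsFinSubrep π ⊥ :=
  ⟨inferInstance, fun g => bot_le, fun v hv => by
    rw [Submodule.mem_bot] at hv
    simpa [hv] using continuous_const⟩

lemma isFinSubrep_biSup [IsTopologicalAddGroup V] {π : Representation ℝ G V}
    {E : ℕ → Submodule ℝ V} (s : Finset ℕ)
    (hE : ∀ k, IsFinSubrep π (E k)) : IsFinSubrep π (⨆ k ∈ s, E k) := by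
  classical
  induction s using Finset.induction_on with
  | empty => simpa using isFinSubrep_bot π
  | insert a s _ ih =>
    rw [Finset.iSup_insert]
    exact (hE a).sup ih

variable [IsTopologicalAddGroup V] [ContinuousSMul ℝ V] [T2Space V]
variable [IsTopologicalAddGroup W] [ContinuousSMul ℝ W] [T2Space W]

lemma roClass_of_isFinSubrep {π : Representation ℝ G V} {E : Submodule ℝ V}
    (h : IsFinSubrep π E) : roClass π E = (subRep π E h).toRO := dif_pos h

/-- Invariant subspaces of possibly different representations have the same class as soon as they
are related by an intertwining linear isomorphism. -/
lemma roClass_eq_of_equiv {π : Representation ℝ G V} {π' : Representation ℝ G W}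
    {E : Submodule ℝ V} {E' : Submodule ℝ W} (h : IsFinSubrep π E) (h' : IsFinSubrep π' E')
    (e : E ≃ₗ[ℝ] E') (he : ∀ g (x y : E), (y : V) = π g x → (e y : W) = π' g (e x)) :
    roClass π E = roClass π' E' := by
  rw [roClass_of_isFinSubrep h, roClass_of_isFinSubrep h']
  exact FinRep.toRO_eq_of_iso ⟨e, fun g u => Subtype.ext (he g u _ rfl)⟩

lemma roClass_map {π : Representation ℝ G V} {π' : Representation ℝ G W} {φ : V →ₗ[ℝ] W}
    (hφ : Function.Injective φ) (hφπ : ∀ g x, φ (π g x) = π' g (φ x)) {E : Submodule ℝ V}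
    (h : IsFinSubrep π E) (h' : IsFinSubrep π' (E.map φ)) :
    roClass π' (E.map φ) = roClass π E :=
  (roClass_eq_of_equiv h h' (Submodule.equivMapOfInjective φ hφ E) fun g x y hxy => by
    rw [Submodule.coe_equivMapOfInjective_apply, hxy, hφπ,
      Submodule.coe_equivMapOfInjective_apply]).symm

lemma roClass_sup {π : Representation ℝ G V} {E F : Submodule ℝ V}
    (hE : IsFinSubrep π E) (hF : IsFinSubrep π F) (hd : Disjoint E F) :
    roClass π (E ⊔ F) = roClass π E + roClass π F := by
  rw [roClass_of_isFinSubrep hE, roClass_of_isFinSubrep hF, roClass_of_isFinSubrep (hE.sup hF),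
    ← FinRep.toRO_dsum]
  refine (FinRep.toRO_eq_of_iso ?_).symm
  have hinj : Function.Injective (E.subtype.coprod F.subtype) := by
    rw [← LinearMap.ker_eq_bot, LinearMap.ker_coprod_of_disjoint_range] <;> simp [hd]
  have hr : LinearMap.range (E.subtype.coprod F.subtype) = E ⊔ F := by
    rw [LinearMap.range_coprod, Submodule.range_subtype, Submodule.range_subtype]
  refine ⟨(LinearEquiv.ofInjective _ hinj).trans (LinearEquiv.ofEq _ _ hr), fun g u => ?_⟩
  exact Subtype.ext (map_add (π g) (u.1 : E).1 (u.2 : F).1).symm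

lemma roClass_bot (π : Representation ℝ G V) : roClass π (⊥ : Submodule ℝ V) = 0 := by
  have h := roClass_sup (isFinSubrep_bot π) (isFinSubrep_bot π) disjoint_bot_left
  rw [sup_bot_eq] at h
  simpa using h

lemma roClass_biSup {π : Representation ℝ G V} {E : ℕ → Submodule ℝ V} (s : Finset ℕ)
    (hE : ∀ k, IsFinSubrep π (E k)) (hind : iSupIndep E) :
    roClass π (⨆ k ∈ s, E k) = ∑ k ∈ s, roClass π (E k) := by
  classical
  induction s using Finset.induction_on with
  | empty => simpa using roClass_bot π
  | insert a s ha ih =>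
    rw [Finset.iSup_insert, Finset.sum_insert ha, ← ih]
    refine roClass_sup (hE a) (isFinSubrep_biSup s hE) ((hind a).mono_right ?_)
    exact iSup₂_le fun k hk => le_iSup₂_of_le k (fun h => ha (h ▸ hk)) le_rfl

/-- Two invariant decompositions `V = E ⊕ F = E' ⊕ F'` such that `E` is transversal to `F'` and
`E'` to `F`: the projection onto `E'` along `F'` is injective on `E`, and the dimensions leave
no room for it to miss anything. -/
lemma roClass_eq_of_transversal [FiniteDimensional ℝ V] {π : Representation ℝ G V}
    {E F E' F' : Submodule ℝ V} (hE : IsFinSubrep π E) (hE' : IsFinSubrep π E')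
    (hF' : IsFinSubrep π F') (h : IsCompl E F) (h' : IsCompl E' F')
    (h₁ : Disjoint E F') (h₂ : Disjoint F E') : roClass π E = roClass π E' := by
  have hdim : Module.finrank ℝ E = Module.finrank ℝ E' := by
    have a1 := Submodule.finrank_add_eq_of_isCompl h
    have a2 := Submodule.finrank_add_eq_of_isCompl h'
    have a3 := Submodule.finrank_add_finrank_le_of_disjoint h₁
    have a4 := Submodule.finrank_add_finrank_le_of_disjoint h₂
    omega
  set p : E →ₗ[ℝ] E' := (E'.projectionOnto F' h').comp E.subtype with hp
  have hpinj : Function.Injective p := by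
    rw [← LinearMap.ker_eq_bot, Submodule.eq_bot_iff]
    intro x hx
    have : (x : V) ∈ F' := by
      rw [LinearMap.mem_ker, hp, LinearMap.comp_apply, Submodule.projectionOnto_apply_eq_zero_iff]
        at hx
      exact hx
    exact Subtype.ext (Submodule.disjoint_def.1 h₁ x x.2 this)
  refine roClass_eq_of_equiv hE hE' (LinearEquiv.ofInjectiveOfFinrankEq p hpinj hdim)
    fun g x y hxy => ?_
  change ((E'.projectionOnto F' h' (y : V) : E') : V) = π g (E'.projectionOnto F' h' (x : V) : E')
  obtain ⟨u, w, hu⟩ : ∃ (u : E') (w : F'), (x : V) = u + w := by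
    obtain ⟨u, hu, w, hw, huw⟩ := Submodule.mem_sup.1 (h'.sup_eq_top ▸ Submodule.mem_top :
      (x : V) ∈ E' ⊔ F')
    exact ⟨⟨u, hu⟩, ⟨w, hw⟩, huw.symm⟩
  rw [hxy, hu, map_add, map_add, map_add]
  have e1 := Submodule.projectionOnto_apply_left h' ⟨π g u, hE'.2.1 g u.2⟩
  have e2 : E'.projectionOnto F' h' (π g w) = 0 :=
    (Submodule.projectionOnto_apply_eq_zero_iff h').2 (hF'.2.1 g w.2)
  have e3 : E'.projectionOnto F' h' (w : V) = 0 :=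
    (Submodule.projectionOnto_apply_eq_zero_iff h').2 w.2
  rw [e2, e3, Submodule.projectionOnto_apply_left h' u, add_zero, add_zero]
  exact congrArg Subtype.val e1

end RepClasses

/-! ### Sums of eigenspaces along a path of symmetric operators -/

section EigSum

variable {V : Type*} [AddCommGroup V] [Module ℝ V]

lemma eigSum_union (T : Module.End ℝ V) (s t : Set ℝ) :
    eigSum T (s ∪ t) = eigSum T s ⊔ eigSum T t := iSup_union

lemma disjoint_eigSum (T : Module.End ℝ V) {s t : Set ℝ} (h : Disjoint s t) :
    Disjoint (eigSum T s) (eigSum T t) :=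
  T.eigenspaces_iSupIndep.disjoint_biSup_biSup h

lemma eigSum_le_comap_of_commute {T P : Module.End ℝ V} (h : ∀ x, T (P x) = P (T x)) (s : Set ℝ) :
    eigSum T s ≤ (eigSum T s).comap P := by
  refine iSup₂_le fun μ hμ x hx => ?_
  refine (le_iSup₂_of_le μ hμ le_rfl : T.eigenspace μ ≤ eigSum T s) ?_
  rw [Module.End.mem_eigenspace_iff] at hx ⊢
  rw [h, hx, map_smul]

end EigSum

section FiniteDimensional

variable {V : Type} [NormedAddCommGroup V] [InnerProductSpace ℝ V] [FiniteDimensional ℝ V]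

/-- Membership in a sum of eigenspaces, in terms of the coordinates in an eigenbasis. -/
lemma mem_eigSum_iff {T : Module.End ℝ V} (hT : T.IsSymmetric) {m : ℕ}
    (hm : Module.finrank ℝ V = m) (s : Set ℝ) (x : V) :
    x ∈ eigSum T s ↔
      ∀ i, hT.eigenvalues hm i ∉ s → (hT.eigenvectorBasis hm).repr x i = 0 := by
  constructor
  · intro hx i hi
    let f : V →ₗ[ℝ] ℝ := (EuclideanSpace.proj i : EuclideanSpace ℝ (Fin m) →L[ℝ] ℝ).toLinearMap ∘ₗ
      (hT.eigenvectorBasis hm).repr.toLinearMap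
    have hle : eigSum T s ≤ LinearMap.ker f := by
      refine iSup₂_le fun μ hμ y hy => ?_
      rw [Module.End.mem_eigenspace_iff] at hy
      have h := hT.eigenvectorBasis_apply_self_apply hm y i
      rw [hy, map_smul] at h
      have h2 : (μ - hT.eigenvalues hm i) * (hT.eigenvectorBasis hm).repr y i = 0 := by
        simp only [PiLp.smul_apply, smul_eq_mul, RCLike.ofReal_real_eq_id, id] at h
        linear_combination h
      refine (mul_eq_zero.1 h2).resolve_left (sub_ne_zero.2 fun h => hi (h ▸ hμ))
    exact hle hx
  · intro h
    rw [← (hT.eigenvectorBasis hm).sum_repr x]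
    refine Submodule.sum_mem _ fun i _ => ?_
    by_cases hi : hT.eigenvalues hm i ∈ s
    · refine Submodule.smul_mem _ _ ((le_iSup₂_of_le _ hi le_rfl :
        T.eigenspace _ ≤ eigSum T s) ?_)
      exact Module.End.mem_eigenspace_iff.2 (hT.apply_eigenvectorBasis hm i)
    · rw [h i hi, zero_smul]
      exact Submodule.zero_mem _

lemma isCompl_eigSum_compl {T : Module.End ℝ V} (hT : T.IsSymmetric) (s : Set ℝ) :
    IsCompl (eigSum T s) (eigSum T sᶜ) := by
  refine ⟨disjoint_eigSum T disjoint_compl_right, ?_⟩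
  rw [codisjoint_iff, ← eigSum_union, union_compl_self, Submodule.eq_top_iff']
  intro x
  rw [mem_eigSum_iff hT rfl]
  exact fun i hi => absurd (mem_univ _) hi

lemma norm_sq_eq_sum_repr {T : Module.End ℝ V} (hT : T.IsSymmetric) (x : V) :
    ‖x‖ ^ 2 = ∑ i, ((hT.eigenvectorBasis rfl).repr x i) ^ 2 := by
  rw [← (hT.eigenvectorBasis rfl).repr.norm_map x, EuclideanSpace.norm_sq_eq]
  simp

lemma inner_apply_self_eq_sum {T : Module.End ℝ V} (hT : T.IsSymmetric) (x : V) :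
    ⟪T x, x⟫ = ∑ i, hT.eigenvalues rfl i * ((hT.eigenvectorBasis rfl).repr x i) ^ 2 := by
  rw [← (hT.eigenvectorBasis rfl).repr.inner_map_map, PiLp.inner_apply]
  refine Finset.sum_congr rfl fun i _ => ?_
  rw [hT.eigenvectorBasis_apply_self_apply rfl x i]
  simp
  ring

lemma inner_apply_self_le {T : Module.End ℝ V} (hT : T.IsSymmetric) {a : ℝ} {x : V}
    (hx : x ∈ eigSum T (Iic a)) : ⟪T x, x⟫ ≤ a * ‖x‖ ^ 2 := by
  rw [inner_apply_self_eq_sum hT, norm_sq_eq_sum_repr hT, Finset.mul_sum]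
  refine Finset.sum_le_sum fun i _ => ?_
  by_cases hi : hT.eigenvalues rfl i ∈ Iic a
  · exact mul_le_mul_of_nonneg_right hi (sq_nonneg _)
  · simp [(mem_eigSum_iff hT rfl _ x).1 hx i hi]

lemma le_inner_apply_self {T : Module.End ℝ V} (hT : T.IsSymmetric) {a : ℝ} {x : V}
    (hx : x ∈ eigSum T (Ici a)) : a * ‖x‖ ^ 2 ≤ ⟪T x, x⟫ := by
  rw [inner_apply_self_eq_sum hT, norm_sq_eq_sum_repr hT, Finset.mul_sum]
  refine Finset.sum_le_sum fun i _ => ?_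
  by_cases hi : hT.eigenvalues rfl i ∈ Ici a
  · exact mul_le_mul_of_nonneg_right hi (sq_nonneg _)
  · simp [(mem_eigSum_iff hT rfl _ x).1 hx i hi]

lemma eigSum_mono_of_hasEigenvalue {T : Module.End ℝ V} (hT : T.IsSymmetric) {s t : Set ℝ}
    (h : ∀ μ ∈ s, T.HasEigenvalue μ → μ ∈ t) : eigSum T s ≤ eigSum T t := by
  intro x hx
  rw [mem_eigSum_iff hT rfl] at hx ⊢
  exact fun i hi => hx i fun his => hi (h _ his (hT.hasEigenvalue_eigenvalues rfl i))

/-- If `a` is not an eigenvalue of `T`, there is a gap in the spectrum of `T` around `a`. -/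
lemma exists_eigSum_gap {T : Module.End ℝ V} (hT : T.IsSymmetric) {a : ℝ}
    (ha : ¬ T.HasEigenvalue a) :
    ∃ c > 0, eigSum T (Iic a) ≤ eigSum T (Iic (a - c)) ∧
      eigSum T (Ioi a) ≤ eigSum T (Ici (a + c)) := by
  have hev : ∀ᶠ c in 𝓝[>] (0 : ℝ), ∀ i, c < |hT.eigenvalues rfl i - a| := by
    refine eventually_all.2 fun i => ?_
    have hne : hT.eigenvalues rfl i - a ≠ 0 := fun h =>
      ha (sub_eq_zero.1 h ▸ hT.hasEigenvalue_eigenvalues rfl i)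
    filter_upwards [Ioo_mem_nhdsGT (abs_pos.2 hne)] with c hc using hc.2
  obtain ⟨c, hc, hc0⟩ := (hev.and self_mem_nhdsWithin).exists
  refine ⟨c, hc0, fun x hx => ?_, fun x hx => ?_⟩ <;>
  · rw [mem_eigSum_iff hT rfl] at hx ⊢
    refine fun i hi => hx i fun h => hi ?_
    simp only [mem_Iic, mem_Ioi, mem_Ici] at h ⊢
    rcases abs_cases (hT.eigenvalues rfl i - a) with h1 | h1 <;> linarith [hc i]

variable {G : Type*} [Group G] [TopologicalSpace G]

lemma isFinSubrep_eigSum {σ : Representation ℝ G V} (hσ : ∀ v, Continuous fun g => σ g v)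
    {T : Module.End ℝ V} (hT : ∀ g x, T (σ g x) = σ g (T x)) (s : Set ℝ) :
    IsFinSubrep σ (eigSum T s) :=
  ⟨inferInstance, fun g => eigSum_le_comap_of_commute (hT g) s, fun v _ => hσ v⟩

/-- Along a path of equivariant symmetric operators that never has the eigenvalue `a`, the class of
the sum of the eigenspaces below `a` is constant: the form `⟪T x, x⟫ - a ‖x‖ ^ 2` is definite on
the eigenspaces below and above `a`, and stays definite on them for nearby operators, so that
these decompositions are transversal. -/
theorem roClass_eigSum_Iic_eq {σ : Representation ℝ G V} (hσ : ∀ v, Continuous fun g => σ g v)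
    {T : ℝ → V →L[ℝ] V} {c d a : ℝ} (hcd : c ≤ d) (hcont : ContinuousOn T (Icc c d))
    (hsymm : ∀ l ∈ Icc c d, (T l : V →ₗ[ℝ] V).IsSymmetric)
    (hequiv : ∀ l ∈ Icc c d, ∀ g x, T l (σ g x) = σ g (T l x))
    (ha : ∀ l ∈ Icc c d, ¬ Module.End.HasEigenvalue (T l : V →ₗ[ℝ] V) a) :
    roClass σ (eigSum (T c : V →ₗ[ℝ] V) (Iic a)) = roClass σ (eigSum (T d : V →ₗ[ℝ] V) (Iic a)) := by
  refine isPreconnected_Icc.induction₂ (s := Icc c d) (fun l l' =>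
    roClass σ (eigSum (T l : V →ₗ[ℝ] V) (Iic a)) = roClass σ (eigSum (T l' : V →ₗ[ℝ] V) (Iic a)))
    (fun l hl => ?_) (fun _ _ _ _ _ _ => Eq.trans) (fun _ _ _ _ => Eq.symm)
    (left_mem_Icc.2 hcd) (right_mem_Icc.2 hcd)
  obtain ⟨ε, hε, h1, h2⟩ := exists_eigSum_gap (hsymm l hl) (ha l hl)
  have hclose := Metric.continuousWithinAt_iff'.1 (hcont l hl) ε hε
  filter_upwards [hclose, self_mem_nhdsWithin] with l' hl' hmem
  have hpert : ∀ x, x ≠ 0 → |⟪T l' x, x⟫ - ⟪T l x, x⟫| < ε * ‖x‖ ^ 2 := fun x hx => by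
    rw [← inner_sub_left, ← sub_apply]
    have hx' := norm_pos_iff.2 hx
    calc _ ≤ ‖(T l' - T l) x‖ * ‖x‖ := abs_real_inner_le_norm _ _
      _ ≤ ‖T l' - T l‖ * ‖x‖ * ‖x‖ := by gcongr; exact ContinuousLinearMap.le_opNorm _ _
      _ < ε * ‖x‖ * ‖x‖ := by
        rw [dist_eq_norm] at hl'
        gcongr
      _ = _ := by ring
  have hfin := fun k hk s => isFinSubrep_eigSum hσ (T := (T k : V →ₗ[ℝ] V)) (hequiv k hk) s
  refine roClass_eq_of_transversal (hfin l hl _) (hfin l' hmem _) (hfin l' hmem (Iic a)ᶜ)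
    (isCompl_eigSum_compl (hsymm l hl) _) (isCompl_eigSum_compl (hsymm l' hmem) _) ?_ ?_
  · refine Submodule.disjoint_def.2 fun x hx hx' => by_contra fun hne => ?_
    rw [compl_Iic] at hx'
    have e1 := inner_apply_self_le (hsymm l hl) (h1 hx)
    have e2 := le_inner_apply_self (hsymm l' hmem)
      (eigSum_mono_of_hasEigenvalue (hsymm l' hmem) (fun μ hμ _ => (mem_Ioi.1 hμ).le) hx')
    have e3 := abs_lt.1 (hpert x hne)
    simp only [ContinuousLinearMap.coe_coe] at e1 e2
    linarith [e3.1, e3.2]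
  · refine Submodule.disjoint_def.2 fun x hx hx' => by_contra fun hne => ?_
    rw [compl_Iic] at hx
    have e1 := le_inner_apply_self (hsymm l hl) (h2 hx)
    have e2 := inner_apply_self_le (hsymm l' hmem) hx'
    have e3 := abs_lt.1 (hpert x hne)
    simp only [ContinuousLinearMap.coe_coe] at e1 e2
    linarith [e3.1, e3.2]

end FiniteDimensional

/-! ### Selfadjoint Fredholm operators -/

section Fredholm

variable {V : Type} [NormedAddCommGroup V] [InnerProductSpace ℝ V]

open scoped LinearMap.FiniteRangeSetoid in
lemma isFredholm_add_of_hasFiniteRange {T F : V →L[ℝ] V} (hT : T.IsFredholm)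
    (hF : (F : V →ₗ[ℝ] V).HasFiniteRange) : (T + F).IsFredholm := by
  obtain ⟨v, hv⟩ := hT.exists_isQuasiInverse
  refine ContinuousLinearMap.IsFredholm.of_isQuasiInverse (v := v) (hv.congr (Setoid.refl _) ?_)
  rw [LinearMap.FiniteRangeSetoid.equiv_iff_hasFiniteRange]
  have h : ((T + F : V →L[ℝ] V) : V →ₗ[ℝ] V) - (T : V →ₗ[ℝ] V) = F := by
    ext x
    simp
  rwa [h]

lemma isFredholm_of_isUnit {T : V →L[ℝ] V} (hT : IsUnit T) : T.IsFredholm := by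
  obtain ⟨u, rfl⟩ := hT
  exact ContinuousLinearMap.IsFredholm.of_isQuasiInverse
    (v := ((ContinuousLinearEquiv.ofUnit u).symm : V →L[ℝ] V))
    (ContinuousLinearEquiv.ofUnit u).toLinearEquiv.isQuasiInverse

open scoped LinearMap.FiniteRangeSetoid in
/-- Weyl's criterion: a Fredholm operator does not tend to zero along an orthonormal sequence.
Applying a quasi-inverse would show that a finite rank operator is arbitrarily close to `-1` on
the sequence, so that a subsequence converges. -/
lemma not_tendsto_zero_of_orthonormal {T : V →L[ℝ] V} (hT : T.IsFredholm) {x : ℕ → V}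
    (hx : Orthonormal ℝ x) : ¬ Tendsto (fun j => T (x j)) atTop (𝓝 0) := by
  intro h0
  obtain ⟨v, hv⟩ := hT.exists_isQuasiInverse
  have hfin := LinearMap.FiniteRangeSetoid.equiv_iff_hasFiniteRange.1 hv.1
  rw [LinearMap.hasFiniteRange_iff_range] at hfin
  set F : V →L[ℝ] V := v ∘L T - ContinuousLinearMap.id ℝ V with hF
  have hFD : FiniteDimensional ℝ (LinearMap.range (F : V →ₗ[ℝ] V)) := by
    rw [← Submodule.fg_iff_finiteDimensional]
    exact hfin
  have hproper := FiniteDimensional.proper ℝ (LinearMap.range (F : V →ₗ[ℝ] V))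
  let y : ℕ → LinearMap.range (F : V →ₗ[ℝ] V) := fun j => ⟨F (x j), LinearMap.mem_range_self _ _⟩
  have hbd : ∀ j, y j ∈ Metric.closedBall (0 : LinearMap.range (F : V →ₗ[ℝ] V)) ‖F‖ := fun j => by
    rw [mem_closedBall_zero_iff]
    simpa [hx.1 j] using F.le_opNorm (x j)
  obtain ⟨w, -, φ, hφ, hw⟩ := tendsto_subseq_of_bounded Metric.isBounded_closedBall hbd
  have h1 : Tendsto (fun j => F (x (φ j))) atTop (𝓝 (w : V)) :=
    (continuous_subtype_val.tendsto w).comp hw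
  have h2 : Tendsto (fun j => v (T (x (φ j)))) atTop (𝓝 0) := by
    have := (v.continuous.tendsto 0).comp (h0.comp hφ.tendsto_atTop)
    rwa [map_zero] at this
  have h3 : Tendsto (fun j => x (φ j)) atTop (𝓝 (0 - (w : V))) := by
    refine (h2.sub h1).congr fun j => ?_
    simp [hF]
  have h4 := (h3.comp (tendsto_add_atTop_nat 1)).sub h3
  rw [sub_self] at h4
  -- distinct members of an orthonormal sequence have distance `√2`, so that it cannot converge
  have h5 : ∀ j, ‖x (φ (j + 1)) - x (φ j)‖ ^ 2 = 2 := fun j => by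
    rw [norm_sub_sq_real, hx.1, hx.1, hx.2 (hφ (Nat.lt_succ_self j)).ne']
    norm_num
  have h6 := (h4.norm).pow 2
  simp only [Function.comp_apply, h5, norm_zero] at h6
  have := tendsto_nhds_unique h6 tendsto_const_nhds
  norm_num at this

/-- Along a compact family of Fredholm operators, only finitely many members of a sequence of
pairwise orthogonal subspaces meet a kernel of the family. -/
lemma finite_setOf_ker_inf_ne_bot {K : Set ℝ} (hK : IsCompact K) {τ : ℝ → V →L[ℝ] V}
    (hτ : ContinuousOn τ K) (hF : ∀ y ∈ K, (τ y).IsFredholm) {M : ℕ → Submodule ℝ V}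
    (hM : ∀ j k, j ≠ k → ∀ x ∈ M j, ∀ y ∈ M k, ⟪x, y⟫ = 0) :
    {k | ∃ y ∈ K, ∃ x ∈ M k, x ≠ 0 ∧ τ y x = 0}.Finite := by
  by_contra hinf
  let f := Set.Infinite.natEmbedding _ hinf
  have hf : ∀ j, ∃ y ∈ K, ∃ x ∈ M (f j), ‖x‖ = 1 ∧ τ y x = 0 := fun j => by
    obtain ⟨y, hy, x, hx, hx0, hyx⟩ := (f j).2
    refine ⟨y, hy, (‖x‖⁻¹ : ℝ) • x, Submodule.smul_mem _ _ hx, ?_, by rw [map_smul, hyx, smul_zero]⟩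
    rw [norm_smul, norm_inv, norm_norm, inv_mul_cancel₀ (norm_ne_zero_iff.2 hx0)]
  choose y hy x hx hx1 hyx using hf
  obtain ⟨y₀, hy₀, φ, hφ, hlim⟩ := hK.tendsto_subseq hy
  have horth : Orthonormal ℝ (x ∘ φ) := by
    refine ⟨fun j => hx1 _, fun i j hij => hM _ _ (fun h => hij ?_) _ (hx _) _ (hx _)⟩
    exact hφ.injective (f.injective (Subtype.ext h))
  refine not_tendsto_zero_of_orthonormal (hF y₀ hy₀) horth ?_
  have h1 : Tendsto (fun j => τ (y (φ j))) atTop (𝓝 (τ y₀)) :=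
    ((hτ y₀ hy₀).tendsto).comp
      (tendsto_nhdsWithin_iff.2 ⟨hlim, Eventually.of_forall fun j => hy _⟩)
  have h2 : Tendsto (fun j => ‖τ y₀ - τ (y (φ j))‖) atTop (𝓝 0) := by
    simpa using ((tendsto_const_nhds (x := τ y₀)).sub h1).norm
  refine squeeze_zero_norm (fun j => ?_) h2
  have h3 : τ y₀ ((x ∘ φ) j) = (τ y₀ - τ (y (φ j))) (x (φ j)) := by
    rw [sub_apply, hyx, sub_zero]
    rfl
  rw [h3]
  simpa [hx1] using (τ y₀ - τ (y (φ j))).le_opNorm (x (φ j))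

variable [CompleteSpace V]

lemma isUnit_of_isSymmetric_of_isFredholm {T : V →L[ℝ] V} (hs : (T : V →ₗ[ℝ] V).IsSymmetric)
    (hF : T.IsFredholm) (hinj : ∀ x, T x = 0 → x = 0) : IsUnit T := by
  rw [ContinuousLinearMap.isUnit_iff_bijective]
  refine ⟨(injective_iff_map_eq_zero T).2 hinj, ?_⟩
  have hker : LinearMap.ker (T : V →ₗ[ℝ] V) = ⊥ := (Submodule.eq_bot_iff _).2 hinj
  have horth : (LinearMap.range (T : V →ₗ[ℝ] V))ᗮ = ⊥ := by rw [hs.orthogonal_range, hker]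
  have : CompleteSpace (LinearMap.range (T : V →ₗ[ℝ] V)) :=
    hF.isClosed_range.completeSpace_coe
  exact LinearMap.range_eq_top.1 ((Submodule.orthogonal_eq_bot_iff).1 horth)

/-- The orthogonal projection onto the kernel turns a selfadjoint Fredholm operator into an
invertible one; as invertibility is an open condition, all nearby operators are Fredholm. -/
lemma exists_isUnit_add_hasFiniteRange {T : V →L[ℝ] V} (hs : (T : V →ₗ[ℝ] V).IsSymmetric)
    (hF : T.IsFredholm) :
    ∃ P : V →L[ℝ] V, (P : V →ₗ[ℝ] V).HasFiniteRange ∧ IsUnit (T + P) := by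
  have := hF.finite_ker
  set N := LinearMap.ker (T : V →ₗ[ℝ] V) with hN
  have hfin : (N.starProjection : V →ₗ[ℝ] V).HasFiniteRange := by
    rw [LinearMap.hasFiniteRange_iff_range]
    refine Submodule.FG.of_le (T := N) (Submodule.fg_iff_finiteDimensional _ |>.2 this) ?_
    rintro _ ⟨x, rfl⟩
    exact Submodule.starProjection_apply_mem N x
  refine ⟨N.starProjection, hfin, isUnit_of_isSymmetric_of_isFredholm (fun x y => ?_)
    (isFredholm_add_of_hasFiniteRange hF hfin) fun x hx => ?_⟩
  · have h1 := hs x y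
    have h2 := N.starProjection_isSymmetric x y
    simp only [ContinuousLinearMap.coe_coe, add_apply, inner_add_left,
      inner_add_right] at *
    rw [h1, h2]
  · rw [add_apply] at hx
    have h1 : ⟪T x, N.starProjection x⟫ = 0 := by
      have h2 : T (N.starProjection x) = 0 := Submodule.starProjection_apply_mem N x
      have h3 := hs x (N.starProjection x)
      simp only [ContinuousLinearMap.coe_coe, h2, inner_zero_right] at h3
      exact h3
    have h4 : N.starProjection x = 0 := by
      have h5 : ⟪T x + N.starProjection x, N.starProjection x⟫ = 0 := by rw [hx, inner_zero_left]
      rw [inner_add_left, h1, zero_add] at h5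
      exact inner_self_eq_zero.1 h5
    rw [h4, add_zero] at hx
    rw [← (Submodule.starProjection_eq_self_iff (K := N)).2 hx, h4]

end Fredholm

/-! ### Spectral flow of a path that preserves a decomposition into finite dimensional modes -/

/-- The sum of the intersections with `M` of the eigenspaces of `T` for the eigenvalues in `s`. -/
def eigSumOn {V : Type*} [AddCommGroup V] [Module ℝ V] (T : Module.End ℝ V) (M : Submodule ℝ V)
    (s : Set ℝ) : Submodule ℝ V :=
  ⨆ μ ∈ s, T.eigenspace μ ⊓ M

section EigSumOn

variable {V W : Type*} [AddCommGroup V] [Module ℝ V] [AddCommGroup W] [Module ℝ W]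

lemma eigSumOn_le (T : Module.End ℝ V) (M : Submodule ℝ V) (s : Set ℝ) : eigSumOn T M s ≤ M :=
  iSup₂_le fun _ _ => inf_le_right

lemma eigSumOn_le_eigSum (T : Module.End ℝ V) (M : Submodule ℝ V) (s : Set ℝ) :
    eigSumOn T M s ≤ eigSum T s :=
  iSup₂_mono fun _ _ => inf_le_left

lemma eigSumOn_union (T : Module.End ℝ V) (M : Submodule ℝ V) (s t : Set ℝ) :
    eigSumOn T M (s ∪ t) = eigSumOn T M s ⊔ eigSumOn T M t := iSup_union

lemma eigSumOn_eq_bot {T : Module.End ℝ V} {M : Submodule ℝ V} {s : Set ℝ}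
    (h : ∀ μ ∈ s, ∀ x ∈ M, T x = μ • x → x = 0) : eigSumOn T M s = ⊥ := by
  simp only [eigSumOn, iSup_eq_bot]
  exact fun μ hμ => (Submodule.eq_bot_iff _).2 fun x hx =>
    h μ hμ x hx.2 (Module.End.mem_eigenspace_iff.1 hx.1)

lemma map_eigSum {T : Module.End ℝ V} {A : Module.End ℝ W} {φ : W →ₗ[ℝ] V} {M : Submodule ℝ V}
    (hφ : Function.Injective φ) (hr : LinearMap.range φ = M) (hT : ∀ x, T (φ x) = φ (A x))
    (s : Set ℝ) : (eigSum A s).map φ = eigSumOn T M s := by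
  simp only [eigSum, eigSumOn, Submodule.map_iSup]
  refine iSup_congr fun μ => iSup_congr fun _ => le_antisymm ?_ ?_
  · rintro _ ⟨x, hx, rfl⟩
    refine ⟨?_, hr ▸ LinearMap.mem_range_self _ _⟩
    simp only [SetLike.mem_coe, Module.End.mem_eigenspace_iff] at hx ⊢
    rw [hT, hx, map_smul]
  · rintro y ⟨hy, hyM⟩
    simp only [SetLike.mem_coe] at hy hyM
    rw [← hr] at hyM
    obtain ⟨x, rfl⟩ := hyM
    refine ⟨x, ?_, rfl⟩
    simp only [SetLike.mem_coe, Module.End.mem_eigenspace_iff] at hy ⊢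
    rw [hT, ← map_smul] at hy
    exact hφ hy

end EigSumOn

section Modes

variable {G : Type*} [Group G] [TopologicalSpace G]
variable {V : Type} [NormedAddCommGroup V] [InnerProductSpace ℝ V]

/-- `V` is the Hilbert sum of the finite dimensional subspaces `M k`, which are invariant under the
representation `π` and under the operators of the path `A`. -/
structure IsModeDecomposition (π : Representation ℝ G V) (A : ℝ → V →L[ℝ] V)
    (M : ℕ → Submodule ℝ V) : Prop where
  isFinSubrep : ∀ k, IsFinSubrep π (M k)
  orthogonal : ∀ j k, j ≠ k → ∀ x ∈ M j, ∀ y ∈ M k, ⟪x, y⟫ = 0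
  total : ∀ x, (∀ k, ∀ y ∈ M k, ⟪y, x⟫ = 0) → x = 0
  invariant : ∀ l ∈ Icc (0 : ℝ) 1, ∀ k, ∀ x ∈ M k, A l x ∈ M k

lemma starProjection_apply_comm {T : V →L[ℝ] V} (hT : (T : V →ₗ[ℝ] V).IsSymmetric)
    {M : Submodule ℝ V} [M.HasOrthogonalProjection] (hM : ∀ x ∈ M, T x ∈ M) (x : V) :
    T (M.starProjection x) = M.starProjection (T x) := by
  refine (Submodule.eq_starProjection_of_mem_of_inner_eq_zero
    (hM _ (M.starProjection_apply_mem x)) fun w hw => ?_).symm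
  rw [← map_sub]
  exact (hT _ _).trans (M.starProjection_inner_eq_zero x (T w) (hM w hw))

variable {π : Representation ℝ G V} {A : ℝ → V →L[ℝ] V} {M : ℕ → Submodule ℝ V}

lemma IsModeDecomposition.iSupIndep (hM : IsModeDecomposition π A M) : iSupIndep M := by
  refine OrthogonalFamily.independent (𝕜 := ℝ) ?_
  intro j k hjk x y
  exact hM.orthogonal j k hjk x x.2 y y.2

/-- A vector all of whose components outside the finitely many modes `F` vanish is the sum of its
components in these modes. -/
lemma IsModeDecomposition.eq_sum_starProjection (hM : IsModeDecomposition π A M)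
    [∀ k, FiniteDimensional ℝ (M k)] (F : Finset ℕ) {x : V}
    (hx : ∀ k ∉ F, (M k).starProjection x = 0) : x = ∑ k ∈ F, (M k).starProjection x := by
  rw [← sub_eq_zero]
  refine hM.total _ fun j z hz => ?_
  have hself : ⟪z, (M j).starProjection x⟫ = ⟪z, x⟫ := by
    have := (M j).starProjection_inner_eq_zero x z hz
    rw [real_inner_comm, inner_sub_right] at this
    linarith
  have hother : ∀ k, k ≠ j → ⟪z, (M k).starProjection x⟫ = 0 := fun k hk =>
    hM.orthogonal j k hk.symm z hz _ ((M k).starProjection_apply_mem x)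
  rw [inner_sub_right, inner_sum]
  by_cases hj : j ∈ F
  · rw [Finset.sum_eq_single_of_mem j hj fun k _ hk => hother k hk, hself, sub_self]
  · rw [Finset.sum_eq_zero fun k hk => hother k fun h => hj (h ▸ hk), ← hself, hx j hj,
      inner_zero_right, sub_zero]

/-- If the eigenvalues in `s` occur in finitely many modes only, the sum of the eigenspaces splits
into the contributions of these modes. -/
lemma IsModeDecomposition.eigSum_eq_biSup (hM : IsModeDecomposition π A M) {T : V →L[ℝ] V}
    (hT : (T : V →ₗ[ℝ] V).IsSymmetric) (hinv : ∀ k, ∀ x ∈ M k, T x ∈ M k) {s : Set ℝ}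
    {F : Finset ℕ} (hF : ∀ k ∉ F, ∀ μ ∈ s, ∀ x ∈ M k, T x = μ • x → x = 0) :
    eigSum (T : V →ₗ[ℝ] V) s = ⨆ k ∈ F, eigSumOn (T : V →ₗ[ℝ] V) (M k) s := by
  have := fun k => (hM.isFinSubrep k).1
  refine le_antisymm (iSup₂_le fun μ hμ x hx => ?_) (iSup₂_le fun k _ => eigSumOn_le_eigSum _ _ _)
  have hx : T x = μ • x := Module.End.mem_eigenspace_iff.1 hx
  have hp : ∀ k, T ((M k).starProjection x) = μ • (M k).starProjection x := fun k => by
    rw [starProjection_apply_comm hT (hinv k), hx, map_smul]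
  rw [hM.eq_sum_starProjection F fun k hk =>
    hF k hk μ hμ _ ((M k).starProjection_apply_mem x) (hp k)]
  refine Submodule.sum_mem _ fun k hk => Submodule.mem_iSup_of_mem k
    (Submodule.mem_iSup_of_mem hk (Submodule.mem_iSup_of_mem μ (Submodule.mem_iSup_of_mem hμ ?_)))
  exact ⟨Module.End.mem_eigenspace_iff.2 (hp k), (M k).starProjection_apply_mem x⟩

lemma isFinSubrep_eigSumOn {E : Submodule ℝ V} (hE : IsFinSubrep π E) {T : V →L[ℝ] V}
    (hT : ∀ g u, T (π g u) = π g (T u)) (s : Set ℝ) :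
    IsFinSubrep π (eigSumOn (T : V →ₗ[ℝ] V) E s) := by
  refine hE.of_le (eigSumOn_le _ _ _) fun g => iSup₂_le fun μ hμ x hx => ?_
  refine (le_iSup₂_of_le μ hμ le_rfl :
    Module.End.eigenspace (T : V →ₗ[ℝ] V) μ ⊓ E ≤ eigSumOn (T : V →ₗ[ℝ] V) E s) ⟨?_, hE.2.1 g hx.2⟩
  have h : T x = μ • x := Module.End.mem_eigenspace_iff.1 hx.1
  refine Module.End.mem_eigenspace_iff.2 ?_
  change T (π g x) = μ • π g x
  rw [hT, h, map_smul]

lemma roClass_eigSumOn_union {E : Submodule ℝ V} (hE : IsFinSubrep π E) {T : V →L[ℝ] V}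
    (hT : ∀ g u, T (π g u) = π g (T u)) {s t : Set ℝ} (hst : Disjoint s t) :
    roClass π (eigSumOn (T : V →ₗ[ℝ] V) E (s ∪ t))
      = roClass π (eigSumOn (T : V →ₗ[ℝ] V) E s) + roClass π (eigSumOn (T : V →ₗ[ℝ] V) E t) := by
  rw [eigSumOn_union]
  exact roClass_sup (isFinSubrep_eigSumOn hE hT s) (isFinSubrep_eigSumOn hE hT t)
    ((disjoint_eigSum _ hst).mono (eigSumOn_le_eigSum _ _ _) (eigSumOn_le_eigSum _ _ _))

/-- The version of `roClass_eigSum_Iic_eq` for an invariant finite dimensional subspace. -/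
lemma roClass_eigSumOn_Iic_eq {E : Submodule ℝ V} (hE : IsFinSubrep π E) {c d a : ℝ}
    (hcd : c ≤ d) (hcont : ContinuousOn A (Icc c d))
    (hsymm : ∀ l ∈ Icc c d, (A l : V →ₗ[ℝ] V).IsSymmetric)
    (hequiv : ∀ l ∈ Icc c d, ∀ g u, A l (π g u) = π g (A l u))
    (hinv : ∀ l ∈ Icc c d, ∀ x ∈ E, A l x ∈ E)
    (ha : ∀ l ∈ Icc c d, ∀ x ∈ E, A l x = a • x → x = 0) :
    roClass π (eigSumOn (A c : V →ₗ[ℝ] V) E (Iic a))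
      = roClass π (eigSumOn (A d : V →ₗ[ℝ] V) E (Iic a)) := by
  have := hE.1
  let σ : Representation ℝ G E := π.subrepresentation E hE.2.1
  let B : ℝ → E →L[ℝ] E := fun l => E.orthogonalProjectionOnto ∘L A l ∘L E.subtypeL
  have hB : ∀ l ∈ Icc c d, ∀ x : E, (B l x : V) = A l x := fun l hl x =>
    congrArg Subtype.val
      (Submodule.orthogonalProjectionOnto_mem_subspace_eq_self (⟨A l x, hinv l hl x x.2⟩ : E))
  have hσ : ∀ v, Continuous fun g => σ g v := fun v =>
    Continuous.subtype_mk (hE.2.2 v v.2) _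
  have hBe : ∀ l ∈ Icc c d, ∀ g x, B l (σ g x) = σ g (B l x) := fun l hl g x => by
    refine Subtype.ext ?_
    rw [hB l hl]
    change A l (π g x) = π g (B l x)
    rw [hB l hl, hequiv l hl]
  have key : ∀ l ∈ Icc c d, roClass π (eigSumOn (A l : V →ₗ[ℝ] V) E (Iic a))
      = roClass σ (eigSum (B l : E →ₗ[ℝ] E) (Iic a)) := fun l hl => by
    have hmap := map_eigSum (T := (A l : V →ₗ[ℝ] V)) (A := (B l : E →ₗ[ℝ] E)) (φ := E.subtype)
      E.injective_subtype E.range_subtype (fun x => (hB l hl x).symm) (Iic a)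
    have hfin := isFinSubrep_eigSumOn hE (hequiv l hl) (Iic a)
    rw [← hmap] at hfin ⊢
    exact roClass_map E.injective_subtype (fun g x => rfl)
      (isFinSubrep_eigSum hσ (T := (B l : E →ₗ[ℝ] E)) (hBe l hl) _) hfin
  rw [key c (left_mem_Icc.2 hcd), key d (right_mem_Icc.2 hcd)]
  refine roClass_eigSum_Iic_eq hσ hcd ?_ (fun l hl x y => ?_) hBe fun l hl h => ?_
  · exact continuousOn_const.clm_comp (hcont.clm_comp continuousOn_const)
  · change ⟪(B l x : V), (y : V)⟫ = ⟪(x : V), (B l y : V)⟫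
    rw [hB l hl, hB l hl]
    exact hsymm l hl x y
  · obtain ⟨x, hx⟩ := h.exists_hasEigenvector
    refine hx.2 (Subtype.ext (ha l hl x x.2 ?_))
    have h1 := congrArg Subtype.val hx.apply_eq_smul
    exact (hB l hl x).symm.trans h1

lemma eq_zero_of_notMem_spectrum {T : V →L[ℝ] V} {a : ℝ} (ha : a ∉ spectrum ℝ T) {x : V}
    (hx : T x = a • x) : x = 0 := by
  obtain ⟨u, hu⟩ := spectrum.notMem_iff.1 ha
  have h1 : (u : V →L[ℝ] V) x = 0 := by
    rw [hu, sub_apply, hx]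
    simp [Algebra.algebraMap_eq_smul_one]
  have h2 : ((u⁻¹ : (V →L[ℝ] V)ˣ) : V →L[ℝ] V) ((u : V →L[ℝ] V) x) = x := by
    rw [← mul_apply_eq_comp, Units.inv_mul, one_apply_eq_self]
  rw [← h2, h1, map_zero]

/-- The contribution of a mode to the spectral flow. -/
def modeDiff (π : Representation ℝ G V) (A : ℝ → V →L[ℝ] V) (E : Submodule ℝ V) : RO G :=
  roClass π (eigSumOn (A 0 : V →ₗ[ℝ] V) E (Iio 0))
    - roClass π (eigSumOn (A 1 : V →ₗ[ℝ] V) E (Iio 0))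

/-- A mode on which no operator of the path has a kernel does not contribute, and all but finitely
many modes are of this kind. -/
lemma IsModeDecomposition.finite_modeDiff_ne_zero (hM : IsModeDecomposition π A M)
    (hA : IsFSPath π A) : {k | modeDiff π A (M k) ≠ 0}.Finite := by
  refine (finite_setOf_ker_inf_ne_bot isCompact_Icc hA.continuousOn hA.fredholm
    hM.orthogonal).subset fun k hk => ?_
  by_contra hcon
  have hne : ∀ l ∈ Icc (0 : ℝ) 1, ∀ x ∈ M k, A l x = (0 : ℝ) • x → x = 0 := fun l hl x hx h => by
    by_contra hx0
    exact hcon ⟨l, hl, x, hx, hx0, by rw [h, zero_smul]⟩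
  refine hk ?_
  have h := roClass_eigSumOn_Iic_eq (hM.isFinSubrep k) zero_le_one hA.continuousOn hA.symmetric
    hA.equivariant (fun l hl => hM.invariant l hl k) hne
  have hsplit : ∀ l ∈ Icc (0 : ℝ) 1, eigSumOn (A l : V →ₗ[ℝ] V) (M k) (Iic 0)
      = eigSumOn (A l : V →ₗ[ℝ] V) (M k) (Iio 0) := fun l hl => by
    rw [← Iio_union_right, eigSumOn_union, sup_eq_left]
    refine (eigSumOn_eq_bot fun μ hμ x hx h => ?_).trans_le bot_le
    rw [mem_singleton_iff] at hμ
    exact hne l hl x hx (hμ ▸ h)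
  rw [hsplit 0 (left_mem_Icc.2 zero_le_one), hsplit 1 (right_mem_Icc.2 zero_le_one)] at h
  rw [modeDiff, h, sub_self]

lemma SpectralPartition.pt_mem (P : SpectralPartition A) (i : Fin (P.N + 1)) :
    P.pt i ∈ Icc (0 : ℝ) 1 :=
  ⟨P.pt_zero ▸ P.pt_strictMono.monotone (Fin.zero_le i),
    P.pt_last ▸ P.pt_strictMono.monotone (Fin.le_last i)⟩

/-- In each mode, `[E(A, [0, a])] + [E(A, (-∞, 0))]` does not change over a step of the partition,
so that the sum over the steps telescopes. -/
lemma IsModeDecomposition.sum_roClass_eigSumOn (hM : IsModeDecomposition π A M)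
    (hA : IsFSPath π A) (P : SpectralPartition A) (k : ℕ) :
    ∑ i : Fin P.N, (roClass π (eigSumOn (A (P.pt i.succ) : V →ₗ[ℝ] V) (M k) (Icc 0 (P.a i)))
      - roClass π (eigSumOn (A (P.pt i.castSucc) : V →ₗ[ℝ] V) (M k) (Icc 0 (P.a i))))
    = modeDiff π A (M k) := by
  have hstep : ∀ i : Fin P.N,
      roClass π (eigSumOn (A (P.pt i.succ) : V →ₗ[ℝ] V) (M k) (Icc 0 (P.a i)))
        - roClass π (eigSumOn (A (P.pt i.castSucc) : V →ₗ[ℝ] V) (M k) (Icc 0 (P.a i)))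
      = roClass π (eigSumOn (A (P.pt i.castSucc) : V →ₗ[ℝ] V) (M k) (Iio 0))
        - roClass π (eigSumOn (A (P.pt i.succ) : V →ₗ[ℝ] V) (M k) (Iio 0)) := fun i => by
    have hsub : Icc (P.pt i.castSucc) (P.pt i.succ) ⊆ Icc 0 1 :=
      Icc_subset_Icc (P.pt_mem _).1 (P.pt_mem _).2
    have h := roClass_eigSumOn_Iic_eq (hM.isFinSubrep k)
      (P.pt_strictMono (Fin.castSucc_lt_succ (i := i))).le (hA.continuousOn.mono hsub)
      (fun l hl => hA.symmetric l (hsub hl)) (fun l hl => hA.equivariant l (hsub hl))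
      (fun l hl => hM.invariant l (hsub hl) k)
      (fun l hl x _ hx => eq_zero_of_notMem_spectrum (P.notMem_spectrum i l hl).1 hx)
    have hsplit : Iic (P.a i) = Iio 0 ∪ Icc 0 (P.a i) := (Iio_union_Icc_eq_Iic (P.a_pos i).le).symm
    have hd : Disjoint (Iio 0) (Icc 0 (P.a i)) :=
      Set.disjoint_left.2 fun x hx hx' => (not_le.2 hx) hx'.1
    rw [hsplit, roClass_eigSumOn_union (hM.isFinSubrep k) (hA.equivariant _ (P.pt_mem _)) hd,
      roClass_eigSumOn_union (hM.isFinSubrep k) (hA.equivariant _ (P.pt_mem _)) hd] at h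
    rw [sub_eq_sub_iff_add_eq_add, add_comm, ← h, add_comm]
  rw [Finset.sum_congr rfl fun i _ => hstep i]
  have htel : ∀ (N : ℕ) (f : Fin (N + 1) → RO G),
      ∑ i : Fin N, (f i.castSucc - f i.succ) = f 0 - f (Fin.last N) := by
    intro N
    induction N with
    | zero => intro f; simp
    | succ N ih =>
      intro f
      rw [Fin.sum_univ_castSucc]
      have := ih fun i => f i.castSucc
      simp only [← Fin.succ_castSucc] at this ⊢
      rw [this]
      simp
  rw [htel P.N fun j => roClass π (eigSumOn (A (P.pt j) : V →ₗ[ℝ] V) (M k) (Iio 0)), P.pt_zero,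
    P.pt_last]
  rfl

/-- The spectral flow, computed from any admissible partition, is the sum of the contributions of
the modes: near `0` the spectrum only sees finitely many of them. -/
theorem IsModeDecomposition.flow_eq (hM : IsModeDecomposition π A M) (hA : IsFSPath π A)
    (P : SpectralPartition A) : P.flow π = ∑ᶠ k, modeDiff π A (M k) := by
  have hfin : ∀ (i : Fin P.N), ∀ l ∈ Icc (P.pt i.castSucc) (P.pt i.succ),
      {k | ∃ μ ∈ Icc 0 (P.a i), ∃ x ∈ M k, x ≠ 0 ∧
        (A l - μ • ContinuousLinearMap.id ℝ V) x = 0}.Finite := fun i l hl => by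
    refine finite_setOf_ker_inf_ne_bot isCompact_Icc
      (τ := fun μ => A l - μ • ContinuousLinearMap.id ℝ V)
      (by fun_prop) (fun μ hμ => ?_) hM.orthogonal
    by_contra h
    exact Set.disjoint_left.1 (P.disjoint_essSpectrum i l hl)
      ⟨by linarith [hμ.1, P.a_pos i], hμ.2⟩ h
  have hle : ∀ i : Fin P.N, P.pt i.castSucc ≤ P.pt i.succ := fun i =>
    (P.pt_strictMono (Fin.castSucc_lt_succ (i := i))).le
  have hall := (hM.finite_modeDiff_ne_zero hA).union (Set.finite_iUnion fun i =>
    (hfin i _ (left_mem_Icc.2 (hle i))).union (hfin i _ (right_mem_Icc.2 (hle i))))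
  set F := hall.toFinset with hF
  have hsum : ∀ (i : Fin P.N) (j : Fin (P.N + 1)), j = i.castSucc ∨ j = i.succ →
      roClass π (eigSum (A (P.pt j) : V →ₗ[ℝ] V) (Icc 0 (P.a i)))
      = ∑ k ∈ F, roClass π (eigSumOn (A (P.pt j) : V →ₗ[ℝ] V) (M k) (Icc 0 (P.a i))) := by
    intro i j hj
    rw [hM.eigSum_eq_biSup (hA.symmetric _ (P.pt_mem j)) (hM.invariant _ (P.pt_mem j)) (F := F)]
    · refine roClass_biSup F
        (fun k => isFinSubrep_eigSumOn (hM.isFinSubrep k) (hA.equivariant _ (P.pt_mem j)) _) ?_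
      exact hM.iSupIndep.mono fun k => eigSumOn_le _ _ _
    · intro k hk μ hμ x hx h
      by_contra hx0
      refine hk ?_
      rw [hF, Set.Finite.mem_toFinset]
      refine Or.inr (mem_iUnion.2 ⟨i, ?_⟩)
      have hmem : ∃ μ ∈ Icc 0 (P.a i), ∃ x ∈ M k, x ≠ 0 ∧
          (A (P.pt j) - μ • ContinuousLinearMap.id ℝ V) x = 0 :=
        ⟨μ, hμ, x, hx, hx0, by simp [h]⟩
      rcases hj with rfl | rfl
      · exact Or.inl hmem
      · exact Or.inr hmem
  have hflow : P.flow π = ∑ i : Fin P.N, ∑ k ∈ F,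
      (roClass π (eigSumOn (A (P.pt i.succ) : V →ₗ[ℝ] V) (M k) (Icc 0 (P.a i)))
      - roClass π (eigSumOn (A (P.pt i.castSucc) : V →ₗ[ℝ] V) (M k) (Icc 0 (P.a i)))) := by
    refine Finset.sum_congr rfl fun i _ => ?_
    rw [hsum i _ (Or.inl rfl), hsum i _ (Or.inr rfl), Finset.sum_sub_distrib]
  rw [hflow, Finset.sum_comm, Finset.sum_congr rfl fun k _ => hM.sum_roClass_eigSumOn hA P k]
  refine (finsum_eq_sum_of_support_subset _ fun k hk => ?_).symm
  rw [hF, Finset.mem_coe, Set.Finite.mem_toFinset]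
  exact Or.inl hk

lemma IsModeDecomposition.countable_hasEigenvalue (hM : IsModeDecomposition π A M)
    {T : V →L[ℝ] V} (hT : (T : V →ₗ[ℝ] V).IsSymmetric) (hinv : ∀ k, ∀ x ∈ M k, T x ∈ M k) :
    {μ : ℝ | ∃ x, x ≠ 0 ∧ T x = μ • x}.Countable := by
  have := fun k => (hM.isFinSubrep k).1
  refine (Set.countable_iUnion fun k => (Module.End.finite_hasEigenvalue
    ((T : V →ₗ[ℝ] V).restrict (hinv k))).countable).mono ?_
  rintro μ ⟨x, hx0, hx⟩
  by_contra hcon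
  refine hx0 ((hM.eq_sum_starProjection ∅ fun k _ => ?_).trans Finset.sum_empty)
  by_contra hne
  refine hcon (mem_iUnion.2 ⟨k, Module.End.hasEigenvalue_of_hasEigenvector
    (x := ⟨(M k).starProjection x, (M k).starProjection_apply_mem x⟩)
    ⟨Module.End.mem_eigenspace_iff.2 (Subtype.ext ?_), fun h => hne (congrArg Subtype.val h)⟩⟩)
  change T ((M k).starProjection x) = μ • (M k).starProjection x
  rw [starProjection_apply_comm hT (hinv k), hx, map_smul]

variable [CompleteSpace V]

/-- Near each point of the path there is an admissible number `a`: any small positive number will do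
for the essential spectrum, and since the operator at that point has only countably many
eigenvalues, it can be chosen such that neither `a` nor `-a` is one of them. -/
lemma IsModeDecomposition.exists_local_spectral_bound (hM : IsModeDecomposition π A M)
    (hA : IsFSPath π A) {l₀ : ℝ} (hl₀ : l₀ ∈ Icc (0 : ℝ) 1) :
    ∃ a > 0, ∀ᶠ l in 𝓝[Icc 0 1] l₀, (a ∉ spectrum ℝ (A l) ∧ -a ∉ spectrum ℝ (A l)) ∧
      Disjoint (Icc (-a) a) (essSpectrum (A l)) := by
  obtain ⟨P, hP, hunit⟩ := exists_isUnit_add_hasFiniteRange (hA.symmetric l₀ hl₀)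
    (hA.fredholm l₀ hl₀)
  have hAl : Tendsto A (𝓝[Icc 0 1] l₀) (𝓝 (A l₀)) := hA.continuousOn l₀ hl₀
  have hev : ∀ᶠ p in 𝓝[Icc 0 1] l₀ ×ˢ 𝓝 (0 : ℝ),
      IsUnit (A p.1 + P - p.2 • ContinuousLinearMap.id ℝ V) := by
    have ht : Tendsto (fun p : ℝ × ℝ => A p.1 + P - p.2 • ContinuousLinearMap.id ℝ V)
        (𝓝[Icc 0 1] l₀ ×ˢ 𝓝 (0 : ℝ))
        (𝓝 (A l₀ + P - (0 : ℝ) • ContinuousLinearMap.id ℝ V)) :=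
      ((hAl.comp tendsto_fst).add_const P).sub (tendsto_snd.smul_const _)
    refine ht.eventually (Units.isOpen.mem_nhds ?_)
    rw [zero_smul, sub_zero]
    exact hunit
  obtain ⟨p, hp, q, hq, hpq⟩ := eventually_prod_iff.1 hev
  obtain ⟨ε, hε, hball⟩ := Metric.eventually_nhds_iff.1 hq
  have hfred : ∀ l, p l → ∀ μ : ℝ, |μ| < ε →
      (A l - μ • ContinuousLinearMap.id ℝ V).IsFredholm := fun l hl μ hμ => by
    have h1 := isFredholm_of_isUnit (hpq hl (hball (y := μ) (by simpa using hμ)))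
    have h2 := isFredholm_add_of_hasFiniteRange (F := -P) h1 (by
      have := LinearMap.HasFiniteRange.neg hP
      exact this)
    convert h2 using 1
    abel
  have hcount := hM.countable_hasEigenvalue (hA.symmetric l₀ hl₀) (hM.invariant l₀ hl₀)
  obtain ⟨a, ha, haE⟩ := ((hcount.union (hcount.preimage_of_injOn
    (f := fun μ : ℝ => -μ) neg_injective.injOn)).dense_compl ℝ).exists_mem_open isOpen_Ioo
    (nonempty_Ioo.2 hε)
  rw [mem_compl_iff, mem_union, not_or] at ha
  have hspec : ∀ μ : ℝ, |μ| < ε → (∀ x, A l₀ x = μ • x → x = 0) →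
      ∀ᶠ l in 𝓝[Icc 0 1] l₀, μ ∉ spectrum ℝ (A l) := fun μ hμ hinj => by
    have hu : IsUnit (A l₀ - μ • ContinuousLinearMap.id ℝ V) := by
      refine isUnit_of_isSymmetric_of_isFredholm (fun x y => ?_)
        (hfred l₀ (hp.self_of_nhdsWithin hl₀) μ hμ) fun x hx => hinj x ?_
      · have := hA.symmetric l₀ hl₀ x y
        simp only [ContinuousLinearMap.coe_coe] at this
        simp [inner_sub_left, inner_sub_right, real_inner_smul_left, real_inner_smul_right, this]
      · simpa [sub_eq_zero] using hx
    have ht : Tendsto (fun l => A l - μ • ContinuousLinearMap.id ℝ V) (𝓝[Icc 0 1] l₀)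
      (𝓝 (A l₀ - μ • ContinuousLinearMap.id ℝ V)) := hAl.sub_const _
    filter_upwards [ht.eventually (Units.isOpen.mem_nhds hu)] with l hl
    rw [spectrum.notMem_iff, ← neg_sub]
    exact hl.neg
  have habs : |a| < ε := by rw [abs_of_pos haE.1]; exact haE.2
  refine ⟨a, haE.1, ?_⟩
  filter_upwards [hp, hspec a habs fun x hx => by_contra fun h0 => ha.1 ⟨x, h0, hx⟩,
    hspec (-a) (by rwa [abs_neg]) fun x hx => by_contra fun h0 => ha.2 ⟨x, h0, hx⟩] with l h1 h2 h3
  refine ⟨⟨h2, h3⟩, Set.disjoint_left.2 fun μ hμ hess => hess (hfred l h1 μ ?_)⟩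
  exact (abs_le.2 hμ).trans_lt haE.2

lemma IsModeDecomposition.nonempty_spectralPartition (hM : IsModeDecomposition π A M)
    (hA : IsFSPath π A) : Nonempty (SpectralPartition A) := by
  have hloc : ∀ l₀ : Icc (0 : ℝ) 1, ∃ a > 0, ∃ U : Set ℝ, IsOpen U ∧ (l₀ : ℝ) ∈ U ∧
      ∀ l ∈ U ∩ Icc 0 1, (a ∉ spectrum ℝ (A l) ∧ -a ∉ spectrum ℝ (A l)) ∧
        Disjoint (Icc (-a) a) (essSpectrum (A l)) := fun l₀ => by
    obtain ⟨a, ha, h⟩ := hM.exists_local_spectral_bound hA l₀.2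
    obtain ⟨U, hU, hmem, hsub⟩ := mem_nhdsWithin.1 h
    exact ⟨a, ha, U, hU, hmem, hsub⟩
  choose a ha U hU hmem hsub using hloc
  obtain ⟨δ, hδ, hleb⟩ := lebesgue_number_lemma_of_metric isCompact_Icc hU
    fun x hx => mem_iUnion.2 ⟨⟨x, hx⟩, hmem ⟨x, hx⟩⟩
  obtain ⟨m, hm⟩ := exists_nat_one_div_lt hδ
  have hm0 : (0 : ℝ) < (m : ℝ) + 1 := by positivity
  -- the points `i / (m + 1)`, with mesh smaller than the Lebesgue number `δ`, form the partition
  have hpt : ∀ i : Fin (m + 1), ((i.castSucc : ℕ) : ℝ) / (m + 1) ∈ Icc (0 : ℝ) 1 := fun i => by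
    refine ⟨by positivity, (div_le_one hm0).2 ?_⟩
    exact_mod_cast i.castSucc.is_le
  choose c hc using fun i => hleb _ (hpt i)
  have hgood : ∀ (i : Fin (m + 1)), ∀ l ∈ Icc (((i.castSucc : ℕ) : ℝ) / (m + 1))
      (((i.succ : ℕ) : ℝ) / (m + 1)), l ∈ U (c i) ∩ Icc 0 1 := fun i l hl => by
    have h1 : ((i.succ : ℕ) : ℝ) / (m + 1) = ((i.castSucc : ℕ) : ℝ) / (m + 1) + 1 / (m + 1) := by
      rw [Fin.val_succ, Fin.val_castSucc]
      push_cast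
      ring
    refine ⟨hc i ?_, (hpt i).1.trans hl.1, hl.2.trans ((div_le_one hm0).2 ?_)⟩
    · rw [Metric.mem_ball, Real.dist_eq, abs_of_nonneg (sub_nonneg.2 hl.1)]
      linarith [hl.2]
    · exact_mod_cast i.succ.is_le
  exact ⟨{
    N := m + 1
    pt := fun i => ((i : ℕ) : ℝ) / (m + 1)
    a := fun i => a (c i)
    pt_strictMono := fun i j hij => by
      have : ((i : ℕ) : ℝ) < ((j : ℕ) : ℝ) := by exact_mod_cast hij
      exact div_lt_div_of_pos_right this hm0
    pt_zero := by simp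
    pt_last := by
      rw [Fin.val_last]
      push_cast
      exact div_self hm0.ne'
    a_pos := fun i => ha _
    notMem_spectrum := fun i l hl => (hsub _ l (hgood i l hl)).1
    disjoint_essSpectrum := fun i l hl => (hsub _ l (hgood i l hl)).2 }⟩

end Modes

/-! ### The real trigonometric system and Fourier coefficients in `L²` -/

section Trig

lemma continuous_csin_zsmul (m : ℤ) : Continuous fun t : Circ => csin (m • t) :=
  continuous_csin.comp (continuous_const_smul m)

lemma continuous_ccos_zsmul (m : ℤ) : Continuous fun t : Circ => ccos (m • t) :=
  continuous_ccos.comp (continuous_const_smul m)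

lemma integrable_of_continuous {E : Type*} [NormedAddCommGroup E] {f : Circ → E}
    (hf : Continuous f) : Integrable f (volume : Measure Circ) :=
  hf.integrable_of_hasCompactSupport (HasCompactSupport.of_compactSpace f)

lemma zsmul_pi_div {m : ℤ} (hm : m ≠ 0) :
    m • ((Real.pi / m : ℝ) : Circ) = ((Real.pi : ℝ) : Circ) := by
  change ((m • (Real.pi / m) : ℝ) : Circ) = _
  rw [zsmul_eq_mul, mul_div_cancel₀ _ (Int.cast_ne_zero.2 hm)]

/-- Translation by half a period changes the sign of `cos (m t)`, so that its integral vanishes. -/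
lemma integral_ccos_zsmul {m : ℤ} (hm : m ≠ 0) : ∫ t : Circ, ccos (m • t) = 0 := by
  have h := integral_add_right_eq_self (μ := (volume : Measure Circ))
    (fun t : Circ => ccos (m • t)) ((Real.pi / m : ℝ) : Circ)
  simp only [smul_add, zsmul_pi_div hm, ccos_add, ccos_coe, csin_coe, Real.cos_pi, Real.sin_pi,
    mul_zero, sub_zero, mul_neg, mul_one] at h
  rw [integral_neg] at h
  linarith

lemma integral_csin_zsmul (m : ℤ) : ∫ t : Circ, csin (m • t) = 0 := by
  rcases eq_or_ne m 0 with rfl | hm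
  · simp [csin_zero]
  have h := integral_add_right_eq_self (μ := (volume : Measure Circ))
    (fun t : Circ => csin (m • t)) ((Real.pi / m : ℝ) : Circ)
  simp only [smul_add, zsmul_pi_div hm, csin_add, ccos_coe, csin_coe, Real.cos_pi, Real.sin_pi,
    mul_zero, add_zero, mul_neg, mul_one] at h
  rw [integral_neg] at h
  linarith

/-- The orthonormal trigonometric system, indexed by the integers: `1 / √(2π)` for `m = 0`,
`sin (m t) / √π` for `m > 0` and `cos (m t) / √π` for `m < 0`. -/
def trig (m : ℤ) (t : Circ) : ℝ :=
  if m = 0 then 1 / √(2 * Real.pi)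
  else if 0 < m then 1 / √Real.pi * csin (m • t) else 1 / √Real.pi * ccos (m • t)

lemma trig_zero (t : Circ) : trig 0 t = 1 / √(2 * Real.pi) := if_pos rfl

lemma trig_of_pos {m : ℤ} (hm : 0 < m) (t : Circ) : trig m t = 1 / √Real.pi * csin (m • t) := by
  rw [trig, if_neg hm.ne', if_pos hm]

lemma trig_of_neg {m : ℤ} (hm : m < 0) (t : Circ) : trig m t = 1 / √Real.pi * ccos (m • t) := by
  rw [trig, if_neg hm.ne, if_neg hm.not_gt]

lemma continuous_trig (m : ℤ) : Continuous (trig m) := by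
  rcases lt_trichotomy m 0 with h | rfl | h
  · simpa only [funext (trig_of_neg h)] using (continuous_ccos_zsmul m).const_mul _
  · simpa only [funext trig_zero] using continuous_const
  · simpa only [funext (trig_of_pos h)] using (continuous_csin_zsmul m).const_mul _

lemma abs_trig_le (m : ℤ) (t : Circ) : |trig m t| ≤ 1 := by
  have hb : ∀ x : Circ, |csin x| ≤ 1 ∧ |ccos x| ≤ 1 := fun x => by
    have h := ccos_sq_add_csin_sq x
    exact ⟨abs_le_one_iff_mul_self_le_one.2 (by nlinarith [sq_nonneg (ccos x)]),
      abs_le_one_iff_mul_self_le_one.2 (by nlinarith [sq_nonneg (csin x)])⟩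
  have hsq : ∀ c : ℝ, 1 ≤ c → |1 / √c| ≤ 1 := fun c hc => by
    have h1 : 1 ≤ √c := Real.one_le_sqrt.2 hc
    rw [abs_of_pos (by positivity), div_le_one (by positivity)]
    exact h1
  have hpi := Real.pi_gt_three
  rcases lt_trichotomy m 0 with h | rfl | h
  · rw [trig_of_neg h, abs_mul]
    exact mul_le_one₀ (hsq _ (by linarith)) (abs_nonneg _) (hb _).2
  · rw [trig_zero]
    exact hsq _ (by linarith)
  · rw [trig_of_pos h, abs_mul]
    exact mul_le_one₀ (hsq _ (by linarith)) (abs_nonneg _) (hb _).1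

lemma trig_sub (m : ℤ) (t Θ : Circ) :
    trig m (t - Θ) = ccos (m • Θ) * trig m t - csin (m • Θ) * trig (-m) t := by
  rcases lt_trichotomy m 0 with h | rfl | h
  · rw [trig_of_neg h, trig_of_neg h, trig_of_pos (neg_pos.2 h), smul_sub, sub_eq_add_neg, ccos_add,
      csin_neg, ccos_neg, neg_smul, csin_neg]
    ring
  · simp [trig_zero, ccos_zero, csin_zero]
  · rw [trig_of_pos h, trig_of_pos h, trig_of_neg (neg_lt_zero.2 h), smul_sub, sub_eq_add_neg,
      csin_add, csin_neg, ccos_neg, neg_smul, ccos_neg]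
    ring

lemma one_div_sqrt_pi_sq : (1 / √Real.pi) * (1 / √Real.pi) = 1 / Real.pi := by
  rw [div_mul_div_comm, Real.mul_self_sqrt Real.pi_pos.le, one_mul]

lemma one_div_sqrt_two_pi_sq : (1 / √(2 * Real.pi)) * (1 / √(2 * Real.pi)) = 1 / (2 * Real.pi) := by
  rw [div_mul_div_comm, Real.mul_self_sqrt Real.two_pi_pos.le, one_mul]

lemma integral_const_circ (c : ℝ) : ∫ _ : Circ, c = 2 * Real.pi * c := by
  rw [integral_const, smul_eq_mul, measureReal_def, AddCircle.measure_univ,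
    ENNReal.toReal_ofReal Real.two_pi_pos.le]

lemma integral_csin_mul_csin {m j : ℤ} (hm : 0 < m) (hj : 0 < j) :
    ∫ t : Circ, csin (m • t) * csin (j • t) = if m = j then Real.pi else 0 := by
  have h : ∀ t : Circ, csin (m • t) * csin (j • t)
      = 1 / 2 * (ccos ((m - j) • t) - ccos ((m + j) • t)) := fun t => by
    rw [sub_smul, sub_eq_add_neg (m • t), add_smul, ccos_add, ccos_add, ccos_neg, csin_neg]
    ring
  simp only [h]
  rw [integral_const_mul, integral_sub (integrable_of_continuous (continuous_ccos_zsmul _))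
    (integrable_of_continuous (continuous_ccos_zsmul _)), integral_ccos_zsmul (m := m + j) (by omega)]
  split_ifs with hmj
  · simp only [hmj, sub_self, zero_smul, ccos_zero]
    rw [integral_const_circ]
    ring
  · rw [integral_ccos_zsmul (sub_ne_zero.2 hmj)]
    ring

lemma integral_ccos_mul_ccos {m j : ℤ} (hm : m < 0) (hj : j < 0) :
    ∫ t : Circ, ccos (m • t) * ccos (j • t) = if m = j then Real.pi else 0 := by
  have h : ∀ t : Circ, ccos (m • t) * ccos (j • t)
      = 1 / 2 * (ccos ((m - j) • t) + ccos ((m + j) • t)) := fun t => by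
    rw [sub_smul, sub_eq_add_neg, add_smul, ccos_add, ccos_add, ccos_neg, csin_neg]
    ring
  simp only [h]
  rw [integral_const_mul, integral_add (integrable_of_continuous (continuous_ccos_zsmul _))
    (integrable_of_continuous (continuous_ccos_zsmul _)), integral_ccos_zsmul (m := m + j) (by omega)]
  split_ifs with hmj
  · simp only [hmj, sub_self, zero_smul, ccos_zero]
    rw [integral_const_circ]
    ring
  · rw [integral_ccos_zsmul (sub_ne_zero.2 hmj)]
    ring

lemma integral_csin_mul_ccos (m j : ℤ) : ∫ t : Circ, csin (m • t) * ccos (j • t) = 0 := by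
  have h : ∀ t : Circ, csin (m • t) * ccos (j • t)
      = 1 / 2 * (csin ((m - j) • t) + csin ((m + j) • t)) := fun t => by
    rw [sub_smul, sub_eq_add_neg, add_smul, csin_add, csin_add, ccos_neg, csin_neg]
    ring
  simp only [h]
  rw [integral_const_mul, integral_add (integrable_of_continuous (continuous_csin_zsmul _))
    (integrable_of_continuous (continuous_csin_zsmul _)), integral_csin_zsmul, integral_csin_zsmul]
  ring

lemma integral_trig_mul_trig (m j : ℤ) :
    ∫ t : Circ, trig m t * trig j t = if m = j then 1 else 0 := by
  have hpi := Real.pi_ne_zero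
  have hc : ∀ (c d : ℝ) (f g : Circ → ℝ), ∫ t : Circ, c * f t * (d * g t)
      = c * d * ∫ t : Circ, f t * g t := fun c d f g => by
    rw [← integral_const_mul]
    exact integral_congr_ae (Eventually.of_forall fun t => by ring)
  have hc1 : ∀ (c d : ℝ) (f : Circ → ℝ), ∫ t : Circ, c * f t * d
      = c * d * ∫ t : Circ, f t := fun c d f => by
    rw [← integral_const_mul]
    exact integral_congr_ae (Eventually.of_forall fun t => by ring)
  have hc2 : ∀ (c d : ℝ) (f : Circ → ℝ), ∫ t : Circ, d * (c * f t)
      = c * d * ∫ t : Circ, f t := fun c d f => by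
    rw [← integral_const_mul]
    exact integral_congr_ae (Eventually.of_forall fun t => by ring)
  have hswap : ∀ a b : ℤ, ∫ t : Circ, ccos (a • t) * csin (b • t) = 0 := fun a b => by
    simp only [mul_comm (ccos _), integral_csin_mul_ccos]
  rcases lt_trichotomy m 0 with h | rfl | h <;> rcases lt_trichotomy j 0 with h' | rfl | h'
  · simp only [trig_of_neg h, trig_of_neg h', hc, integral_ccos_mul_ccos h h', one_div_sqrt_pi_sq]
    split_ifs <;> simp [hpi]
  · simp only [trig_of_neg h, trig_zero, hc1, integral_ccos_zsmul h.ne, mul_zero, h.ne, if_false]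
  · simp only [trig_of_neg h, trig_of_pos h', hc, hswap, mul_zero, (h.trans h').ne, if_false]
  · simp only [trig_of_neg h', trig_zero, hc2, integral_ccos_zsmul h'.ne, mul_zero, h'.ne', if_false]
  · simp only [trig_zero, one_div_sqrt_two_pi_sq, integral_const_circ, if_true]
    field_simp
  · simp only [trig_of_pos h', trig_zero, hc2, integral_csin_zsmul, mul_zero, h'.ne, if_false]
  · simp only [trig_of_pos h, trig_of_neg h', hc, integral_csin_mul_ccos, mul_zero,
      (h'.trans h).ne', if_false]
  · simp only [trig_of_pos h, trig_zero, hc1, integral_csin_zsmul, mul_zero, h.ne', if_false]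
  · simp only [trig_of_pos h, trig_of_pos h', hc, integral_csin_mul_csin h h', one_div_sqrt_pi_sq]
    split_ifs <;> simp [hpi]

end Trig

section Coefficients

variable {n : ℕ}

/-- The Fourier coefficient `∫ trig m t • u(t) dt`. -/
def coef (m : ℤ) : L2 n →ₗ[ℝ] Phase n := pairing (trig m) (continuous_trig m)

lemma coef_apply (m : ℤ) (u : L2 n) : coef m u = ∫ t, trig m t • u t := rfl

lemma coef_zero (u : L2 n) : coef 0 u = √(2 * Real.pi) • meanCoeff u := by
  have h : (1 / √(2 * Real.pi)) = √(2 * Real.pi) * (1 / (2 * Real.pi)) := by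
    rw [← one_div_sqrt_two_pi_sq]
    have : √(2 * Real.pi) ≠ 0 := (Real.sqrt_pos.2 Real.two_pi_pos).ne'
    field_simp
  simp only [coef_apply, trig_zero, meanCoeff, LinearMap.smul_apply, pairing, LinearMap.coe_mk,
    AddHom.coe_mk, one_smul]
  rw [integral_smul, smul_smul, h]

lemma sqrt_pi_mul_one_div_pi : √Real.pi * (1 / Real.pi) = 1 / √Real.pi := by
  have : √Real.pi ≠ 0 := (Real.sqrt_pos.2 Real.pi_pos).ne'
  rw [← one_div_sqrt_pi_sq]
  field_simp

lemma coef_natCast {k : ℕ} (hk : k ≠ 0) (u : L2 n) : coef k u = √Real.pi • sinCoeff k u := by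
  have hk' : (0 : ℤ) < k := by omega
  simp only [coef_apply, trig_of_pos hk', sinCoeff, LinearMap.smul_apply, pairing, LinearMap.coe_mk,
    AddHom.coe_mk, mul_smul, natCast_zsmul]
  rw [integral_smul, smul_smul, sqrt_pi_mul_one_div_pi]

lemma coef_neg_natCast {k : ℕ} (hk : k ≠ 0) (u : L2 n) :
    coef (-k) u = √Real.pi • cosCoeff k u := by
  have hk' : (-k : ℤ) < 0 := by omega
  simp only [coef_apply, trig_of_neg hk', cosCoeff, LinearMap.smul_apply, pairing, LinearMap.coe_mk,
    AddHom.coe_mk, mul_smul, natCast_zsmul, neg_smul, ccos_neg]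
  rw [integral_smul, smul_smul, sqrt_pi_mul_one_div_pi]

lemma eq_zero_of_coef (u : L2 n) (h : ∀ m, coef m u = 0) : u = 0 := by
  have hpi : √Real.pi ≠ 0 := (Real.sqrt_pos.2 Real.pi_pos).ne'
  have hpi2 : √(2 * Real.pi) ≠ 0 := (Real.sqrt_pos.2 Real.two_pi_pos).ne'
  refine eq_zero_of_coeff u ?_ (fun k hk => ?_) (fun k hk => ?_)
  · exact (smul_eq_zero.1 ((coef_zero u).symm.trans (h 0))).resolve_left hpi2
  · exact (smul_eq_zero.1 ((coef_natCast hk u).symm.trans (h k))).resolve_left hpi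
  · exact (smul_eq_zero.1 ((coef_neg_natCast hk u).symm.trans (h (-k)))).resolve_left hpi

/-- The function `t ↦ trig m t • x`, as an element of `L²`. -/
def trigL2 (m : ℤ) : Phase n →ₗ[ℝ] L2 n where
  toFun x := ContinuousMap.toLp 2 (volume : Measure Circ) ℝ
    ⟨fun t => trig m t • x, (continuous_trig m).smul continuous_const⟩
  map_add' x y := by
    rw [← map_add]
    congr 1
    ext t : 1
    simp
  map_smul' c x := by
    rw [RingHom.id_apply, ← map_smul]
    congr 1
    ext t : 1
    simp [smul_comm c]

lemma trigL2_coe (m : ℤ) (x : Phase n) :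
    ∀ᵐ t ∂(volume : Measure Circ), trigL2 m x t = trig m t • x := by
  have := ContinuousMap.coeFn_toLp (p := 2) (𝕜 := ℝ) (volume : Measure Circ)
    (⟨fun t => trig m t • x, (continuous_trig m).smul continuous_const⟩ : C(Circ, Phase n))
  exact this

lemma inner_trigL2 (m : ℤ) (x : Phase n) (u : L2 n) : ⟪trigL2 m x, u⟫ = ⟪x, coef m u⟫ := by
  rw [MeasureTheory.L2.inner_def, coef_apply,
    ← integral_inner (integrable_smul_L2 (continuous_trig m) u)]
  refine integral_congr_ae ?_
  filter_upwards [trigL2_coe m x] with t ht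
  rw [ht, real_inner_smul_left, real_inner_smul_right]

lemma coef_trigL2 (m j : ℤ) (x : Phase n) : coef m (trigL2 j x) = if m = j then x else 0 := by
  have h : coef m (trigL2 j x) = ∫ t, (trig m t * trig j t) • x := by
    refine integral_congr_ae ?_
    filter_upwards [trigL2_coe j x] with t ht
    simp only [ht, smul_smul]
  rw [h, integral_smul_const, integral_trig_mul_trig]
  split_ifs <;> simp

/-- `trigL2` as an isometric embedding. -/
def trigIsometry (m : ℤ) : Phase n →ₗᵢ[ℝ] L2 n where
  toLinearMap := trigL2 m
  norm_map' x := by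
    rw [← sq_eq_sq₀ (norm_nonneg _) (norm_nonneg _), ← real_inner_self_eq_norm_sq, inner_trigL2,
      coef_trigL2, if_pos rfl, real_inner_self_eq_norm_sq]

lemma isHilbertSum_trig : IsHilbertSum ℝ (fun _ : ℤ => Phase n) (trigIsometry (n := n)) := by
  refine IsHilbertSum.mk (fun j k hjk x y => ?_) ?_
  · change ⟪trigL2 j x, trigL2 k y⟫ = 0
    rw [inner_trigL2, coef_trigL2, if_neg hjk, inner_zero_right]
  · rw [top_le_iff, Submodule.topologicalClosure_eq_top_iff, Submodule.eq_bot_iff]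
    intro u hu
    refine eq_zero_of_coef u fun m => ?_
    have h := Submodule.inner_right_of_mem_orthogonal (Submodule.mem_iSup_of_mem m
      (LinearMap.mem_range_self (trigIsometry m).toLinearMap (coef m u))) hu
    change ⟪trigL2 m (coef m u), u⟫ = 0 at h
    rwa [inner_trigL2, inner_self_eq_zero] at h

lemma linearIsometryEquiv_apply (u : L2 n) (m : ℤ) :
    isHilbertSum_trig.linearIsometryEquiv u m = coef m u := by
  classical
  refine ext_inner_left ℝ fun x => ?_
  rw [← lp.inner_single_left (G := fun _ : ℤ => Phase n),
    ← isHilbertSum_trig.linearIsometryEquiv.symm.inner_map_map,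
    LinearIsometryEquiv.symm_apply_apply, isHilbertSum_trig.linearIsometryEquiv_symm_apply_single]
  exact inner_trigL2 m x u

/-- Parseval's identity. -/
lemma hasSum_inner_coef (u v : L2 n) : HasSum (fun m => ⟪coef m u, coef m v⟫) ⟪u, v⟫ := by
  have h := lp.hasSum_inner (𝕜 := ℝ) (isHilbertSum_trig.linearIsometryEquiv u)
    (isHilbertSum_trig.linearIsometryEquiv v)
  simpa only [linearIsometryEquiv_apply, LinearIsometryEquiv.inner_map_map] using h

/-- The Riesz-Fischer theorem. -/
lemma exists_coef_eq {d : ℤ → Phase n} (hd : Summable fun m => ‖d m‖ ^ 2) :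
    ∃ u : L2 n, ∀ m, coef m u = d m := by
  have hmem : Memℓp d 2 := memℓp_gen (by simpa using hd)
  refine ⟨isHilbertSum_trig.linearIsometryEquiv.symm ⟨d, hmem⟩, fun m => ?_⟩
  rw [← linearIsometryEquiv_apply, LinearIsometryEquiv.apply_symm_apply]

end Coefficients

/-! ### `H^{1/2}` as a weighted sequence space -/

section HalfSpace

variable {n : ℕ}

/-- The weight `max 1 |m|` of the frequency `m` in the norm of `H^{1/2}`. -/
def wt (m : ℤ) : ℝ := max 1 |(m : ℝ)|

lemma one_le_wt (m : ℤ) : 1 ≤ wt m := le_max_left _ _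

lemma wt_pos (m : ℤ) : 0 < wt m := zero_lt_one.trans_le (one_le_wt m)

lemma wt_zero : wt 0 = 1 := by simp [wt]

lemma wt_neg (m : ℤ) : wt (-m) = wt m := by simp [wt]

lemma wt_natCast {k : ℕ} (hk : k ≠ 0) : wt k = k := by
  have : (1 : ℝ) ≤ k := by exact_mod_cast Nat.one_le_iff_ne_zero.2 hk
  simp [wt, this]

/-- The `m`-th Fourier coefficient of an element of `H^{1/2}`. -/
def hcoef (m : ℤ) : HHalf n →ₗ[ℝ] Phase n := coef m ∘ₗ HHalf.toL2

lemma hcoef_apply (m : ℤ) (u : HHalf n) : hcoef m u = coef m u.toL2 := rfl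

lemma wt_mul_inner_add (k : ℕ) (u v : L2 n) :
    wt k * ⟪coef k u, coef k v⟫ + wt (-k) * ⟪coef (-k) u, coef (-k) v⟫
      = Real.pi * (k * (⟪sinCoeff k u, sinCoeff k v⟫ + ⟪cosCoeff k u, cosCoeff k v⟫))
        + if k = 0 then 2 * (2 * Real.pi * ⟪meanCoeff u, meanCoeff v⟫) else 0 := by
  rcases eq_or_ne k 0 with rfl | hk
  · simp only [Nat.cast_zero, neg_zero, wt_zero, coef_zero, real_inner_smul_left,
      real_inner_smul_right, ← mul_assoc, Real.mul_self_sqrt Real.two_pi_pos.le, if_true]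
    ring
  · rw [wt_neg, wt_natCast hk, coef_natCast hk, coef_natCast hk, coef_neg_natCast hk,
      coef_neg_natCast hk, if_neg hk]
    simp only [real_inner_smul_left, real_inner_smul_right]
    linear_combination (k : ℝ) * (⟪sinCoeff k u, sinCoeff k v⟫ + ⟪cosCoeff k u, cosCoeff k v⟫)
      * Real.mul_self_sqrt Real.pi_pos.le

/-- The condition defining `H^{1/2}` does not involve the constant coefficient, but weighting it by
`wt 0 = 1` makes no difference. -/
lemma mem_halfSubmodule_iff (u : L2 n) :
    u ∈ halfSubmodule n ↔ Summable fun m : ℤ => wt m * ‖coef m u‖ ^ 2 := by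
  have key : ∀ k : ℕ, wt k * ‖coef k u‖ ^ 2 + wt (-k) * ‖coef (-k) u‖ ^ 2
      = Real.pi * (k * (‖sinCoeff k u‖ ^ 2 + ‖cosCoeff k u‖ ^ 2))
        + if k = 0 then 2 * (2 * Real.pi * ‖meanCoeff u‖ ^ 2) else 0 := fun k => by
    simpa only [real_inner_self_eq_norm_sq] using wt_mul_inner_add k u u
  have hite : Summable fun k : ℕ => if k = 0 then 2 * (2 * Real.pi * ‖meanCoeff u‖ ^ 2) else 0 :=
    (hasSum_ite_eq 0 _).summable
  change Summable (fun k : ℕ => (k : ℝ) * (‖sinCoeff k u‖ ^ 2 + ‖cosCoeff k u‖ ^ 2)) ↔ _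
  constructor
  · intro h
    have h1 := ((h.mul_left Real.pi).add hite).congr fun k => (key k).symm
    have hnn : ∀ m : ℤ, 0 ≤ wt m * ‖coef m u‖ ^ 2 := fun m =>
      mul_nonneg (wt_pos m).le (sq_nonneg _)
    exact Summable.of_nat_of_neg
      (h1.of_nonneg_of_le (fun k => hnn k) fun k => le_add_of_nonneg_right (hnn _))
      (h1.of_nonneg_of_le (fun k => hnn (-k)) fun k => le_add_of_nonneg_left (hnn _))
  · intro h
    have h1 := (h.nat_add_neg.sub hite).congr (g := fun k : ℕ =>
      Real.pi * (k * (‖sinCoeff k u‖ ^ 2 + ‖cosCoeff k u‖ ^ 2))) fun k => by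
        have := key k
        simp only [sub_eq_iff_eq_add] at this ⊢
        exact this
    exact (summable_mul_left_iff Real.pi_ne_zero).1 h1

lemma summable_wt_mul_norm_sq (u : HHalf n) : Summable fun m => wt m * ‖hcoef m u‖ ^ 2 :=
  (mem_halfSubmodule_iff _).1 u.2

lemma summable_wt_mul_inner (u v : HHalf n) :
    Summable fun m => wt m * ⟪hcoef m u, hcoef m v⟫ := by
  refine Summable.of_norm_bounded ((summable_wt_mul_norm_sq u).add (summable_wt_mul_norm_sq v))
    fun m => ?_
  rw [Real.norm_eq_abs, abs_mul, abs_of_pos (wt_pos m), ← mul_add]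
  refine mul_le_mul_of_nonneg_left ((abs_real_inner_le_norm _ _).trans ?_) (wt_pos m).le
  nlinarith [sq_nonneg (‖hcoef m u‖ - ‖hcoef m v‖), sq_nonneg (‖hcoef m u‖ + ‖hcoef m v‖)]

/-- In terms of the normalized Fourier coefficients, the inner product of `H^{1/2}` is a weighted
`ℓ²` product. -/
lemma hasSum_inner_half (u v : HHalf n) :
    HasSum (fun m => wt m * ⟪hcoef m u, hcoef m v⟫) ⟪u, v⟫ := by
  have h := (summable_wt_mul_inner u v)
  convert h.hasSum using 1
  have h1 := h.hasSum.nat_add_neg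
  have h2 : HasSum (fun k : ℕ => wt k * ⟪hcoef k u, hcoef k v⟫
      + wt (-k) * ⟪hcoef (-k) u, hcoef (-k) v⟫)
      (Real.pi * ∑' k : ℕ, (k : ℝ) * (⟪sinCoeff k u.toL2, sinCoeff k v.toL2⟫
        + ⟪cosCoeff k u.toL2, cosCoeff k v.toL2⟫)
        + 2 * (2 * Real.pi * ⟪meanCoeff u.toL2, meanCoeff v.toL2⟫)) := by
    simp only [hcoef_apply, wt_mul_inner_add]
    exact ((u.summable_inner v).hasSum.mul_left Real.pi).add (hasSum_ite_eq 0 _)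
  have h3 := h1.unique h2
  have h4 : wt 0 * ⟪hcoef 0 u, hcoef 0 v⟫
      = 2 * Real.pi * ⟪meanCoeff u.toL2, meanCoeff v.toL2⟫ := by
    rw [wt_zero, hcoef_apply, hcoef_apply, coef_zero, coef_zero, real_inner_smul_left,
      real_inner_smul_right, ← mul_assoc (√_), Real.mul_self_sqrt Real.two_pi_pos.le, one_mul]
  change 2 * Real.pi * ⟪meanCoeff u.toL2, meanCoeff v.toL2⟫
    + Real.pi * ∑' k : ℕ, (k : ℝ) *
      (⟪sinCoeff k u.toL2, sinCoeff k v.toL2⟫ + ⟪cosCoeff k u.toL2, cosCoeff k v.toL2⟫) = _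
  linarith

lemma hasSum_norm_sq_half (u : HHalf n) : HasSum (fun m => wt m * ‖hcoef m u‖ ^ 2) (‖u‖ ^ 2) := by
  simpa only [real_inner_self_eq_norm_sq] using hasSum_inner_half u u

lemma half_ext {u v : HHalf n} (h : ∀ m, hcoef m u = hcoef m v) : u = v := by
  refine HHalf.toL2_injective (sub_eq_zero.1 (eq_zero_of_coef _ fun m => ?_))
  rw [map_sub, sub_eq_zero]
  exact h m

lemma exists_hcoef_eq {d : ℤ → Phase n} (hd : Summable fun m => wt m * ‖d m‖ ^ 2) :
    ∃ u : HHalf n, ∀ m, hcoef m u = d m := by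
  obtain ⟨u, hu⟩ := exists_coef_eq (hd.of_nonneg_of_le (fun m => sq_nonneg ‖d m‖) fun m =>
    le_mul_of_one_le_left (sq_nonneg _) (one_le_wt m))
  exact ⟨⟨u, (mem_halfSubmodule_iff u).2 (by simpa only [hu] using hd)⟩, hu⟩

/-- The isometry from `H^{1/2}` to `ℓ²` given by the weighted Fourier coefficients. -/
def weightedCoef (n : ℕ) : HHalf n →ₗᵢ[ℝ] lp (fun _ : ℤ => Phase n) 2 where
  toFun u := ⟨fun m => √(wt m) • hcoef m u, memℓp_gen (by
    simpa [norm_smul, mul_pow, Real.sq_sqrt (wt_pos _).le] using summable_wt_mul_norm_sq u)⟩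
  map_add' u v := by
    ext m : 2
    change √(wt m) • hcoef m (u + v) = √(wt m) • hcoef m u + √(wt m) • hcoef m v
    rw [map_add, smul_add]
  map_smul' c u := by
    ext m : 2
    change √(wt m) • hcoef m (c • u) = c • √(wt m) • hcoef m u
    rw [map_smul, smul_comm]
  norm_map' u := by
    rw [← sq_eq_sq₀ (norm_nonneg _) (norm_nonneg _), ← real_inner_self_eq_norm_sq]
    refine (lp.hasSum_inner (𝕜 := ℝ) _ _).unique ?_
    refine (hasSum_norm_sq_half u).congr_fun fun m => ?_
    change ⟪√(wt m) • hcoef m u, √(wt m) • hcoef m u⟫ = _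
    rw [real_inner_self_eq_norm_sq, norm_smul, mul_pow, Real.norm_eq_abs, sq_abs,
      Real.sq_sqrt (wt_pos m).le]

instance (n : ℕ) : CompleteSpace (HHalf n) := by
  have hsurj : Function.Surjective (weightedCoef n) := fun f => by
    have hs := lp.hasSum_norm (p := 2) (by norm_num) f
    obtain ⟨u, hu⟩ := exists_hcoef_eq (d := fun m => (√(wt m))⁻¹ • f m) (by
      convert hs.summable using 2 with m
      have : wt m ≠ 0 := (wt_pos m).ne'
      simp [norm_smul, mul_pow, Real.sq_sqrt (wt_pos _).le, this])
    refine ⟨u, ?_⟩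
    ext m : 2
    change √(wt m) • hcoef m u = f m
    rw [hu, smul_inv_smul₀ (Real.sqrt_pos.2 (wt_pos m)).ne']
  exact (completeSpace_congr (LinearIsometryEquiv.ofSurjective (weightedCoef n)
    hsurj).isometry.isUniformEmbedding (e := (LinearIsometryEquiv.ofSurjective (weightedCoef n)
    hsurj).toEquiv)).2 inferInstance

/-- The function `t ↦ trig m t • x`, as an element of `H^{1/2}`. -/
def trigHalf (m : ℤ) : Phase n →ₗ[ℝ] HHalf n :=
  LinearMap.codRestrict (halfSubmodule n) (trigL2 m) fun x => by
    rw [mem_halfSubmodule_iff]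
    refine summable_of_ne_finset_zero (s := {m}) fun j hj => ?_
    rw [coef_trigL2, if_neg (by simpa using hj), norm_zero]
    ring

lemma hcoef_trigHalf (m j : ℤ) (x : Phase n) :
    hcoef m (trigHalf j x) = if m = j then x else 0 := coef_trigL2 m j x

lemma inner_trigHalf (m : ℤ) (x : Phase n) (u : HHalf n) :
    ⟪trigHalf m x, u⟫ = wt m * ⟪x, hcoef m u⟫ := by
  refine (hasSum_inner_half _ u).unique ?_
  convert hasSum_ite_eq m (wt m * ⟪x, hcoef m u⟫) using 2 with j
  rw [hcoef_trigHalf]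
  split_ifs with h
  · rw [h]
  · simp

/-- Operators of `H^{1/2}` may be prescribed through a uniformly bounded family of maps between
Fourier coefficients of equal weight. -/
lemma exists_coefficient_operator (τ : Equiv.Perm ℤ) (hτ : ∀ m, wt (τ m) = wt m)
    (B : ℤ → Phase n →L[ℝ] Phase n) {K : ℝ} (hK : 0 ≤ K) (hB : ∀ m, ‖B m‖ ≤ K) :
    ∃ T : HHalf n →L[ℝ] HHalf n, (∀ u m, hcoef m (T u) = B m (hcoef (τ m) u)) ∧ ‖T‖ ≤ K := by
  have hs : ∀ u : HHalf n, HasSum (fun m => K ^ 2 * (wt m * ‖hcoef (τ m) u‖ ^ 2))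
      (K ^ 2 * ‖u‖ ^ 2) := fun u => by
    refine HasSum.mul_left _ ?_
    simpa only [Function.comp_def, hτ] using (τ.hasSum_iff).2 (hasSum_norm_sq_half u)
  have hle : ∀ (u : HHalf n) m, wt m * ‖B m (hcoef (τ m) u)‖ ^ 2
      ≤ K ^ 2 * (wt m * ‖hcoef (τ m) u‖ ^ 2) := fun u m => by
    have h1 : ‖B m (hcoef (τ m) u)‖ ≤ K * ‖hcoef (τ m) u‖ :=
      ((B m).le_opNorm _).trans (mul_le_mul_of_nonneg_right (hB m) (norm_nonneg _))
    have h2 := mul_le_mul_of_nonneg_left (pow_le_pow_left₀ (norm_nonneg _) h1 2) (wt_pos m).le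
    linarith [h2]
  have hex : ∀ u : HHalf n, ∃ w : HHalf n, ∀ m, hcoef m w = B m (hcoef (τ m) u) := fun u =>
    exists_hcoef_eq ((hs u).summable.of_nonneg_of_le
      (fun m => mul_nonneg (wt_pos m).le (sq_nonneg _)) (hle u))
  choose f hf using hex
  let T₀ : HHalf n →ₗ[ℝ] HHalf n :=
    { toFun := f
      map_add' := fun u v => half_ext fun m => by simp [hf]
      map_smul' := fun c u => half_ext fun m => by simp [hf] }
  refine ⟨T₀.mkContinuous K fun u => ?_, hf, LinearMap.mkContinuous_norm_le _ hK _⟩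
  refine (sq_le_sq₀ (norm_nonneg _) (by positivity)).1 ?_
  rw [mul_pow]
  refine hasSum_le (hle u) ?_ (hs u)
  have h := hasSum_norm_sq_half (f u)
  simp only [hf] at h
  exact h

end HalfSpace

/-! ### The operators of the linearized Hamiltonian system -/

section Operators

variable {n : ℕ}

lemma opOf_mul (M N : Matrix (Idx n) (Idx n) ℝ) (x : Phase n) :
    opOf (M * N) x = opOf M (opOf N x) := by
  rw [opOf, map_mul, mul_apply_eq_comp]

lemma inner_opOf (M : Matrix (Idx n) (Idx n) ℝ) (x y : Phase n) :
    ⟪opOf M x, y⟫ = ⟪x, opOf M.transpose y⟫ := by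
  have h : M.transpose = star M := (Matrix.conjTranspose_eq_transpose_of_trivial M).symm
  rw [h, opOf, opOf, map_star, ContinuousLinearMap.star_eq_adjoint,
    ContinuousLinearMap.adjoint_inner_right]

lemma opOf_J_opOf_J (x : Phase n) :
    opOf (Matrix.J (Fin n) ℝ) (opOf (Matrix.J (Fin n) ℝ) x) = -x := by
  rw [← opOf_mul, Matrix.J_squared, opOf, map_neg, map_one, neg_apply, one_apply_eq_self]

lemma inner_opOf_J (x y : Phase n) :
    ⟪opOf (Matrix.J (Fin n) ℝ) x, y⟫ = -⟪x, opOf (Matrix.J (Fin n) ℝ) y⟫ := by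
  rw [inner_opOf, Matrix.J_transpose, opOf, map_neg, neg_apply, inner_neg_right]

lemma continuous_opOf : Continuous (opOf (n := n)) := by
  let f : Matrix (Idx n) (Idx n) ℝ →ₗ[ℝ] (Phase n →L[ℝ] Phase n) :=
    (Matrix.toEuclideanCLM (𝕜 := ℝ) (n := Idx n)).toAlgEquiv.toLinearMap
  exact f.continuous_of_finiteDimensional

lemma coef_actL2 (M : Matrix (Idx n) (Idx n) ℝ) (Θ : Circ) (u : L2 n) (m : ℤ) :
    coef m (actL2 M Θ u) = opOf M (ccos (m • Θ) • coef m u - csin (m • Θ) • coef (-m) u) := by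
  rw [coef_apply, integral_smul_actL2 M Θ u (continuous_trig m)]
  congr 1
  have h := fun m => integrable_smul_L2 (continuous_trig m) u
  rw [coef_apply, coef_apply, ← integral_smul, ← integral_smul, ← integral_sub ((h _).fun_smul _)
    ((h _).fun_smul _)]
  refine integral_congr_ae (Eventually.of_forall fun t => ?_)
  simp only [trig_sub, sub_smul, smul_smul]

lemma hasSum_integral_inner_opOf (M : Matrix (Idx n) (Idx n) ℝ) (u v : L2 n) :
    HasSum (fun m => ⟪opOf M (coef m u), coef m v⟫) (∫ t : Circ, ⟪opOf M (u t), v t⟫) := by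
  have h := hasSum_inner_coef (actL2 M 0 u) v
  simp only [coef_actL2, smul_zero, ccos_zero, csin_zero, one_smul, zero_smul, sub_zero] at h
  convert h using 1
  rw [MeasureTheory.L2.inner_def]
  refine integral_congr_ae ?_
  filter_upwards [actL2_coe M 0 u] with t ht
  rw [ht, add_zero]

lemma abs_sign_le (m : ℤ) : |(m.sign : ℝ)| ≤ 1 := by
  rcases lt_trichotomy m 0 with h | rfl | h
  · simp [Int.sign_eq_neg_one_of_neg h]
  · simp
  · simp [Int.sign_eq_one_of_pos h]

lemma wt_mul_sign (m : ℤ) : wt m * (m.sign : ℝ) = m := by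
  rcases eq_or_ne m 0 with rfl | hm
  · simp
  have h1 : (1 : ℝ) ≤ |(m : ℝ)| := by exact_mod_cast Int.one_le_abs hm
  rw [wt, max_eq_right h1]
  exact_mod_cast (mul_comm _ _).trans (Int.sign_mul_abs m)

lemma sign_mul_sign_neg {m : ℤ} (hm : m ≠ 0) : (m.sign : ℝ) * ((-m).sign : ℝ) = -1 := by
  rcases lt_or_gt_of_ne hm with h | h
  · simp [Int.sign_eq_neg_one_of_neg h]
  · simp [Int.sign_eq_one_of_pos h]

lemma exists_derivOp (n : ℕ) : ∃ T : HHalf n →L[ℝ] HHalf n, ∀ u m,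
    hcoef m (T u) = -(m.sign : ℝ) • opOf (Matrix.J (Fin n) ℝ) (hcoef (-m) u) := by
  obtain ⟨T, hT, -⟩ := exists_coefficient_operator (Equiv.neg ℤ) wt_neg
    (fun m => -(m.sign : ℝ) • opOf (Matrix.J (Fin n) ℝ)) (norm_nonneg (opOf (Matrix.J (Fin n) ℝ)))
    fun m => by
      rw [norm_smul, norm_neg, Real.norm_eq_abs]
      exact mul_le_of_le_one_left (norm_nonneg _) (abs_sign_le m)
  exact ⟨T, hT⟩

/-- The operator representing the form `∫ ⟪J u', v⟫` with respect to the scalar product of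
`H^{1/2}`. -/
def derivOp (n : ℕ) : HHalf n →L[ℝ] HHalf n := (exists_derivOp n).choose

lemma hcoef_derivOp (u : HHalf n) (m : ℤ) : hcoef m (derivOp n u)
    = -(m.sign : ℝ) • opOf (Matrix.J (Fin n) ℝ) (hcoef (-m) u) :=
  (exists_derivOp n).choose_spec u m

lemma norm_inv_wt_smul_le (M : Phase n →L[ℝ] Phase n) (m : ℤ) : ‖(wt m)⁻¹ • M‖ ≤ ‖M‖ := by
  rw [norm_smul, norm_inv, Real.norm_eq_abs, abs_of_pos (wt_pos m)]
  exact mul_le_of_le_one_left (norm_nonneg _) (inv_le_one_of_one_le₀ (one_le_wt m))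

lemma exists_multOp (M : Matrix (Idx n) (Idx n) ℝ) : ∃ T : HHalf n →L[ℝ] HHalf n,
    ∀ u m, hcoef m (T u) = (wt m)⁻¹ • opOf M (hcoef m u) := by
  obtain ⟨T, hT, -⟩ := exists_coefficient_operator (Equiv.refl ℤ) (fun _ => rfl)
    (fun m => (wt m)⁻¹ • opOf M) (norm_nonneg (opOf M)) (norm_inv_wt_smul_le _)
  exact ⟨T, hT⟩

/-- The operator representing the form `∫ ⟪M u, v⟫` with respect to the scalar product of
`H^{1/2}`. -/
def multOp (M : Matrix (Idx n) (Idx n) ℝ) : HHalf n →L[ℝ] HHalf n := (exists_multOp M).choose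

lemma hcoef_multOp (M : Matrix (Idx n) (Idx n) ℝ) (u : HHalf n) (m : ℤ) :
    hcoef m (multOp M u) = (wt m)⁻¹ • opOf M (hcoef m u) := (exists_multOp M).choose_spec u m

lemma continuous_multOp : Continuous (multOp (n := n)) := by
  let f : Matrix (Idx n) (Idx n) ℝ →ₗ[ℝ] (HHalf n →L[ℝ] HHalf n) :=
    { toFun := multOp
      map_add' := fun M N => by
        ext1 u
        refine half_ext fun m => ?_
        simp only [add_apply, map_add, hcoef_multOp, opOf, smul_add]
      map_smul' := fun c M => by
        ext1 u
        refine half_ext fun m => ?_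
        simp only [smul_apply, map_smul, hcoef_multOp, opOf, RingHom.id_apply, smul_comm c] }
  exact f.continuous_of_finiteDimensional

lemma inner_multOp (M : Matrix (Idx n) (Idx n) ℝ) (u v : HHalf n) :
    ⟪multOp M u, v⟫ = ∫ t : Circ, ⟪opOf M (u.toL2 t), v.toL2 t⟫ := by
  refine (hasSum_inner_half _ v).unique
    ((hasSum_integral_inner_opOf M u.toL2 v.toL2).congr_fun fun m => ?_)
  rw [hcoef_multOp, real_inner_smul_left, mul_inv_cancel_left₀ (wt_pos m).ne']
  rfl

lemma isSymmetric_multOp {M : Matrix (Idx n) (Idx n) ℝ} (hM : M.IsSymm) :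
    (multOp M : HHalf n →ₗ[ℝ] HHalf n).IsSymmetric := fun u v => by
  refine (hasSum_inner_half (multOp M u) v).unique
    ((hasSum_inner_half u (multOp M v)).congr_fun fun m => ?_)
  rw [hcoef_multOp, hcoef_multOp, real_inner_smul_left, real_inner_smul_right, inner_opOf, hM.eq]

lemma isSymmetric_derivOp (n : ℕ) : (derivOp n : HHalf n →ₗ[ℝ] HHalf n).IsSymmetric := fun u v => by
  refine (hasSum_inner_half (derivOp n u) v).unique
    (((Equiv.neg ℤ).hasSum_iff.2 (hasSum_inner_half u (derivOp n v))).congr_fun fun m => ?_)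
  simp only [Function.comp_apply, Equiv.neg_apply, hcoef_derivOp, neg_neg, real_inner_smul_left,
    real_inner_smul_right, inner_opOf_J, wt_neg, Int.sign_neg, Int.cast_neg]
  ring

/-- The Fourier coefficients of a weak derivative; the test functions are the functions `trig m`,
with `trig m` having derivative `m * trig (-m)`. -/
lemma coef_of_isWeakDeriv {u w : L2 n} (h : IsWeakDeriv u w) (m : ℤ) :
    coef m w = -(m : ℝ) • coef (-m) u := by
  let φ : ℝ → ℝ := fun t => trig m (t : Circ)
  have hz : ∀ (j : ℤ) (t : ℝ), j • (t : Circ) = ((j * t : ℝ) : Circ) := fun j t => by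
    change ((j • t : ℝ) : Circ) = _
    rw [zsmul_eq_mul]
  have hφ : ContDiff ℝ ∞ φ ∧ ∀ t, deriv φ t = m * trig (-m) (t : Circ) := by
    rcases lt_trichotomy m 0 with hm | rfl | hm
    · have e : φ = fun t => 1 / √Real.pi * Real.cos (m * t) := funext fun t => by
        simp only [φ, trig_of_neg hm, hz, ccos_coe]
      rw [e]
      refine ⟨by fun_prop, fun t => ?_⟩
      rw [trig_of_pos (neg_pos.2 hm), neg_smul, csin_neg, hz, csin_coe]
      have hd := (((hasDerivAt_id t).const_mul (m : ℝ)).cos).const_mul (1 / √Real.pi)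
      refine hd.deriv.trans ?_
      simp only [id]
      ring
    · have e : φ = fun t => 1 / √(2 * Real.pi) := funext fun t => by simp only [φ, trig_zero]
      rw [e]
      exact ⟨contDiff_const, fun t => by simp⟩
    · have e : φ = fun t => 1 / √Real.pi * Real.sin (m * t) := funext fun t => by
        simp only [φ, trig_of_pos hm, hz, csin_coe]
      rw [e]
      refine ⟨by fun_prop, fun t => ?_⟩
      rw [trig_of_neg (neg_lt_zero.2 hm), neg_smul, ccos_neg, hz, ccos_coe]
      have hd := (((hasDerivAt_id t).const_mul (m : ℝ)).sin).const_mul (1 / √Real.pi)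
      refine hd.deriv.trans ?_
      simp only [id]
      ring
  have hper : Function.Periodic φ (2 * Real.pi) := fun t => by
    simp only [φ, AddCircle.coe_add_period]
  have h1 := h φ hφ.1 hper
  have e1 := AddCircle.intervalIntegral_preimage (2 * Real.pi) 0 (fun t : Circ => trig m t • w t)
  have e2 := AddCircle.intervalIntegral_preimage (2 * Real.pi) 0
    (fun t : Circ => (m * trig (-m) t) • u t)
  rw [zero_add] at e1 e2
  simp only [hφ.2] at h1
  rw [e2, e1] at h1
  simp only [mul_smul] at h1
  rw [integral_smul] at h1
  rw [coef_apply, coef_apply, neg_smul, h1, neg_neg]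

/-- The form `∫ ⟪J u', v⟫`, extended to `H^{1/2}`. -/
def actionForm (n : ℕ) : HHalf n →L[ℝ] HHalf n →L[ℝ] ℝ :=
  (isBoundedBilinearMap_inner (𝕜 := ℝ)).toContinuousLinearMap ∘L derivOp n

lemma actionForm_apply (u v : HHalf n) : actionForm n u v = ⟪derivOp n u, v⟫ := rfl

lemma isActionForm_actionForm (n : ℕ) : IsActionForm (actionForm n) := fun u v w hw => by
  rw [actionForm_apply]
  refine (hasSum_inner_half _ v).unique
    ((hasSum_integral_inner_opOf (Matrix.J (Fin n) ℝ) w v.toL2).congr_fun fun m => ?_)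
  rw [hcoef_derivOp, coef_of_isWeakDeriv hw, real_inner_smul_left, ← mul_assoc, mul_neg,
    wt_mul_sign, map_smul, real_inner_smul_left]
  rfl

/-- The operator `L` representing the form `Γ(u, v) + ∫ ⟪M u, v⟫`. -/
def hessOp (M : Matrix (Idx n) (Idx n) ℝ) : HHalf n →L[ℝ] HHalf n := derivOp n + multOp M

lemma hcoef_hessOp (M : Matrix (Idx n) (Idx n) ℝ) (u : HHalf n) (m : ℤ) :
    hcoef m (hessOp M u) = -(m.sign : ℝ) • opOf (Matrix.J (Fin n) ℝ) (hcoef (-m) u)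
      + (wt m)⁻¹ • opOf M (hcoef m u) := by
  rw [hessOp, add_apply, map_add, hcoef_derivOp, hcoef_multOp]

lemma inner_hessOp (M : Matrix (Idx n) (Idx n) ℝ) (u v : HHalf n) :
    ⟪hessOp M u, v⟫ = actionForm n u v + ∫ t : Circ, ⟪opOf M (u.toL2 t), v.toL2 t⟫ := by
  rw [hessOp, add_apply, inner_add_left, inner_multOp, actionForm_apply]

lemma isSymmetric_hessOp {M : Matrix (Idx n) (Idx n) ℝ} (hM : M.IsSymm) :
    (hessOp M : HHalf n →ₗ[ℝ] HHalf n).IsSymmetric := fun u v => by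
  have h1 := isSymmetric_derivOp n u v
  have h2 := isSymmetric_multOp hM u v
  simp only [ContinuousLinearMap.coe_coe, hessOp, add_apply, inner_add_left, inner_add_right] at *
  rw [h1, h2]

lemma continuousOn_hessOp {S : ℝ → Matrix (Idx n) (Idx n) ℝ} {I : Set ℝ} (hS : ContinuousOn S I) :
    ContinuousOn (fun l => hessOp (S l)) I :=
  continuousOn_const.add (continuous_multOp.comp_continuousOn hS)

/-- The elements of `H^{1/2}` with frequencies in `s`. -/
def freqSpace (n : ℕ) (s : Set ℤ) : Submodule ℝ (HHalf n) where
  carrier := {u | ∀ m ∉ s, hcoef m u = 0}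
  add_mem' hu hv m hm := by rw [map_add, hu m hm, hv m hm, add_zero]
  zero_mem' m _ := map_zero _
  smul_mem' c u hu m hm := by rw [map_smul, hu m hm, smul_zero]

lemma mem_freqSpace {s : Set ℤ} {u : HHalf n} : u ∈ freqSpace n s ↔ ∀ m ∉ s, hcoef m u = 0 :=
  Iff.rfl

lemma trigHalf_mem_freqSpace {s : Set ℤ} {m : ℤ} (hm : m ∈ s) (x : Phase n) :
    trigHalf m x ∈ freqSpace n s := fun j hj => by
  rw [hcoef_trigHalf, if_neg (ne_of_mem_of_not_mem hm hj).symm]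

lemma eq_sum_trigHalf {s : Finset ℤ} {u : HHalf n} (hu : u ∈ freqSpace n s) :
    u = ∑ m ∈ s, trigHalf m (hcoef m u) := by
  refine half_ext fun j => ?_
  rw [map_sum]
  simp only [hcoef_trigHalf]
  rw [Finset.sum_ite_eq]
  split_ifs with h
  · rfl
  · exact hu j h

lemma finiteDimensional_freqSpace {s : Set ℤ} (hs : s.Finite) :
    FiniteDimensional ℝ (freqSpace n s) := by
  have := hs.to_subtype
  let f : freqSpace n s →ₗ[ℝ] (s → Phase n) :=
    LinearMap.pi fun m => hcoef m.1 ∘ₗ (freqSpace n s).subtype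
  refine FiniteDimensional.of_injective f fun u v huv => Subtype.ext (half_ext fun m => ?_)
  by_cases hm : m ∈ s
  · exact congrFun huv ⟨m, hm⟩
  · rw [u.2 m hm, v.2 m hm]

lemma hasFiniteRange_of_hcoef_eq_zero {F : HHalf n →L[ℝ] HHalf n} {s : Set ℤ} (hs : s.Finite)
    (hF : ∀ u, ∀ m ∉ s, hcoef m (F u) = 0) : (F : HHalf n →ₗ[ℝ] HHalf n).HasFiniteRange := by
  rw [LinearMap.hasFiniteRange_iff_range]
  refine Submodule.FG.of_le (T := freqSpace n s)
    (Submodule.fg_iff_finiteDimensional _ |>.2 (finiteDimensional_freqSpace hs)) ?_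
  rintro _ ⟨u, rfl⟩
  exact hF u

/-- Up to a finite rank operator, `hessOp M` is a small perturbation of the involution that equals
`derivOp` on the frequencies `m ≠ 0` and the identity on the constants: at high frequencies the
multiplication operator is damped by the factor `1 / wt m`. -/
lemma isFredholm_hessOp (M : Matrix (Idx n) (Idx n) ℝ) : (hessOp M).IsFredholm := by
  obtain ⟨P, hP, -⟩ := exists_coefficient_operator (n := n) (Equiv.refl ℤ) (fun _ => rfl)
    (fun m => if m = 0 then ContinuousLinearMap.id ℝ (Phase n) else 0)
    (norm_nonneg (ContinuousLinearMap.id ℝ (Phase n))) fun m => by split_ifs <;> simp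
  have hinv : (derivOp n + P) * (derivOp n + P) = 1 := by
    ext1 u
    refine half_ext fun m => ?_
    rw [mul_apply_eq_comp, one_apply_eq_self]
    rcases eq_or_ne m 0 with rfl | hm
    · simp [hcoef_derivOp, hP]
    · simp only [add_apply, map_add, hcoef_derivOp, hP, hm, neg_eq_zero, if_false,
        Equiv.refl_apply, neg_neg, map_smul, opOf_J_opOf_J, smul_neg, smul_smul, neg_mul, mul_neg,
        zero_apply, map_zero, smul_zero, add_zero]
      rw [sign_mul_sign_neg hm, neg_one_smul, neg_neg]
  have hunit : IsUnit (derivOp n + P) := ⟨⟨_, _, hinv, hinv⟩, rfl⟩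
  obtain ⟨ε, hε, hball⟩ := Metric.isOpen_iff.1
    (Units.isOpen (R := HHalf n →L[ℝ] HHalf n)) _ hunit
  obtain ⟨K, hK⟩ := exists_nat_gt (‖opOf M‖ / ε)
  obtain ⟨C, hC, hCn⟩ := exists_coefficient_operator (n := n) (Equiv.refl ℤ) (fun _ => rfl)
    (fun m => if K < m.natAbs then (wt m)⁻¹ • opOf M else 0) (K := ‖opOf M‖ / (K + 1))
    (by positivity) fun m => by
      split_ifs with hm
      · have h1 : (K : ℝ) + 1 ≤ wt m := by
          refine le_trans ?_ (le_max_right _ _)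
          rw [← Int.cast_abs, ← Nat.cast_natAbs]
          exact_mod_cast hm
        rw [norm_smul, norm_inv, Real.norm_eq_abs, abs_of_pos (wt_pos m), div_eq_inv_mul]
        gcongr
      · rw [norm_zero]
        positivity
  have hCε : ‖C‖ < ε := by
    refine hCn.trans_lt ?_
    rw [div_lt_iff₀ hε] at hK
    rw [div_lt_iff₀ (by positivity)]
    nlinarith
  have hU : IsUnit (derivOp n + P + C) := hball (by
    rw [Metric.mem_ball, dist_eq_norm, add_sub_cancel_left]
    exact hCε)
  have hfin : ((multOp M - C - P : HHalf n →L[ℝ] HHalf n) : HHalf n →ₗ[ℝ] HHalf n).HasFiniteRange := by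
    refine hasFiniteRange_of_hcoef_eq_zero (Set.finite_Icc (-(K : ℤ)) K) fun u m hm => ?_
    have hm1 : K < m.natAbs := by
      rw [mem_Icc] at hm
      omega
    have hm0 : m ≠ 0 := by
      rintro rfl
      simp at hm1
    simp [hcoef_multOp, hC, hP, hm1, hm0]
  have h := isFredholm_add_of_hasFiniteRange (isFredholm_of_isUnit hU) hfin
  have he : hessOp M = derivOp n + P + C + (multOp M - C - P) := by
    rw [hessOp]
    abel
  rwa [he]

end Operators

/-! ### Hessians -/

section Hessian

lemma isHessianAtZero_quadratic {V : Type*} [NormedAddCommGroup V] [InnerProductSpace ℝ V]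
    {T : V →L[ℝ] V} (hT : (T : V →ₗ[ℝ] V).IsSymmetric) :
    IsHessianAtZero (fun u => 1 / 2 * ⟪T u, u⟫) T := by
  let B : V →L[ℝ] V →L[ℝ] ℝ := (isBoundedBilinearMap_inner (𝕜 := ℝ)).toContinuousLinearMap ∘L T
  have hB : ∀ u v, B u v = ⟪T u, v⟫ := fun u v => rfl
  have hd : ∀ u, HasFDerivAt (fun u => 1 / 2 * ⟪T u, u⟫) (B u) u := fun u => by
    refine ((T.hasFDerivAt.inner ℝ (hasFDerivAt_id u)).const_mul (1 / 2)).congr_fderiv ?_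
    ext v
    have h := hT v u
    simp only [ContinuousLinearMap.coe_coe] at h
    simp [hB, h, real_inner_comm (T u) v]
    ring
  refine ⟨Eventually.of_forall fun u => (hd u).differentiableAt, B, ?_, hB⟩
  rw [show fderiv ℝ (fun u => 1 / 2 * ⟪T u, u⟫) = B from funext fun u => (hd u).fderiv]
  exact B.hasFDerivAt

/-- A function of one variable that is constant up to `o(s ^ 2)` has vanishing second derivative at
`0`: by the mean value inequality it agrees with its second order Taylor polynomial up to
`o(s ^ 2)`. -/
lemma second_deriv_eq_zero_of_isLittleO {f f' : ℝ → ℝ} {d : ℝ}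
    (hf : ∀ᶠ s in 𝓝 0, HasDerivAt f (f' s) s) (hf' : HasDerivAt f' d 0)
    (ho : (fun s => f s - f 0) =o[𝓝 0] fun s => s ^ 2) : d = 0 := by
  have h0 : f' 0 = 0 := by
    refine hf.self_of_nhds.unique ?_
    rw [hasDerivAt_iff_isLittleO]
    simp only [sub_zero, smul_eq_mul, mul_zero]
    refine ho.trans_isBigO ?_
    have : (fun s : ℝ => s ^ 2) =O[𝓝 0] fun s => s ^ 1 :=
      (Asymptotics.isLittleO_pow_pow one_lt_two).isBigO
    simpa using this
  have htaylor : (fun s => f s - f 0 - d / 2 * s ^ 2) =o[𝓝 0] fun s => s ^ 2 := by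
    rw [Asymptotics.isLittleO_iff]
    intro c hc
    rw [hasDerivAt_iff_isLittleO, Asymptotics.isLittleO_iff] at hf'
    obtain ⟨δ, hδ, hball⟩ := Metric.eventually_nhds_iff.1 (hf.and (hf' hc))
    filter_upwards [Metric.ball_mem_nhds 0 hδ] with s hs
    have hseg : ∀ x ∈ uIcc 0 s, |x| ≤ |s| := fun x hx => by
      simpa using abs_sub_left_of_mem_uIcc hx
    have hin : ∀ x ∈ uIcc 0 s, dist x 0 < δ := fun x hx => by
      rw [Real.dist_0_eq_abs]
      rw [Metric.mem_ball, Real.dist_0_eq_abs] at hs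
      exact (hseg x hx).trans_lt hs
    have hmv := (convex_uIcc (0 : ℝ) s).norm_image_sub_le_of_norm_hasDerivWithin_le
      (f := fun x => f x - d / 2 * x ^ 2) (f' := fun x => f' x - d * x) (C := c * |s|)
      (fun x hx => ?_) (fun x hx => ?_) left_mem_uIcc right_mem_uIcc
    · simp only [sub_zero, Real.norm_eq_abs] at hmv ⊢
      rw [abs_pow, sq |s|, ← mul_assoc]
      have e : f s - f 0 - d / 2 * s ^ 2 = f s - d / 2 * s ^ 2 - (f 0 - d / 2 * 0 ^ 2) := by ring
      rwa [e]
    · have h1 := (hball (hin x hx)).1.sub (((hasDerivAt_pow 2 x).const_mul (d / 2)))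
      refine (h1.congr_deriv ?_).hasDerivWithinAt
      norm_num
      ring
    · have h2 := (hball (hin x hx)).2
      simp only [sub_zero, smul_eq_mul, h0, Real.norm_eq_abs] at h2 ⊢
      rw [mul_comm d x]
      exact h2.trans (mul_le_mul_of_nonneg_left (hseg x hx) hc.le)
  have h2 : (fun s : ℝ => d / 2 * s ^ 2) =o[𝓝 0] fun s => s ^ 2 := by
    refine (ho.sub htaylor).congr_left fun s => ?_
    ring
  by_contra hd
  have h3 : (fun s : ℝ => s ^ 2) =o[𝓝 0] fun s => s ^ 2 :=
    (Asymptotics.isLittleO_const_mul_left_iff (div_ne_zero hd two_ne_zero)).1 h2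
  refine (Asymptotics.isLittleO_irrefl (Frequently.filter_mono (f := 𝓝[≠] (0 : ℝ)) ?_
    nhdsWithin_le_nhds)) h3
  exact Eventually.frequently (eventually_mem_nhdsWithin.mono fun s hs => pow_ne_zero 2 hs)

lemma IsHessianAtZero.isSymmetric {V : Type*} [NormedAddCommGroup V] [InnerProductSpace ℝ V]
    {f : V → ℝ} {T : V →L[ℝ] V} (hT : IsHessianAtZero f T) (u v : V) : ⟪T u, v⟫ = ⟪T v, u⟫ := by
  obtain ⟨hdiff, B, hB, hBT⟩ := hT
  rw [← hBT, ← hBT]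
  exact second_derivative_symmetric_of_eventually (hdiff.mono fun u hu => hu.hasFDerivAt) hB u v

/-- The Hessian in a direction `u` can be read off from an expansion of the function along the
line through `u`. -/
lemma IsHessianAtZero.inner_eq {V : Type*} [NormedAddCommGroup V] [InnerProductSpace ℝ V]
    {f : V → ℝ} {T : V →L[ℝ] V} (hT : IsHessianAtZero f T) {u : V} {q : ℝ}
    (ho : (fun s : ℝ => f (s • u) - 1 / 2 * s ^ 2 * q - f 0) =o[𝓝 0] fun s => s ^ 2) :
    ⟪T u, u⟫ = q := by
  obtain ⟨hdiff, B, hB, hBT⟩ := hT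
  have hs : ∀ s : ℝ, HasDerivAt (fun s : ℝ => s • u) u s := fun s => by
    simpa using (hasDerivAt_id s).smul_const u
  have hcont : Tendsto (fun s : ℝ => s • u) (𝓝 0) (𝓝 0) := by
    simpa using (hs 0).continuousAt.tendsto
  have hd1 : ∀ᶠ s : ℝ in 𝓝 0, HasDerivAt (fun s : ℝ => f (s • u) - 1 / 2 * s ^ 2 * q)
      (fderiv ℝ f (s • u) u - s * q) s := by
    filter_upwards [hcont.eventually hdiff] with s hsd
    have h1 : HasDerivAt (fun s : ℝ => f (s • u)) (fderiv ℝ f (s • u) u) s :=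
      hsd.hasFDerivAt.comp_hasDerivAt s (hs s)
    have h2 : HasDerivAt (fun s : ℝ => 1 / 2 * s ^ 2 * q) (s * q) s :=
      (((hasDerivAt_pow 2 s).const_mul (1 / 2)).mul_const q).congr_deriv (by push_cast; ring)
    exact h1.sub h2
  have hd2 : HasDerivAt (fun s : ℝ => fderiv ℝ f (s • u) u - s * q) (⟪T u, u⟫ - q) 0 := by
    have hB' : HasFDerivAt (fun w => fderiv ℝ f w u) (B.flip u) ((0 : ℝ) • u) := by
      rw [zero_smul]
      exact (ContinuousLinearMap.apply ℝ ℝ u).hasFDerivAt.comp (0 : V) hB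
    have h1 : HasDerivAt (fun s : ℝ => fderiv ℝ f (s • u) u) (B.flip u u) 0 :=
      HasFDerivAt.comp_hasDerivAt (l := fun w => fderiv ℝ f w u) 0 hB' (hs 0)
    have h2 : HasDerivAt (fun s : ℝ => s * q) q 0 := by
      simpa using (hasDerivAt_id (0 : ℝ)).mul_const q
    rw [← hBT]
    exact h1.sub h2
  refine sub_eq_zero.1 (second_deriv_eq_zero_of_isLittleO hd1 hd2 (ho.congr_left fun s => ?_))
  rw [zero_smul]
  ring

variable {n : ℕ}

/-- A function on `ℝ²ⁿ` with gradient `o(‖x‖)` is constant up to `o(‖x‖ ^ 2)`. -/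
lemma exists_abs_sub_le_of_gradient {R : Phase n → ℝ} (hR : Differentiable ℝ R)
    (hg : (fun x => gradient R x) =o[𝓝 0] fun x => x) {ε : ℝ} (hε : 0 < ε) :
    ∃ δ > 0, ∀ x, ‖x‖ < δ → |R x - R 0| ≤ ε * ‖x‖ ^ 2 := by
  obtain ⟨δ, hδ, hball⟩ := Metric.eventually_nhds_iff.1 (Asymptotics.isLittleO_iff.1 hg hε)
  refine ⟨δ, hδ, fun x hx => ?_⟩
  have h := (convex_closedBall (0 : Phase n) ‖x‖).norm_image_sub_le_of_norm_fderiv_le (𝕜 := ℝ)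
    (f := R) (C := ε * ‖x‖) (fun y _ => hR y) (fun y hy => ?_)
    (Metric.mem_closedBall_self (norm_nonneg x)) (mem_closedBall_zero_iff.2 le_rfl)
  · rw [sub_zero, Real.norm_eq_abs] at h
    rwa [sq, ← mul_assoc]
  · rw [mem_closedBall_zero_iff] at hy
    have h1 := hball (y := y) (by rw [dist_zero_right]; exact hy.trans_lt hx)
    rw [gradient, LinearIsometryEquiv.norm_map] at h1
    exact h1.trans (mul_le_mul_of_nonneg_left hy hε.le)

/-- `u` is essentially bounded by `C`. -/
def IsBoundedBy (u : HHalf n) (C : ℝ) : Prop :=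
  ∀ᵐ t ∂(volume : Measure Circ), ‖u.toL2 t‖ ≤ C

lemma IsBoundedBy.add {u v : HHalf n} {C D : ℝ} (hu : IsBoundedBy u C) (hv : IsBoundedBy v D) :
    IsBoundedBy (u + v) (C + D) := by
  filter_upwards [hu, hv, Lp.coeFn_add u.toL2 v.toL2] with t h1 h2 h3
  rw [map_add, h3]
  exact (norm_add_le _ _).trans (add_le_add h1 h2)

lemma IsBoundedBy.smul {u : HHalf n} {C : ℝ} (hu : IsBoundedBy u C) (s : ℝ) :
    IsBoundedBy (s • u) (|s| * C) := by
  filter_upwards [hu, Lp.coeFn_smul s u.toL2] with t h1 h2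
  rw [map_smul, h2, Pi.smul_apply, norm_smul, Real.norm_eq_abs]
  exact mul_le_mul_of_nonneg_left h1 (abs_nonneg s)

lemma isBoundedBy_trigHalf (m : ℤ) (x : Phase n) : IsBoundedBy (trigHalf m x) ‖x‖ := by
  filter_upwards [trigL2_coe m x] with t ht
  change ‖trigL2 m x t‖ ≤ ‖x‖
  rw [ht, norm_smul]
  exact mul_le_of_le_one_left (norm_nonneg _) (abs_trig_le m t)

lemma IsBoundedBy.integrable_comp {u : HHalf n} {C : ℝ} (hu : IsBoundedBy u C) {R : Phase n → ℝ}
    (hR : Continuous R) : Integrable (fun t => R (u.toL2 t)) (volume : Measure Circ) := by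
  obtain ⟨K, hK⟩ := (isCompact_closedBall (0 : Phase n) C).exists_bound_of_continuousOn
    hR.continuousOn
  refine Integrable.of_bound (hR.comp_aestronglyMeasurable (Lp.aestronglyMeasurable u.toL2)) K ?_
  filter_upwards [hu] with t ht
  exact hK _ (mem_closedBall_zero_iff.2 ht)

lemma integrable_inner_opOf (M : Matrix (Idx n) (Idx n) ℝ) (u v : L2 n) :
    Integrable (fun t => ⟪opOf M (u t), v t⟫) (volume : Measure Circ) := by
  refine (MeasureTheory.L2.integrable_inner (𝕜 := ℝ) (actL2 M 0 u) v).congr ?_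
  filter_upwards [actL2_coe M 0 u] with t ht
  rw [ht, add_zero]

lemma actionFunctional_eq_of_integrable (M : Matrix (Idx n) (Idx n) ℝ) {R : Phase n → ℝ}
    {u : HHalf n} (hR : Integrable (fun t => R (u.toL2 t)) (volume : Measure Circ)) :
    actionFunctional (actionForm n) M R u
      = 1 / 2 * ⟪hessOp M u, u⟫ + ∫ t : Circ, R (u.toL2 t) := by
  rw [actionFunctional, integral_add ((integrable_inner_opOf M _ _).const_mul _) hR,
    integral_const_mul, inner_hessOp]
  ring

lemma isHessianAtZero_hessOp {M : Matrix (Idx n) (Idx n) ℝ} (hM : M.IsSymm) :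
    IsHessianAtZero (actionFunctional (actionForm n) M 0) (hessOp M) := by
  have h : actionFunctional (actionForm n) M 0 = fun u => 1 / 2 * ⟪hessOp M u, u⟫ :=
    funext fun u => by
      rw [actionFunctional_eq_of_integrable M (by simp)]
      simp
  rw [h]
  exact isHessianAtZero_quadratic (isSymmetric_hessOp hM)

lemma isLittleO_integral_comp_smul {R : Phase n → ℝ} (hR : Differentiable ℝ R)
    (hg : (fun x => gradient R x) =o[𝓝 0] fun x => x) {u : HHalf n} {C : ℝ}
    (hu : IsBoundedBy u C) :
    (fun s : ℝ => (∫ t : Circ, R ((s • u).toL2 t)) - ∫ _ : Circ, R 0) =o[𝓝 0] fun s => s ^ 2 := by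
  rw [Asymptotics.isLittleO_iff]
  intro c hc
  have hpi := Real.two_pi_pos
  have hK : 0 < 2 * Real.pi * (|C| + 1) ^ 2 := by positivity
  obtain ⟨δ, hδ, hball⟩ := exists_abs_sub_le_of_gradient hR hg (div_pos hc hK)
  have hev : ∀ᶠ s : ℝ in 𝓝 0, |s| * (|C| + 1) < δ := by
    have : Tendsto (fun s : ℝ => |s| * (|C| + 1)) (𝓝 0) (𝓝 (|(0 : ℝ)| * (|C| + 1))) :=
      ((continuous_abs.mul continuous_const).tendsto 0)
    rw [abs_zero, zero_mul] at this
    exact this.eventually (gt_mem_nhds hδ)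
  filter_upwards [hev] with s hs
  rw [← integral_sub ((hu.smul s).integrable_comp hR.continuous) (integrable_const _)]
  have hbound : ∀ᵐ t ∂(volume : Measure Circ), ‖R ((s • u).toL2 t) - R 0‖
      ≤ c / (2 * Real.pi * (|C| + 1) ^ 2) * (|s| * (|C| + 1)) ^ 2 := by
    filter_upwards [hu.smul s] with t ht
    have h1 : ‖(s • u).toL2 t‖ ≤ |s| * (|C| + 1) :=
      ht.trans (mul_le_mul_of_nonneg_left (by linarith [le_abs_self C]) (abs_nonneg s))
    refine (hball _ (h1.trans_lt hs)).trans ?_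
    gcongr
  refine (norm_integral_le_of_norm_le_const hbound).trans_eq ?_
  rw [measureReal_def, AddCircle.measure_univ, ENNReal.toReal_ofReal hpi.le, Real.norm_eq_abs,
    abs_pow]
  field_simp

/-- The Hessian at `0` of the action functional can only be `hessOp M`: along bounded functions
the higher order part does not contribute to the second derivative, and the trigonometric
polynomials, which are bounded, determine a symmetric operator. -/
lemma eq_hessOp_of_isHessianAtZero {M : Matrix (Idx n) (Idx n) ℝ} (hM : M.IsSymm)
    {R : Phase n → ℝ} (hR : Differentiable ℝ R)
    (hg : (fun x => gradient R x) =o[𝓝 0] fun x => x) {T : HHalf n →L[ℝ] HHalf n}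
    (hT : IsHessianAtZero (actionFunctional (actionForm n) M R) T) : T = hessOp M := by
  have hquad : ∀ (u : HHalf n) (C : ℝ), IsBoundedBy u C → ⟪T u, u⟫ = ⟪hessOp M u, u⟫ := by
    intro u C hu
    have hform : ∀ s : ℝ, actionFunctional (actionForm n) M R (s • u)
        = 1 / 2 * s ^ 2 * ⟪hessOp M u, u⟫ + ∫ t : Circ, R ((s • u).toL2 t) := fun s => by
      rw [actionFunctional_eq_of_integrable M ((hu.smul s).integrable_comp hR.continuous),
        map_smul, real_inner_smul_left, real_inner_smul_right]
      ring
    have hzero : actionFunctional (actionForm n) M R 0 = ∫ _ : Circ, R 0 := by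
      have h := hform 0
      rw [zero_smul] at h
      rw [h, zero_pow two_ne_zero, mul_zero, zero_mul, zero_add]
      refine integral_congr_ae ?_
      filter_upwards [Lp.coeFn_zero (Phase n) 2 (volume : Measure Circ)] with t ht
      rw [map_zero, ht, Pi.zero_apply]
    refine hT.inner_eq ((isLittleO_integral_comp_smul hR hg hu).congr_left fun s => ?_)
    rw [hform, hzero]
    ring
  set D := T - hessOp M with hD
  have hDsymm : ∀ u v, ⟪D u, v⟫ = ⟪u, D v⟫ := fun u v => by
    have h1 := isSymmetric_hessOp hM u v
    simp only [ContinuousLinearMap.coe_coe] at h1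
    simp only [hD, sub_apply, inner_sub_left, inner_sub_right]
    rw [h1, hT.isSymmetric u v, real_inner_comm (T v)]
  have hDquad : ∀ (u : HHalf n) (C : ℝ), IsBoundedBy u C → ⟪D u, u⟫ = 0 := fun u C hu => by
    simp only [hD, sub_apply, inner_sub_left]
    rw [hquad u C hu, sub_self]
  have hDtrig : ∀ i j (x y : Phase n), ⟪trigHalf j y, D (trigHalf i x)⟫ = 0 := fun i j x y => by
    have hi := isBoundedBy_trigHalf i x
    have hj := isBoundedBy_trigHalf j y
    have h := hDquad _ _ (hi.add hj)
    rw [map_add, inner_add_left, inner_add_right, inner_add_right, hDquad _ _ hi, hDquad _ _ hj,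
      hDsymm (trigHalf j y), real_inner_comm] at h
    linarith
  have hcoef_zero : ∀ v : HHalf n, (∀ j y, ⟪trigHalf j y, v⟫ = 0) → v = 0 := fun v hv => by
    refine half_ext fun j => ?_
    have h := hv j (hcoef j v)
    rw [inner_trigHalf, mul_eq_zero, inner_self_eq_zero] at h
    rw [map_zero]
    exact h.resolve_left (wt_pos j).ne'
  refine sub_eq_zero.1 ?_
  ext1 u
  refine hcoef_zero _ fun j y => ?_
  rw [← hDsymm, hcoef_zero _ fun i x => hDtrig j i y x, inner_zero_left]

end Hessian

/-! ### The Fourier modes as representations -/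

section Intertwining

variable {G : Type*} [Group G] [TopologicalSpace G]
variable {V : Type} [NormedAddCommGroup V] [InnerProductSpace ℝ V]
variable {W : Type} [AddCommGroup W] [Module ℝ W] [TopologicalSpace W] [IsTopologicalAddGroup W]
  [ContinuousSMul ℝ W] [T2Space W] [FiniteDimensional ℝ W]

/-- The contribution of an invariant subspace can be computed in a coordinate model of it. -/
lemma modeDiff_eq_of_intertwining {π : Representation ℝ G V} {A : ℝ → V →L[ℝ] V}
    (hA : IsFSPath π A) {E : Submodule ℝ V} (hE : IsFinSubrep π E) {σ : Representation ℝ G W}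
    (hσ : ∀ v, Continuous fun g => σ g v) {φ : W →ₗ[ℝ] V} (hφ : Function.Injective φ)
    (hr : LinearMap.range φ = E) (hφσ : ∀ g x, φ (σ g x) = π g (φ x))
    {B : ℝ → Module.End ℝ W} (hB : ∀ l ∈ Icc (0 : ℝ) 1, ∀ x, A l (φ x) = φ (B l x)) :
    modeDiff π A E
      = roClass σ (eigSum (B 0) (Iio 0)) - roClass σ (eigSum (B 1) (Iio 0)) := by
  have key : ∀ l ∈ Icc (0 : ℝ) 1, roClass π (eigSumOn (A l : V →ₗ[ℝ] V) E (Iio 0))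
      = roClass σ (eigSum (B l) (Iio 0)) := fun l hl => by
    have hcomm : ∀ g x, B l (σ g x) = σ g (B l x) := fun g x => hφ <| by
      rw [← hB l hl, hφσ, hφσ, hA.equivariant l hl, hB l hl]
    have hmap := map_eigSum (T := (A l : V →ₗ[ℝ] V)) hφ hr (hB l hl) (Iio 0)
    rw [← hmap]
    refine roClass_map hφ hφσ
      ⟨inferInstance, fun g => eigSum_le_comap_of_commute (hcomm g) _, fun v _ => hσ v⟩ ?_
    rw [hmap]
    exact isFinSubrep_eigSumOn hE (hA.equivariant l hl) _
  rw [modeDiff, key 0 (left_mem_Icc.2 zero_le_one), key 1 (right_mem_Icc.2 zero_le_one)]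

end Intertwining

variable {n : ℕ} {G₀ : Type*} [Group G₀]

lemma hcoef_loopRep (ρ : G₀ →* Matrix.orthogonalGroup (Idx n) ℝ) (x : G₀ × S1) (u : HHalf n)
    (m : ℤ) : hcoef m (loopRep ρ x u) = opOf (ρ x.1 : Matrix (Idx n) (Idx n) ℝ)
      (ccos (m • x.2.toAdd) • hcoef m u - csin (m • x.2.toAdd) • hcoef (-m) u) :=
  coef_actL2 _ _ _ _

/-- The span of the functions `sin(kt) a` and `cos(kt) b`. -/
def modeSpace (n k : ℕ) : Submodule ℝ (HHalf n) :=
  freqSpace n (({(k : ℤ), -(k : ℤ)} : Finset ℤ) : Set ℤ)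

lemma mem_modeSpace {k : ℕ} {u : HHalf n} :
    u ∈ modeSpace n k ↔ ∀ m : ℤ, m ≠ k → m ≠ -k → hcoef m u = 0 := by
  simp [modeSpace, mem_freqSpace]

lemma loopRep_mem_modeSpace (ρ : G₀ →* Matrix.orthogonalGroup (Idx n) ℝ) (x : G₀ × S1) {k : ℕ}
    {u : HHalf n} (hu : u ∈ modeSpace n k) : loopRep ρ x u ∈ modeSpace n k := by
  rw [mem_modeSpace] at hu ⊢
  intro m h1 h2
  rw [hcoef_loopRep, hu m h1 h2, hu (-m) (by lia) (by lia), smul_zero, smul_zero, sub_zero,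
    map_zero]

lemma hessOp_mem_modeSpace (M : Matrix (Idx n) (Idx n) ℝ) {k : ℕ} {u : HHalf n}
    (hu : u ∈ modeSpace n k) : hessOp M u ∈ modeSpace n k := by
  rw [mem_modeSpace] at hu ⊢
  intro m h1 h2
  rw [hcoef_hessOp, hu m h1 h2, hu (-m) (by lia) (by lia), map_zero, map_zero, smul_zero,
    smul_zero, add_zero]

section Topology

variable [TopologicalSpace G₀] {ρ : G₀ →* Matrix.orthogonalGroup (Idx n) ℝ}

lemma isFinSubrep_modeSpace (hρ : Continuous ρ) (k : ℕ) :
    IsFinSubrep (loopRep ρ) (modeSpace n k) := by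
  refine ⟨finiteDimensional_freqSpace (Finset.finite_toSet _),
    fun g u hu => loopRep_mem_modeSpace ρ g hu, fun v hv => ?_⟩
  rw [funext fun g => eq_sum_trigHalf (loopRep_mem_modeSpace ρ g hv)]
  refine continuous_finsetSum _ fun m _ =>
    (LinearMap.continuous_of_finiteDimensional (trigHalf m)).comp ?_
  simp only [hcoef_loopRep]
  have hg : Continuous fun g : G₀ × S1 => opOf (ρ g.1 : Matrix (Idx n) (Idx n) ℝ) :=
    continuous_opOf.comp (continuous_subtype_val.comp (hρ.comp continuous_fst))
  have hΘ : Continuous fun g : G₀ × S1 => m • g.2.toAdd :=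
    (continuous_toAdd.comp continuous_snd).zsmul m
  exact hg.clm_apply (((continuous_ccos.comp hΘ).smul continuous_const).sub
    ((continuous_csin.comp hΘ).smul continuous_const))

lemma isModeDecomposition_modeSpace (hρ : Continuous ρ) (S : ℝ → Matrix (Idx n) (Idx n) ℝ) :
    IsModeDecomposition (loopRep ρ) (fun l => hessOp (S l)) (modeSpace n) where
  isFinSubrep := isFinSubrep_modeSpace hρ
  orthogonal j k hjk x hx y hy := by
    rw [mem_modeSpace] at hx hy
    refine (hasSum_inner_half x y).unique (hasSum_zero.congr_fun fun m => ?_)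
    by_cases h : m = j ∨ m = -j
    · rw [hy m (by lia) (by lia), inner_zero_right, mul_zero]
    · rw [hx m (by tauto) (by tauto), inner_zero_left, mul_zero]
  total x hx := half_ext fun m => by
    have hm : trigHalf m (hcoef m x) ∈ modeSpace n m.natAbs :=
      trigHalf_mem_freqSpace (by simpa using m.natAbs_eq) _
    have h := hx _ _ hm
    rw [inner_trigHalf, mul_eq_zero, inner_self_eq_zero] at h
    rw [map_zero]
    exact h.resolve_left (wt_pos m).ne'
  invariant l _ k x hx := hessOp_mem_modeSpace (S l) hx

end Topology

/-- An orthogonal matrix preserving the form given by `J` commutes with `J`. -/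
lemma orthogonal_mul_J {g : Matrix (Idx n) (Idx n) ℝ} (hg : g ∈ Matrix.orthogonalGroup (Idx n) ℝ)
    (hJ : g.transpose * Matrix.J (Fin n) ℝ * g = Matrix.J (Fin n) ℝ) :
    g * Matrix.J (Fin n) ℝ = Matrix.J (Fin n) ℝ * g := by
  have h : g * g.transpose = 1 := (Matrix.mem_orthogonalGroup_iff _ _).1 hg
  rw [← hJ, ← Matrix.mul_assoc, ← Matrix.mul_assoc, h, Matrix.one_mul, hJ]

lemma hessOp_loopRep {ρ : G₀ →* Matrix.orthogonalGroup (Idx n) ℝ} {M : Matrix (Idx n) (Idx n) ℝ}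
    {x : G₀ × S1} (hJ : (ρ x.1 : Matrix (Idx n) (Idx n) ℝ).transpose * Matrix.J (Fin n) ℝ *
      (ρ x.1 : Matrix (Idx n) (Idx n) ℝ) = Matrix.J (Fin n) ℝ)
    (hM : (ρ x.1 : Matrix (Idx n) (Idx n) ℝ) * M = M * (ρ x.1 : Matrix (Idx n) (Idx n) ℝ))
    (u : HHalf n) : hessOp M (loopRep ρ x u) = loopRep ρ x (hessOp M u) := by
  have hJ' : ∀ y, opOf (Matrix.J (Fin n) ℝ) (opOf (ρ x.1 : Matrix (Idx n) (Idx n) ℝ) y)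
      = opOf (ρ x.1 : Matrix (Idx n) (Idx n) ℝ) (opOf (Matrix.J (Fin n) ℝ) y) := fun y => by
    rw [← opOf_mul, ← opOf_mul, orthogonal_mul_J (ρ x.1).2 hJ]
  have hM' : ∀ y, opOf M (opOf (ρ x.1 : Matrix (Idx n) (Idx n) ℝ) y)
      = opOf (ρ x.1 : Matrix (Idx n) (Idx n) ℝ) (opOf M y) := fun y => by
    rw [← opOf_mul, ← opOf_mul, hM]
  refine half_ext fun m => ?_
  simp only [hcoef_hessOp, hcoef_loopRep, hJ', hM', map_add, map_sub, map_smul, map_neg, neg_neg,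
    neg_smul, csin_neg, ccos_neg, wt_neg, Int.sign_neg, Int.cast_neg]
  module

/-- The constant functions, as a copy of `ℝ²ⁿ` (up to the factor that makes the trigonometric system
orthonormal). -/
def constEmb (n : ℕ) : (Idx n → ℝ) →ₗ[ℝ] HHalf n :=
  trigHalf 0 ∘ₗ (WithLp.linearEquiv 2 ℝ (Idx n → ℝ)).symm.toLinearMap

/-- The functions of frequency `k ≥ 1`, as a copy of `ℝ²ⁿ × ℝ²ⁿ`: the first component is the
coefficient of `trig k` (the normalized `sin(kt)`), the second one that of `trig (-k)` (the
normalized `cos(kt)`). -/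
def modeEmb (n k : ℕ) : (Idx n ⊕ Idx n → ℝ) →ₗ[ℝ] HHalf n :=
  trigHalf k ∘ₗ (WithLp.linearEquiv 2 ℝ (Idx n → ℝ)).symm.toLinearMap ∘ₗ
      LinearMap.funLeft ℝ ℝ Sum.inl
    + trigHalf (-k) ∘ₗ (WithLp.linearEquiv 2 ℝ (Idx n → ℝ)).symm.toLinearMap ∘ₗ
      LinearMap.funLeft ℝ ℝ Sum.inr

lemma hcoef_constEmb (m : ℤ) (x : Idx n → ℝ) :
    hcoef m (constEmb n x) = if m = 0 then WithLp.toLp 2 x else 0 :=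
  hcoef_trigHalf m 0 _

lemma hcoef_modeEmb {k : ℕ} (hk : k ≠ 0) (m : ℤ) (x : Idx n ⊕ Idx n → ℝ) :
    hcoef m (modeEmb n k x) = if m = k then WithLp.toLp 2 (x ∘ Sum.inl) else
      if m = -k then WithLp.toLp 2 (x ∘ Sum.inr) else 0 := by
  have h : hcoef m (modeEmb n k x) = hcoef m (trigHalf k (WithLp.toLp 2 (x ∘ Sum.inl)))
      + hcoef m (trigHalf (-k) (WithLp.toLp 2 (x ∘ Sum.inr))) := map_add (hcoef m) _ _
  rw [h, hcoef_trigHalf, hcoef_trigHalf]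
  split_ifs with h1 h2
  · lia
  all_goals simp

lemma constEmb_injective (n : ℕ) : Function.Injective (constEmb n) := fun x y h => by
  have h0 := congrArg (hcoef 0) h
  simpa [hcoef_constEmb] using h0

lemma modeEmb_injective {k : ℕ} (hk : k ≠ 0) : Function.Injective (modeEmb n k) := fun x y h => by
  have h1 := congrArg (hcoef k) h
  have h2 := congrArg (hcoef (-k)) h
  have hne : -(k : ℤ) ≠ k := by lia
  simp only [hcoef_modeEmb hk, if_true, if_neg hne] at h1 h2
  have h1' := WithLp.toLp_injective 2 h1
  have h2' := WithLp.toLp_injective 2 h2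
  ext (i | i)
  · exact congrFun h1' i
  · exact congrFun h2' i

lemma range_constEmb (n : ℕ) : LinearMap.range (constEmb n) = modeSpace n 0 := by
  refine le_antisymm ?_ fun u hu => ⟨(hcoef 0 u).ofLp, half_ext fun m => ?_⟩
  · rintro _ ⟨x, rfl⟩
    refine mem_modeSpace.2 fun m h1 _ => ?_
    rw [hcoef_constEmb, if_neg (by simpa using h1)]
  · rw [hcoef_constEmb]
    split_ifs with h
    · rw [h, WithLp.toLp_ofLp]
    · exact (mem_modeSpace.1 hu m (by simpa using h) (by simpa using h)).symm

lemma range_modeEmb {k : ℕ} (hk : k ≠ 0) : LinearMap.range (modeEmb n k) = modeSpace n k := by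
  refine le_antisymm ?_ fun u hu =>
    ⟨Sum.elim (hcoef k u).ofLp (hcoef (-k) u).ofLp, half_ext fun m => ?_⟩
  · rintro _ ⟨x, rfl⟩
    refine mem_modeSpace.2 fun m h1 h2 => ?_
    rw [hcoef_modeEmb hk, if_neg h1, if_neg h2]
  · rw [hcoef_modeEmb hk]
    split_ifs with h1 h2
    · rw [h1, Sum.elim_comp_inl, WithLp.toLp_ofLp]
    · rw [h2, Sum.elim_comp_inr, WithLp.toLp_ofLp]
    · exact (mem_modeSpace.1 hu m h1 h2).symm

lemma toLp_mulVec (M : Matrix (Idx n) (Idx n) ℝ) (x : Idx n → ℝ) :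
    WithLp.toLp 2 (M.mulVec x) = opOf M (WithLp.toLp 2 x) :=
  (Matrix.toEuclideanCLM_toLp M x).symm

lemma hessOp_constEmb (M : Matrix (Idx n) (Idx n) ℝ) (x : Idx n → ℝ) :
    hessOp M (constEmb n x) = constEmb n (Matrix.toLin' M x) := by
  refine half_ext fun m => ?_
  rw [hcoef_hessOp]
  simp only [hcoef_constEmb, Matrix.toLin'_apply, toLp_mulVec, neg_eq_zero]
  split_ifs with h
  · simp [h, wt_zero]
  · simp

lemma hessOp_modeEmb (M : Matrix (Idx n) (Idx n) ℝ) {k : ℕ} (hk : k ≠ 0)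
    (x : Idx n ⊕ Idx n → ℝ) :
    hessOp M (modeEmb n k x) = modeEmb n k (Matrix.toLin' (modeMatrix M k) x) := by
  refine half_ext fun m => ?_
  have hne : -(k : ℤ) ≠ k := by lia
  have hsign : (k : ℤ).sign = 1 := Int.sign_eq_one_of_pos (by lia)
  rw [hcoef_hessOp]
  simp only [hcoef_modeEmb hk, Matrix.toLin'_apply, modeMatrix, Matrix.fromBlocks_mulVec,
    Sum.elim_comp_inl, Sum.elim_comp_inr, Matrix.smul_mulVec, Matrix.neg_mulVec, WithLp.toLp_add,
    WithLp.toLp_smul, WithLp.toLp_neg, toLp_mulVec]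
  by_cases h1 : m = k
  · subst h1
    simp only [hne, if_true, if_false, hsign, wt_natCast hk]
    simp [add_comm]
  by_cases h2 : m = -k
  · subst h2
    simp only [hne, neg_neg, if_true, if_false, Int.sign_neg, hsign, wt_neg, wt_natCast hk]
    simp
  · rw [if_neg h1, if_neg h2, if_neg h1, if_neg h2, if_neg (by lia), if_neg (by lia)]
    simp

lemma constEmb_constRep (ρ : G₀ →* Matrix.orthogonalGroup (Idx n) ℝ) (g : G₀ × S1)
    (x : Idx n → ℝ) : constEmb n (constRep ρ g x) = loopRep ρ g (constEmb n x) := by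
  refine half_ext fun m => ?_
  rw [hcoef_loopRep]
  change hcoef m (constEmb n ((ρ g.1 : Matrix (Idx n) (Idx n) ℝ).mulVec x)) = _
  simp only [hcoef_constEmb, toLp_mulVec, neg_eq_zero]
  split_ifs with h
  · simp [h, ccos_zero, csin_zero]
  · simp

lemma modeEmb_modeRep (ρ : G₀ →* Matrix.orthogonalGroup (Idx n) ℝ) {k : ℕ} (hk : k ≠ 0)
    (g : G₀ × S1) (x : Idx n ⊕ Idx n → ℝ) :
    modeEmb n k (modeRep ρ k g x) = loopRep ρ g (modeEmb n k x) := by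
  refine half_ext fun m => ?_
  have hne : -(k : ℤ) ≠ k := by lia
  have hrep : modeRep ρ k g = Matrix.toLin' (rotBlock n k g.2.toAdd *
    Matrix.fromBlocks (ρ g.1 : Matrix (Idx n) (Idx n) ℝ) 0 0 (ρ g.1)) := rfl
  rw [hcoef_loopRep, hrep, Matrix.toLin'_apply, ← Matrix.mulVec_mulVec]
  simp only [hcoef_modeEmb hk, rotBlock, Matrix.fromBlocks_mulVec, Sum.elim_comp_inl,
    Sum.elim_comp_inr, Matrix.zero_mulVec, add_zero, zero_add, Matrix.smul_mulVec,
    Matrix.neg_mulVec, Matrix.one_mulVec, WithLp.toLp_add, WithLp.toLp_smul, WithLp.toLp_neg,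
    toLp_mulVec]
  by_cases h1 : m = k
  · subst h1
    simp only [hne, if_true, if_false, natCast_zsmul, map_sub, map_smul]
    module
  by_cases h2 : m = -k
  · subst h2
    simp only [hne, neg_neg, if_true, if_false, neg_smul, natCast_zsmul, map_sub, map_smul,
      map_neg, ccos_neg, csin_neg]
    module
  · rw [if_neg h1, if_neg h2, if_neg h1, if_neg h2, if_neg (by lia), if_neg (by lia)]
    simp

section Topology

variable [TopologicalSpace G₀] {ρ : G₀ →* Matrix.orthogonalGroup (Idx n) ℝ}

lemma continuous_constRep (hρ : Continuous ρ) (v : Idx n → ℝ) :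
    Continuous fun g => constRep ρ g v := by
  have h : Continuous fun g : G₀ × S1 => (ρ g.1 : Matrix (Idx n) (Idx n) ℝ) :=
    continuous_subtype_val.comp (hρ.comp continuous_fst)
  exact h.matrix_mulVec continuous_const

lemma continuous_modeRep (hρ : Continuous ρ) (k : ℕ) (v : Idx n ⊕ Idx n → ℝ) :
    Continuous fun g => modeRep ρ k g v := by
  have h : Continuous fun g : G₀ × S1 => (ρ g.1 : Matrix (Idx n) (Idx n) ℝ) :=
    continuous_subtype_val.comp (hρ.comp continuous_fst)
  have hΘ : Continuous fun g : G₀ × S1 => k • g.2.toAdd :=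
    (continuous_toAdd.comp continuous_snd).nsmul k
  have hc := (continuous_ccos.comp hΘ).smul
    (continuous_const (y := (1 : Matrix (Idx n) (Idx n) ℝ)))
  have hs := (continuous_csin.comp hΘ).smul
    (continuous_const (y := (1 : Matrix (Idx n) (Idx n) ℝ)))
  exact ((hc.matrix_fromBlocks hs.neg hs hc).matrix_mul
    (h.matrix_fromBlocks continuous_const continuous_const h)).matrix_mulVec continuous_const

variable {S : ℝ → Matrix (Idx n) (Idx n) ℝ}

lemma modeDiff_modeSpace_zero (hρ : Continuous ρ)
    (hA : IsFSPath (loopRep ρ) fun l => hessOp (S l)) :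
    modeDiff (loopRep ρ) (fun l => hessOp (S l)) (modeSpace n 0) = constTerm ρ S :=
  modeDiff_eq_of_intertwining (B := fun l => Matrix.toLin' (S l)) hA
    (isFinSubrep_modeSpace hρ 0) (continuous_constRep hρ) (constEmb_injective n)
    (range_constEmb n) (constEmb_constRep ρ) fun l _ => hessOp_constEmb (S l)

lemma modeDiff_modeSpace (hρ : Continuous ρ) (hA : IsFSPath (loopRep ρ) fun l => hessOp (S l))
    {k : ℕ} (hk : k ≠ 0) :
    modeDiff (loopRep ρ) (fun l => hessOp (S l)) (modeSpace n k) = modeTerm ρ S k :=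
  modeDiff_eq_of_intertwining (B := fun l => Matrix.toLin' (modeMatrix (S l) k)) hA
    (isFinSubrep_modeSpace hρ k) (continuous_modeRep hρ k) (modeEmb_injective hk)
    (range_modeEmb hk) (modeEmb_modeRep ρ hk) fun l _ => hessOp_modeEmb (S l) hk

end Topology

lemma finsum_nat_eq_add_finsum_pnat {X : Type*} [AddCommGroup X] {f : ℕ → X}
    (hf : {k | f k ≠ 0}.Finite) : ∑ᶠ k, f k = f 0 + ∑ᶠ k : ℕ+, f k := by
  have hr : (univ : Set ℕ) = insert 0 (range ((↑) : ℕ+ → ℕ)) := by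
    ext k
    rcases Nat.eq_zero_or_pos k with rfl | hk
    · simp
    · simpa using Or.inr ⟨⟨k, hk⟩, rfl⟩
  have h0 : (0 : ℕ) ∉ range ((↑) : ℕ+ → ℕ) := by
    rintro ⟨k, hk⟩
    exact k.ne_zero hk
  rw [← finsum_mem_univ, hr, finsum_mem_insert' f h0 (hf.subset inter_subset_right),
    finsum_mem_range PNat.coe_injective]

lemma IsHigherOrder.differentiable {R : ℝ → Phase n → ℝ} (hR : IsHigherOrder R) {l : ℝ}
    (hl : l ∈ Icc (0 : ℝ) 1) : Differentiable ℝ (R l) := by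
  have h : ContDiffOn ℝ 2 (fun x : Phase n => R l x) univ :=
    hR.contDiffOn.comp (f := fun x : Phase n => (l, x))
      (contDiff_const.prodMk contDiff_id).contDiffOn fun x _ => ⟨hl, mem_univ x⟩
  exact (contDiffOn_univ.1 h).differentiable two_ne_zero

end EquivariantSpectralFlow

end

theorem mainTheorem1 (n : ℕ)
    {G₀ : Type*} [Group G₀] [TopologicalSpace G₀] [IsTopologicalGroup G₀] [CompactSpace G₀]
    (ρ : G₀ →* Matrix.orthogonalGroup (Idx n) ℝ) (hρ : Continuous ρ)
    (hρJ : ∀ g, (ρ g : Matrix (Idx n) (Idx n) ℝ).transpose * Matrix.J (Fin n) ℝ *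
      (ρ g : Matrix (Idx n) (Idx n) ℝ) = Matrix.J (Fin n) ℝ)
    (S : ℝ → Matrix (Idx n) (Idx n) ℝ) (hS : ContinuousOn S (Icc 0 1))
    (hSsymm : ∀ l ∈ Icc (0 : ℝ) 1, (S l).IsSymm)
    (hρS : ∀ g, ∀ l ∈ Icc (0 : ℝ) 1,
      (ρ g : Matrix (Idx n) (Idx n) ℝ) * S l = S l * (ρ g : Matrix (Idx n) (Idx n) ℝ))
    (R : ℝ → Phase n → ℝ) (hR : IsHigherOrder R) :
    ∃ Γ : HHalf n →L[ℝ] HHalf n →L[ℝ] ℝ, IsActionForm Γ ∧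
    ∃ L : ℝ → HHalf n →L[ℝ] HHalf n,
      (∀ l ∈ Icc (0 : ℝ) 1, ∀ u v : HHalf n,
        ⟪L l u, v⟫ = Γ u v + ∫ t : Circ, ⟪opOf (S l) (u.toL2 t), v.toL2 t⟫) ∧
      (∀ l ∈ Icc (0 : ℝ) 1, IsHessianAtZero (actionFunctional Γ (S l) 0) (L l)) ∧
      (∀ l ∈ Icc (0 : ℝ) 1, ∀ T : HHalf n →L[ℝ] HHalf n,
        IsHessianAtZero (actionFunctional Γ (S l) (R l)) T → T = L l) ∧
      IsFSPath (loopRep ρ) L ∧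
      Nonempty (SpectralPartition L) ∧
      (∀ P : SpectralPartition L, P.flow (loopRep ρ) = sflG (loopRep ρ) L) ∧
      {k : ℕ+ | modeTerm ρ S k ≠ 0}.Finite ∧
      sflG (loopRep ρ) L = constTerm ρ S + ∑ᶠ k : ℕ+, modeTerm ρ S k := by
  have hFS : IsFSPath (loopRep ρ) fun l => hessOp (S l) :=
    { continuousOn := continuousOn_hessOp hS
      symmetric := fun l hl => isSymmetric_hessOp (hSsymm l hl)
      fredholm := fun l _ => isFredholm_hessOp (S l)
      equivariant := fun l hl g u => hessOp_loopRep (hρJ g.1) (hρS g.1 l hl) u }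
  have hM := isModeDecomposition_modeSpace hρ S
  have hfin := hM.finite_modeDiff_ne_zero hFS
  have hne := hM.nonempty_spectralPartition hFS
  have hsfl : sflG (loopRep ρ) (fun l => hessOp (S l))
      = ∑ᶠ k, modeDiff (loopRep ρ) (fun l => hessOp (S l)) (modeSpace n k) := by
    rw [sflG, dif_pos hne, hM.flow_eq hFS]
  refine ⟨actionForm n, isActionForm_actionForm n, fun l => hessOp (S l),
    fun l _ => inner_hessOp (S l), fun l hl => isHessianAtZero_hessOp (hSsymm l hl),
    fun l hl T hT => eq_hessOp_of_isHessianAtZero (hSsymm l hl) (hR.differentiable hl)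
      (hR.gradient_isLittleO l hl) hT,
    hFS, hne, fun P => (hM.flow_eq hFS P).trans hsfl.symm, ?_, ?_⟩
  · refine (hfin.preimage PNat.coe_injective.injOn).subset fun k hk => ?_
    rw [mem_preimage, mem_ofPred_eq, modeDiff_modeSpace hρ hFS k.ne_zero]
    exact hk
  · rw [hsfl, finsum_nat_eq_add_finsum_pnat hfin, modeDiff_modeSpace_zero hρ hFS]
    exact congrArg _ (finsum_congr fun k => modeDiff_modeSpace hρ hFS k.ne_zero)
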